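/- **Setting.** Let $\Phi$ be a countable Hilbertian nuclear space: a separable Fréchet space whose topology is given by an increasing sequence of compatible Hilbertian norms $\|\cdot\|_n$, $n\in\mathbb N_0$, such that for every $n$ there is $m>n$ for which the canonical injection $\Phi_m\to\Phi_n$ is Hilbert–Schmidt, $\Phi_n$ being the completion of $(\Phi,\|\cdot\|_n)$. Let $\Phi_{-n}$ be the dual of $\Phi_n$, with norm $\|\cdot\|_{-n}$ and inner product $\langle\cdot,\cdot\rangle_{-n}$, let $\Phi'=\bigcup_n\Phi_{-n}$ be the dual of $\Phi$, identify $\Phi_0$ with $\Phi_0'$ (so $\Phi\subset\Phi'$), and write $u[\phi]$ for the pairing. Assume there is a sequence $(\phi_j)$ in $\Phi$ that is a complete orthonormal system in $\Phi_0$ and a complete orthogonal system in every $\Phi_n$; let $\theta_p:\Phi_{-p}\to\Phi_p$ be the isometry with $\theta_p(\phi_j/\|\phi_j\|_{-p})=\phi_j/\|\phi_j\|_p$. Let $\mathbb X$ be a locally compact Polish space, $\nu$ a Borel measure on $\mathbb X$ that is finite on compact sets, $T\in(0,\infty)$, $\mathbb X_T=[0,T]\times\mathbb X$ and $\nu_T=\lambda_T\otimes\nu$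 with $\lambda_T$ Lebesgue measure on $[0,T]$. Let $\mathbb M$ be the set of Borel measures on $\mathbb X_T$ that are finite on compact sets, with the weakest topology making $\mu\mapsto\int f\,d\mu$ continuous for every $f\in C_c(\mathbb X_T)$. For measurable $g:\mathbb X_T\to[0,\infty)$ put $L_T(g)=\int l(g)\,d\nu_T$ with $l(r)=r\log r-r+1$. Let $S^N=\{g: L_T(g)\le N\}$ and $\mathbb S=\bigcup_{N\ge1}S^N$. For $g\in\mathbb S$ let $\nu_T^g(A)=\int_A g\,d\nu_T$, which belongs to $\mathbb M$; give $\mathbb S$ and each $S^N$ the topology induced by $g\mapsto\nu_T^g\in\mathbb M$. **Assumptions on the coefficients.** Let $A:[0,T]\times\Phi'\to\Phi'$ and $G:[0,T]\times\Phi'\times\mathbb X\to\Phi'$ be measurable, and suppose that there is $p_0$ such that for every $p\ge p_0$ there are $q=q(p)\ge p$ and $K=K(p)$ for which the following hold for all $t\in[0,T]$. * (a) For $u\in\Phi_{-p}$: $A(t,u)\in\Phi_{-q}$ and $G(t,u,\cdot)\in L^2(\mathbb X,\nu;\Phi_{-p})$, and the maps $u\mapsto A(t,u)\in\Phi_{-q}$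 and $u\mapsto G(t,u,\cdot)\in L^2(\mathbb X,\nu;\Phi_{-p})$ are continuous on $\Phi_{-p}$. * (b) $2A(t,\phi)[\theta_p\phi]\le K(1+\|\phi\|_{-p}^2)$ for all $\phi\in\Phi$. * (c) $\|A(t,u)\|_{-q}^2\le K(1+\|u\|_{-p}^2)$ and $\int_{\mathbb X}\|G(t,u,v)\|_{-p}^2\,\nu(dv)\le K(1+\|u\|_{-p}^2)$ for all $u\in\Phi_{-p}$. * (d) $2\langle A(t,u_1)-A(t,u_2),u_1-u_2\rangle_{-q}+\int_{\mathbb X}\|G(t,u_1,v)-G(t,u_2,v)\|_{-q}^2\,\nu(dv)\le K\|u_1-u_2\|_{-q}^2$ for all $u_1,u_2\in\Phi_{-p}$. Fix $p\ge p_0$, $q=q(p)$ and $X_0\in\Phi_{-p}$, and fix $p_1\ge p$ such that the canonical injection $\Phi_{-p}\to\Phi_{-p_1}$ is Hilbert–Schmidt. Suppose that for some $\delta_1,\delta\in(0,\infty)$ and all Borel $E\subset\mathbb X_T$ with $\nu_T(E)<\infty$, $$\int_E e^{\delta_1\|G(s,v)\|_{0,-p}^2}\,\nu(dv)\,ds<\infty,\qquad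 \int_E e^{\delta\|G(s,v)\|_{1,-q}^2}\,\nu(dv)\,ds<\infty,$$ where $$\|G(t,v)\|_{0,-p}=\sup_{u\in\Phi_{-p}}\frac{\|G(t,u,v)\|_{-p}}{1+\|u\|_{-p}},\qquad \|G(t,v)\|_{1,-q}=\sup_{u_1\ne u_2\in\Phi_{-q}}\frac{\|G(t,u_1,v)-G(t,u_2,v)\|_{-q}}{\|u_1-u_2\|_{-q}}$$ are assumed to be $\nu_T$-measurable functions. **Statement.** For every $g\in\mathbb S$ there is exactly one $\tilde X^g\in C([0,T]:\Phi_{-p_1})$ with $\sup_{t\in[0,T]}\|\tilde X^g_t\|_{-p}<\infty$ such that for all $\phi\in\Phi$ and $t\in[0,T]$ $$\tilde X^g_t[\phi]=X_0[\phi]+\int_0^tA(s,\tilde X^g_s)[\phi]\,ds+\int_0^t\int_{\mathbb X}G(s,\tilde X^g_s,v)[\phi]\,(g(s,v)-1)\,\nu(dv)\,ds$$ (both integrands being integrable over $[0,T]$ and $\mathbb X_T$ respectively), and $\mathcal G^0(\nu_T^g)=\tilde X^g$ is well defined as a function of the measure $\nu_T^g$. Moreover, for every $N\in\mathbb N$,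 if $g_n,g\in S^N$ and $g_n\to g$ as $n\to\infty$, then $$\mathcal G^0(\nu_T^{g_n})\to\mathcal G^0(\nu_T^g)\quad\text{in } C([0,T]:\Phi_{-p_1})$$ with the uniform topology. -/

import Mathlib

open MeasureTheory Filter Topology Set
open scoped ENNReal NNReal CompactlySupported

noncomputable section

/-! ### Countable Hilbertian nuclear spaces -/

/-- The Hilbertian norm `x ↦ √⟨x, x⟩` of an inner product on `Φ`, as a seminorm. -/
def coreNorm {Φ : Type*} [AddCommGroup Φ] [Module ℝ Φ] (c : InnerProductSpace.Core ℝ Φ) :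
    Seminorm ℝ Φ :=
  letI : NormedAddCommGroup Φ := c.toNormedAddCommGroup
  letI : InnerProductSpace ℝ Φ := InnerProductSpace.ofCore c.toCore
  normSeminorm ℝ Φ

/-- A countable Hilbertian nuclear space: a separable Fréchet space `Φ` whose topology is given by
an increasing sequence of compatible Hilbertian norms `‖·‖_n`, `n = 0, 1, 2, …`, together with a
sequence `φ_j` in `Φ` that is a complete orthonormal system for `‖·‖_0` and a complete orthogonal
system for every `‖·‖_n` (it is then automatically one for the dual norms `‖·‖_{-n}`).
A system is complete for `‖·‖_n` when its span is dense in `Φ`, equivalently in the completion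
`Φ_n`, for `‖·‖_n`. Nuclearity: for each `n` there is `m > n` with `Φ_m → Φ_n` Hilbert–Schmidt, the
Hilbert–Schmidt norm being computed in the complete orthonormal system `φ_j / ‖φ_j‖_m` of `Φ_m`. -/
structure CHNS (Φ : Type*) [AddCommGroup Φ] [Module ℝ Φ] [UniformSpace Φ] [IsUniformAddGroup Φ] where
  /-- the inner product `⟨·,·⟩_n` -/
  ip : ℕ → InnerProductSpace.Core ℝ Φ
  /-- the sequence `φ_j` -/
  phi : ℕ → Φ
  withSeminorms : WithSeminorms (fun n => coreNorm (ip n))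
  complete : CompleteSpace Φ
  separable : TopologicalSpace.SeparableSpace Φ
  increasing : ∀ m n, m ≤ n → ∀ x, coreNorm (ip m) x ≤ coreNorm (ip n) x
  compatible : ∀ m n (x : ℕ → Φ),
    Tendsto (fun k : ℕ × ℕ => coreNorm (ip m) (x k.1 - x k.2)) atTop (𝓝 0) →
    Tendsto (fun k : ℕ × ℕ => coreNorm (ip n) (x k.1 - x k.2)) atTop (𝓝 0) →
    Tendsto (fun k => coreNorm (ip m) (x k)) atTop (𝓝 0) →
    Tendsto (fun k => coreNorm (ip n) (x k)) atTop (𝓝 0)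
  normalized : ∀ j, coreNorm (ip 0) (phi j) = 1
  orthogonal : ∀ n i j, i ≠ j → (ip n).inner (phi i) (phi j) = 0
  total : ∀ n x, ∀ ε > 0, ∃ y ∈ Submodule.span ℝ (Set.range phi), coreNorm (ip n) (x - y) < ε
  nuclear : ∀ n, ∃ m, n < m ∧
    Summable (fun j => (coreNorm (ip n) ((coreNorm (ip m) (phi j))⁻¹ • phi j)) ^ 2)

namespace CHNS

variable {Φ : Type*} [AddCommGroup Φ] [Module ℝ Φ] [UniformSpace Φ] [IsUniformAddGroup Φ]

/-- The vector space `Φ`, equipped with the single norm `‖·‖_n`. -/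
def Level (_S : CHNS Φ) (_n : ℕ) : Type _ := Φ

instance (S : CHNS Φ) (n : ℕ) : NormedAddCommGroup (S.Level n) :=
  @InnerProductSpace.Core.toNormedAddCommGroup ℝ Φ _ _ _ (S.ip n)

instance (S : CHNS Φ) (n : ℕ) : InnerProductSpace ℝ (S.Level n) :=
  InnerProductSpace.ofCore (S.ip n).toCore

/-- `Φ_{-n}`: the bounded linear functionals on `(Φ, ‖·‖_n)`, equivalently on its completion `Φ_n`,
with the operator norm `‖·‖_{-n}`. -/
abbrev Neg (S : CHNS Φ) (n : ℕ) : Type _ := StrongDual ℝ (S.Level n)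

/-- The identity `Φ → (Φ, ‖·‖_n)`, which is continuous. -/
def toLevel (S : CHNS Φ) (n : ℕ) : Φ →L[ℝ] S.Level n where
  toFun x := x
  map_add' _ _ := rfl
  map_smul' _ _ := rfl
  cont := by
    have h := S.withSeminorms.continuous_seminorm n
    refine continuous_iff_continuousAt.2 fun x => ?_
    refine tendsto_iff_norm_sub_tendsto_zero.2 ?_
    have h2 : Continuous fun y : Φ => coreNorm (S.ip n) (y - x) :=
      h.comp (continuous_id.sub continuous_const)
    have h3 := h2.tendsto x
    simp only [sub_self, map_zero] at h3
    exact h3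

/-- The inclusion `Φ_{-n} ⊆ Φ'`. -/
def incl (S : CHNS Φ) (n : ℕ) (u : S.Neg n) : StrongDual ℝ Φ := u.comp (S.toLevel n)

/-- The embedding `Φ ⊆ Φ_0 = Φ_0' ⊆ Φ'`, `φ ↦ ⟨φ, ·⟩_0`. -/
def embed (S : CHNS Φ) (x : Φ) : StrongDual ℝ Φ :=
  S.incl 0 (innerSL ℝ (S.toLevel 0 x))

/-- `‖w‖_{-n} = sup_φ |w[φ]| / ‖φ‖_n ∈ [0, ∞]` for `w ∈ Φ'`; thus `w ∈ Φ_{-n}` if and only if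
`‖w‖_{-n} < ∞`. -/
def negNorm (S : CHNS Φ) (n : ℕ) (w : StrongDual ℝ Φ) : ℝ≥0∞ :=
  ⨆ x : Φ, ‖w x‖ₑ / ‖S.toLevel n x‖ₑ

/-- The inner product `⟨w, z⟩_{-n}` of `w, z ∈ Φ_{-n}`, recovered from the Hilbertian norm
`‖·‖_{-n}` by polarization. -/
def negInner (S : CHNS Φ) (n : ℕ) (w z : StrongDual ℝ Φ) : ℝ :=
  ((S.negNorm n (w + z)).toReal ^ 2 - (S.negNorm n (w - z)).toReal ^ 2) / 4

/-- `φ_j^n = φ_j / ‖φ_j‖_n` for `n ≥ 0`. -/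
def phiN (S : CHNS Φ) (n : ℕ) (j : ℕ) : Φ := ‖S.toLevel n (S.phi j)‖⁻¹ • S.phi j

/-- `φ_j^{-n} = φ_j / ‖φ_j‖_{-n}`. -/
def phiNeg (S : CHNS Φ) (n : ℕ) (j : ℕ) : StrongDual ℝ Φ :=
  (S.negNorm n (S.embed (S.phi j))).toReal⁻¹ • S.embed (S.phi j)

/-- `θ_p φ` for `φ ∈ Φ`, where `θ_p : Φ_{-p} → Φ_p` is the isometry with `θ_p(φ_j^{-p}) = φ_j^p`;
the coefficient of `φ` along `φ_j^{-p}` is `φ[φ_j^p]`, and the series converges in `Φ`. -/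
def theta (S : CHNS Φ) (p : ℕ) (x : Φ) : Φ := ∑' j, S.embed x (S.phiN p j) • S.phiN p j

/-- The canonical injection `Φ_{-p} → Φ_{-r}` is Hilbert–Schmidt. -/
def InjectionHS (S : CHNS Φ) (p r : ℕ) : Prop :=
  ∑' j, S.negNorm r (S.phiNeg p j) ^ 2 < ∞

end CHNS

/-! ### Measures finite on compact sets and controls -/

/-- `M_FC(Y)`: the Borel measures on `Y` that are finite on compact sets. -/
def FCMeasure (Y : Type*) [TopologicalSpace Y] [MeasurableSpace Y] : Type _ :=
  {μ : Measure Y // IsFiniteMeasureOnCompacts μ}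

/-- The weakest topology on `M_FC(Y)` that makes `μ ↦ ∫ f dμ` continuous for all `f ∈ C_c(Y)`. -/
instance (Y : Type*) [TopologicalSpace Y] [MeasurableSpace Y] : TopologicalSpace (FCMeasure Y) :=
  TopologicalSpace.induced (fun μ (f : C_c(Y, ℝ)) => ∫ y, f y ∂μ.1) inferInstance

/-- `l(r) = r log r - r + 1`. -/
def ell (r : ℝ≥0) : ℝ := (r : ℝ) * Real.log r - r + 1

theorem measurable_ell : Measurable ell := by
  unfold ell
  fun_prop

theorem le_ell_add_two (r : ℝ≥0) : (r : ℝ) ≤ ell r + 2 := by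
  unfold ell
  rcases eq_or_lt_of_le r.coe_nonneg with h | h
  · rw [← h]
    norm_num
  · have h1 : Real.log (Real.exp 1 / r) ≤ Real.exp 1 / r - 1 :=
      Real.log_le_sub_one_of_pos (by positivity)
    rw [Real.log_div (Real.exp_pos 1).ne' h.ne', Real.log_exp] at h1
    have h2 : (r : ℝ) * (1 - Real.log r) ≤ r * (Real.exp 1 / r - 1) :=
      mul_le_mul_of_nonneg_left h1 h.le
    have h3 : (r : ℝ) * (Real.exp 1 / r - 1) = Real.exp 1 - r := by
      field_simp
    have h4 := Real.exp_one_lt_d9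
    linarith

section Controls

variable {X : Type*} [TopologicalSpace X] [MeasurableSpace X]

/-- `λ_T`: Lebesgue measure on `[0, T]`. -/
abbrev lamT (T : ℝ) : Measure (Icc (0 : ℝ) T) := (volume : Measure ℝ).comap Subtype.val

/-- `ν_T = λ_T ⊗ ν` on `X_T = [0, T] × X`. -/
abbrev nuT (T : ℝ) (ν : Measure X) : Measure (Icc (0 : ℝ) T × X) :=
  (lamT T).prod ν

/-- `L_T(g) = ∫ l(g) dν_T ∈ [0, ∞]`. -/
def LTcost (T : ℝ) (ν : Measure X) (g : Icc (0 : ℝ) T × X → ℝ≥0) : ℝ≥0∞ :=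
  ∫⁻ z, ENNReal.ofReal (ell (g z)) ∂(nuT T ν)

/-- `𝕊 = ⋃_N S^N`: the measurable `g : X_T → [0, ∞)` with `L_T(g) < ∞`. -/
def Control (T : ℝ) (ν : Measure X) : Type _ :=
  {g : Icc (0 : ℝ) T × X → ℝ≥0 // Measurable g ∧ LTcost T ν g < ∞}

/-- `S^N = {g : L_T(g) ≤ N}`, as a subset of `𝕊`. -/
def SN (T : ℝ) (ν : Measure X) (N : ℕ) : Set (Control T ν) := {g | LTcost T ν g.1 ≤ N}

/-- `ν_T^g(A) = ∫_A g dν_T`. -/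
def nuTg (T : ℝ) (ν : Measure X) (g : Icc (0 : ℝ) T × X → ℝ≥0) :
    Measure (Icc (0 : ℝ) T × X) :=
  (nuT T ν).withDensity (fun z => (g z : ℝ≥0∞))

theorem finiteOnCompacts_nuTg [OpensMeasurableSpace X] [T2Space X] (T : ℝ) (ν : Measure X)
    [SFinite ν] [IsFiniteMeasureOnCompacts ν] (g : Control T ν) :
    IsFiniteMeasureOnCompacts (nuTg T ν g.1) := by
  have hvol : IsFiniteMeasure (lamT T) := by
    refine ⟨?_⟩
    rw [lamT, comap_subtype_coe_apply measurableSet_Icc, image_univ, Subtype.range_coe]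
    exact measure_Icc_lt_top
  refine ⟨fun K hK => ?_⟩
  set K' : Set (Icc (0 : ℝ) T × X) := univ ×ˢ (Prod.snd '' K)
  have hc : IsCompact (Prod.snd '' K) := hK.image continuous_snd
  have hKK : K ⊆ K' := fun z hz => ⟨mem_univ _, z, hz, rfl⟩
  refine lt_of_le_of_lt (measure_mono hKK) ?_
  have hm : MeasurableSet K' := MeasurableSet.univ.prod hc.measurableSet
  rw [nuTg, withDensity_apply _ hm]
  have hfin : nuT T ν K' < ∞ := by
    rw [nuT, Measure.prod_prod]
    exact ENNReal.mul_lt_top (measure_lt_top _ _) hc.measure_lt_top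
  calc ∫⁻ z in K', (g.1 z : ℝ≥0∞) ∂(nuT T ν)
      ≤ ∫⁻ z in K', (ENNReal.ofReal (ell (g.1 z)) + 2) ∂(nuT T ν) := by
        refine lintegral_mono fun z => ?_
        have h := ENNReal.ofReal_le_ofReal (le_ell_add_two (g.1 z))
        rw [ENNReal.ofReal_coe_nnreal] at h
        refine h.trans (ENNReal.ofReal_add_le.trans ?_)
        simp
    _ = ∫⁻ z in K', ENNReal.ofReal (ell (g.1 z)) ∂(nuT T ν) + 2 * nuT T ν K' := by
        rw [lintegral_add_right _ measurable_const, setLIntegral_const]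
    _ < ∞ := by
        refine ENNReal.add_lt_top.2 ⟨?_, ENNReal.mul_lt_top (by simp) hfin⟩
        exact lt_of_le_of_lt (setLIntegral_le_lintegral _ _) g.2.2

/-- The identification of `g ∈ 𝕊` with `ν_T^g ∈ M_FC(X_T)`. -/
def controlMeasure [OpensMeasurableSpace X] [T2Space X] (T : ℝ) (ν : Measure X)
    [SFinite ν] [IsFiniteMeasureOnCompacts ν] (g : Control T ν) :
    FCMeasure (Icc (0 : ℝ) T × X) :=
  ⟨nuTg T ν g.1, finiteOnCompacts_nuTg T ν g⟩

/-- The topology on controls induced by `g ↦ ν_T^g`. -/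
instance [OpensMeasurableSpace X] [T2Space X] (T : ℝ) (ν : Measure X)
    [SFinite ν] [IsFiniteMeasureOnCompacts ν] : TopologicalSpace (Control T ν) :=
  TopologicalSpace.induced (controlMeasure T ν) inferInstance

end Controls

/-! ### Coefficients -/

section Coefficients

variable {Φ : Type*} [AddCommGroup Φ] [Module ℝ Φ] [UniformSpace Φ] [IsUniformAddGroup Φ]
  {X : Type*} [MeasurableSpace X]

/-- The `σ`-algebra on `Φ'` generated by the evaluations `u ↦ u[φ]`, `φ ∈ Φ`; its trace on each
separable Hilbert space `Φ_{-n}` is the Borel `σ`-algebra of `Φ_{-n}`. -/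
abbrev dualSigma (Φ : Type*) [AddCommGroup Φ] [Module ℝ Φ] [UniformSpace Φ] :
    MeasurableSpace (StrongDual ℝ Φ) :=
  MeasurableSpace.comap (fun u (x : Φ) => u x) MeasurableSpace.pi

/-- `A : [0,T] × Φ' → Φ'` and `G : [0,T] × Φ' × X → Φ'` are (jointly) measurable. -/
def MeasurableCoeff {T : ℝ} (A : Icc (0 : ℝ) T → StrongDual ℝ Φ → StrongDual ℝ Φ)
    (G : Icc (0 : ℝ) T → StrongDual ℝ Φ → X → StrongDual ℝ Φ) : Prop :=
  letI : MeasurableSpace (StrongDual ℝ Φ) := dualSigma Φ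
  Measurable (fun z : Icc (0 : ℝ) T × StrongDual ℝ Φ => A z.1 z.2) ∧
  Measurable (fun z : Icc (0 : ℝ) T × StrongDual ℝ Φ × X => G z.1 z.2.1 z.2.2)

/-- The continuity, coercivity, growth and monotonicity conditions on `A` and `G`, for given
`p ≤ q` and constant `K`. -/
structure CoeffCondition (S : CHNS Φ) {T : ℝ} (ν : Measure X)
    (A : Icc (0 : ℝ) T → StrongDual ℝ Φ → StrongDual ℝ Φ)
    (G : Icc (0 : ℝ) T → StrongDual ℝ Φ → X → StrongDual ℝ Φ) (p q : ℕ) (K : ℝ) : Prop where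
  mem_A : ∀ t (u : S.Neg p), S.negNorm q (A t (S.incl p u)) < ∞
  mem_G : ∀ t (u : S.Neg p) v, S.negNorm p (G t (S.incl p u) v) < ∞
  memL2_G : ∀ t (u : S.Neg p), ∫⁻ v, S.negNorm p (G t (S.incl p u) v) ^ 2 ∂ν < ∞
  continuous_A : ∀ t (u : S.Neg p), Tendsto
    (fun w : S.Neg p => S.negNorm q (A t (S.incl p w) - A t (S.incl p u))) (𝓝 u) (𝓝 0)
  continuous_G : ∀ t (u : S.Neg p), Tendsto
    (fun w : S.Neg p => ∫⁻ v, S.negNorm p (G t (S.incl p w) v - G t (S.incl p u) v) ^ 2 ∂ν)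
    (𝓝 u) (𝓝 0)
  coercive : ∀ t (x : Φ),
    2 * A t (S.embed x) (S.theta p x) ≤ K * (1 + (S.negNorm p (S.embed x)).toReal ^ 2)
  growth_A : ∀ t (u : S.Neg p),
    S.negNorm q (A t (S.incl p u)) ^ 2 ≤ ENNReal.ofReal (K * (1 + ‖u‖ ^ 2))
  growth_G : ∀ t (u : S.Neg p),
    ∫⁻ v, S.negNorm p (G t (S.incl p u) v) ^ 2 ∂ν ≤ ENNReal.ofReal (K * (1 + ‖u‖ ^ 2))
  monotone : ∀ t (u₁ u₂ : S.Neg p),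
    2 * S.negInner q (A t (S.incl p u₁) - A t (S.incl p u₂)) (S.incl p u₁ - S.incl p u₂)
      + (∫⁻ v, S.negNorm q (G t (S.incl p u₁) v - G t (S.incl p u₂) v) ^ 2 ∂ν).toReal
      ≤ K * (S.negNorm q (S.incl p u₁ - S.incl p u₂)).toReal ^ 2

/-- `‖G(t,v)‖_{0,-p} = sup_{u ∈ Φ_{-p}} ‖G(t,u,v)‖_{-p} / (1 + ‖u‖_{-p})`. -/
def growthNorm (S : CHNS Φ) {T : ℝ} (G : Icc (0 : ℝ) T → StrongDual ℝ Φ → X → StrongDual ℝ Φ)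
    (p : ℕ) (z : Icc (0 : ℝ) T × X) : ℝ≥0∞ :=
  ⨆ u : S.Neg p, S.negNorm p (G z.1 (S.incl p u) z.2) / (1 + ‖u‖ₑ)

/-- `‖G(t,v)‖_{1,-q} = sup_{u₁ ≠ u₂ ∈ Φ_{-q}} ‖G(t,u₁,v) - G(t,u₂,v)‖_{-q} / ‖u₁ - u₂‖_{-q}`. -/
def lipNorm (S : CHNS Φ) {T : ℝ} (G : Icc (0 : ℝ) T → StrongDual ℝ Φ → X → StrongDual ℝ Φ)
    (q : ℕ) (z : Icc (0 : ℝ) T × X) : ℝ≥0∞ :=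
  ⨆ (u₁ : S.Neg q) (u₂ : S.Neg q) (_ : u₁ ≠ u₂),
    S.negNorm q (G z.1 (S.incl q u₁) z.2 - G z.1 (S.incl q u₂) z.2) / ‖u₁ - u₂‖ₑ

/-- There is `δ ∈ (0, ∞)` such that `∫_E exp(δ f²) dν_T < ∞` for all Borel `E` with
`ν_T(E) < ∞`. -/
def ExpIntegrable {T : ℝ} (ν : Measure X) (f : Icc (0 : ℝ) T × X → ℝ≥0∞) : Prop :=
  ∃ δ : ℝ, 0 < δ ∧ ∀ E : Set (Icc (0 : ℝ) T × X), MeasurableSet E → nuT T ν E < ∞ →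
    ∫⁻ z in E, EReal.exp ((ENNReal.ofReal δ * f z ^ 2 : ℝ≥0∞) : EReal) ∂(nuT T ν) < ∞

end Coefficients

/-! ### The skeleton equation and its solution map -/

section Skeleton

variable {Φ : Type*} [AddCommGroup Φ] [Module ℝ Φ] [UniformSpace Φ] [IsUniformAddGroup Φ]
  {X : Type*} [TopologicalSpace X] [MeasurableSpace X]

/-- `Y ∈ C([0,T] : Φ_{-p₁})` solves the skeleton equation with control `g` and initial value
`X₀ ∈ Φ_{-p}`, and is bounded in `Φ_{-p}`. -/
structure IsSkeletonSolution (S : CHNS Φ) {T : ℝ} (ν : Measure X)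
    (A : Icc (0 : ℝ) T → StrongDual ℝ Φ → StrongDual ℝ Φ)
    (G : Icc (0 : ℝ) T → StrongDual ℝ Φ → X → StrongDual ℝ Φ)
    (p p₁ : ℕ) (X₀ : S.Neg p) (g : Control T ν) (Y : C(Icc (0 : ℝ) T, S.Neg p₁)) : Prop where
  bounded : ⨆ t, S.negNorm p (S.incl p₁ (Y t)) < ∞
  integrable_A : ∀ x : Φ, Integrable (fun s => A s (S.incl p₁ (Y s)) x) (lamT T)
  integrable_G : ∀ x : Φ,
    Integrable (fun z => G z.1 (S.incl p₁ (Y z.1)) z.2 x * ((g.1 z : ℝ) - 1)) (nuT T ν)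
  equation : ∀ (x : Φ) (t : Icc (0 : ℝ) T),
    S.incl p₁ (Y t) x = S.incl p X₀ x
      + ∫ s in {s | s ≤ t}, A s (S.incl p₁ (Y s)) x ∂(lamT T)
      + ∫ z in {z | z.1 ≤ t}, G z.1 (S.incl p₁ (Y z.1)) z.2 x * ((g.1 z : ℝ) - 1) ∂(nuT T ν)

open Classical in
/-- The map `𝒢⁰ : M_FC(X_T) → C([0,T] : Φ_{-p₁})`: `𝒢⁰(ν_T^g)` is the solution of the skeleton
equation with control `g`. (On measures for which there is no such solution the value is `0`.) -/
def skeletonMap [OpensMeasurableSpace X] [T2Space X] (S : CHNS Φ) {T : ℝ} (ν : Measure X)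
    [SFinite ν] [IsFiniteMeasureOnCompacts ν]
    (A : Icc (0 : ℝ) T → StrongDual ℝ Φ → StrongDual ℝ Φ)
    (G : Icc (0 : ℝ) T → StrongDual ℝ Φ → X → StrongDual ℝ Φ)
    (p p₁ : ℕ) (X₀ : S.Neg p) (m : FCMeasure (Icc (0 : ℝ) T × X)) :
    C(Icc (0 : ℝ) T, S.Neg p₁) :=
  if h : ∃ Y, ∃ g : Control T ν, controlMeasure T ν g = m ∧
      IsSkeletonSolution S ν A G p p₁ X₀ g Y
  then h.choose else 0

end Skeleton

end

/-! Coordinates. The `φ_j` are orthogonal at every level, so an element `w` of `Φ'` is its sequence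
of coordinates `w[φ_j]`, and `‖w‖_{-n}² = ∑ w[φ_j]² / ‖φ_j‖_n²` (`CHNS.negNorm_sq`). Energy
estimates are done on finitely many coordinates and passed to the limit. When `Φ_{-p} → Φ_{-p₁}` is
Hilbert–Schmidt, balls of `Φ_{-p}` are compact in `Φ_{-p₁}` (`CHNS.InjectionHS.isCompact_ball`).

Controls. A control enters linearly through `g - 1` and is bounded only in entropy. The
Fenchel–Young inequality for `l`, rescaled by `ε`, yields `∫ a |g - 1| ≤ C ∫ a² + ε` uniformly over
controls of cost at most `N` and over `0 ≤ a ≤ h`, provided `exp(δ h²)` is integrable over some set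
`{h > L}` (`lintegral_mul_abs_sub_one_le`). The exponential hypothesis speaks only of sets of finite
measure; since `ν_T` has no atoms in the time direction, it forces some upper level set to have
finite measure (`ExpIntegrable.exists_expTail`). The uniform bound gives integrability,
equicontinuity in time, and passage to the limit when `g_n → g` vaguely and the integrands converge
in `L²` (`tendsto_integral_mul_sub_one`, `GrowthContext.tendsto_skInt`).

Uniqueness. In the `‖·‖_{-q}` energy of a difference `Y - Z` the control contributes twice the
integral of `⟨Y - Z, G(Y) - G(Z)⟩_{-q} (g - 1)`. The Lipschitz norm has a square-exponential tail,
so this is at most `∫ ‖G(Y) - G(Z)‖_{-q}² dν + κ(s) ‖Y - Z‖_{-q}²` with `κ` integrable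
(`exists_absorbing_rate`). The first term is exactly the one on the left of the monotonicity
condition, and Gronwall finishes (`skeleton_unique`).

Existence. The equation is projected to `d` coordinates and the state in the coefficients is delayed
by `δ`; such an equation is solved step by step, with no regularity of the coefficients in the state
(`GrowthContext.exists_galerkin`). Coercivity bounds the drift paired with the delayed state; the
error of replacing the current state by the delayed one is made harmless by taking `δ` small
depending on `d`; the control costs an integrable rate of mass bounded in terms of `N`. Hence a
bound in `Φ_{-p}` uniform in `d` and in the control (`GrowthContext.galerkin_bound`). Arzelà–Ascoli
in `Φ_{-p₁}` and identification of limits (`GrowthContext.exists_subseq_solution`) produce a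
solution. Bounds come from level `p`, while limits are taken by continuity of the coefficients at
level `p₁`, where the paths converge.

Continuity. The same compactness, applied to the solutions for `g_n`, shows that every subsequence
has a further one converging to a solution for `g`, which uniqueness identifies. -/

set_option linter.unusedSectionVars false

noncomputable section

/-! ### Coordinates in `Φ` and Parseval's identity for the dual norms -/

namespace CHNS

variable {Φ : Type*} [AddCommGroup Φ] [Module ℝ Φ] [UniformSpace Φ] [IsUniformAddGroup Φ]
  (S : CHNS Φ)

/-- The weight `‖φ_j‖_n`. -/
def wt (n j : ℕ) : ℝ := ‖S.toLevel n (S.phi j)‖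

/-- The coordinate `⟨φ_j, x⟩_0`. -/
def coef (x : Φ) (j : ℕ) : ℝ := inner ℝ (S.toLevel 0 (S.phi j)) (S.toLevel 0 x)

/-- The partial sums `∑_{j < J} ⟨φ_j, x⟩_0 φ_j`. -/
def proj (J : ℕ) (x : Φ) : Φ := ∑ j ∈ Finset.range J, S.coef x j • S.phi j

theorem norm_toLevel_mono {m n : ℕ} (h : m ≤ n) (x : Φ) :
    ‖S.toLevel m x‖ ≤ ‖S.toLevel n x‖ := S.increasing m n h x

theorem wt_zero (j : ℕ) : S.wt 0 j = 1 := S.normalized j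

theorem wt_mono {m n : ℕ} (h : m ≤ n) (j : ℕ) : S.wt m j ≤ S.wt n j := S.norm_toLevel_mono h _

theorem one_le_wt (n j : ℕ) : 1 ≤ S.wt n j := by
  rw [← S.wt_zero j]; exact S.wt_mono (Nat.zero_le n) j

theorem wt_pos (n j : ℕ) : 0 < S.wt n j := zero_lt_one.trans_le (S.one_le_wt n j)

theorem inner_phi_phi (n : ℕ) {i j : ℕ} (h : i ≠ j) :
    inner ℝ (S.toLevel n (S.phi i)) (S.toLevel n (S.phi j)) = 0 := S.orthogonal n i j h

theorem inner_phi_self (n j : ℕ) :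
    inner ℝ (S.toLevel n (S.phi j)) (S.toLevel n (S.phi j)) = S.wt n j ^ 2 := by
  rw [real_inner_self_eq_norm_sq]; rfl

theorem coef_phi (i j : ℕ) : S.coef (S.phi i) j = if j = i then 1 else 0 := by
  unfold coef
  split_ifs with h
  · rw [h, inner_phi_self, wt_zero, one_pow]
  · exact S.inner_phi_phi 0 h

theorem coef_add (x y : Φ) (j : ℕ) : S.coef (x + y) j = S.coef x j + S.coef y j := by
  simp [coef, inner_add_right]

theorem coef_sub (x y : Φ) (j : ℕ) : S.coef (x - y) j = S.coef x j - S.coef y j := by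
  simp [coef, inner_sub_right]

theorem coef_smul (c : ℝ) (x : Φ) (j : ℕ) : S.coef (c • x) j = c * S.coef x j := by
  simp [coef, inner_smul_right]

theorem coef_zero (j : ℕ) : S.coef 0 j = 0 := by
  simp [coef]

theorem abs_coef_le (n : ℕ) (x : Φ) (j : ℕ) : |S.coef x j| ≤ ‖S.toLevel n x‖ := by
  refine (abs_real_inner_le_norm _ _).trans ?_
  have : ‖S.toLevel 0 (S.phi j)‖ = 1 := S.wt_zero j
  rw [this, one_mul]
  exact S.norm_toLevel_mono (Nat.zero_le n) x

theorem exists_span_close (n : ℕ) (x : Φ) {ε : ℝ} (hε : 0 < ε) :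
    ∃ y ∈ Submodule.span ℝ (Set.range S.phi), ‖S.toLevel n (x - y)‖ < ε :=
  S.total n x ε hε

/-- For fixed `j` both sides are continuous in `x` for `‖·‖_n`, and by orthogonality they agree on
the dense span of the `φ_i`. Thus the coordinates taken in `Φ_0` serve all levels at once. -/
theorem inner_phi (n j : ℕ) (x : Φ) :
    inner ℝ (S.toLevel n (S.phi j)) (S.toLevel n x) = S.wt n j ^ 2 * S.coef x j := by
  have hspan : ∀ y ∈ Submodule.span ℝ (Set.range S.phi),
      inner ℝ (S.toLevel n (S.phi j)) (S.toLevel n y) = S.wt n j ^ 2 * S.coef y j := by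
    intro y hy
    induction hy using Submodule.span_induction with
    | mem y hy =>
      obtain ⟨i, rfl⟩ := hy
      rw [coef_phi]
      split_ifs with h
      · rw [h, inner_phi_self, mul_one]
      · rw [S.inner_phi_phi n h, mul_zero]
    | zero => simp [coef_zero]
    | add y z _ _ h1 h2 => rw [map_add, inner_add_right, h1, h2, coef_add]; ring
    | smul c y _ h => rw [map_smul, inner_smul_right, h, coef_smul]; ring
  refine sub_eq_zero.1 (abs_nonpos_iff.1 (le_of_forall_pos_le_add fun ε hε => ?_))
  have hw := S.wt_pos n j
  have hc : 0 < S.wt n j + S.wt n j ^ 2 := by positivity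
  obtain ⟨y, hy, hxy⟩ := S.exists_span_close n x (div_pos hε hc)
  have e : inner ℝ (S.toLevel n (S.phi j)) (S.toLevel n x) - S.wt n j ^ 2 * S.coef x j
      = inner ℝ (S.toLevel n (S.phi j)) (S.toLevel n (x - y))
        - S.wt n j ^ 2 * S.coef (x - y) j := by
    rw [map_sub, inner_sub_right, coef_sub, hspan y hy]; ring
  rw [e, zero_add]
  have h1 := abs_real_inner_le_norm (S.toLevel n (S.phi j)) (S.toLevel n (x - y))
  have h2 := S.abs_coef_le n (x - y) j
  have h3 : ‖S.toLevel n (S.phi j)‖ = S.wt n j := rfl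
  rw [h3] at h1
  calc _ ≤ |inner ℝ (S.toLevel n (S.phi j)) (S.toLevel n (x - y))|
        + |S.wt n j ^ 2 * S.coef (x - y) j| := abs_sub _ _
    _ ≤ S.wt n j * ‖S.toLevel n (x - y)‖ + S.wt n j ^ 2 * ‖S.toLevel n (x - y)‖ := by
        rw [abs_mul, abs_of_nonneg (sq_nonneg (S.wt n j))]
        gcongr
    _ = (S.wt n j + S.wt n j ^ 2) * ‖S.toLevel n (x - y)‖ := by ring
    _ ≤ (S.wt n j + S.wt n j ^ 2) * (ε / (S.wt n j + S.wt n j ^ 2)) := by gcongr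
    _ = ε := by field_simp

theorem coef_proj (J : ℕ) (x : Φ) (j : ℕ) :
    S.coef (S.proj J x) j = if j < J then S.coef x j else 0 := by
  unfold proj
  induction J with
  | zero => simp [coef_zero]
  | succ J ih =>
    rw [Finset.sum_range_succ, coef_add, ih, coef_smul, coef_phi]
    rcases lt_trichotomy j J with h | h | h
    · simp [h, h.ne, Nat.lt_succ_of_lt h]
    · simp [h]
    · rw [if_neg h.not_gt, if_neg h.ne', if_neg (by omega)]; simp

theorem inner_proj (n J : ℕ) (c : ℕ → ℝ) (x : Φ) :
    inner ℝ (S.toLevel n (∑ j ∈ Finset.range J, c j • S.phi j)) (S.toLevel n x)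
      = ∑ j ∈ Finset.range J, c j * (S.wt n j ^ 2 * S.coef x j) := by
  rw [map_sum, sum_inner]
  refine Finset.sum_congr rfl fun j _ => ?_
  rw [map_smul, real_inner_smul_left, inner_phi]

theorem norm_proj_sq (n J : ℕ) (x : Φ) :
    ‖S.toLevel n (S.proj J x)‖ ^ 2 = ∑ j ∈ Finset.range J, S.coef x j ^ 2 * S.wt n j ^ 2 := by
  rw [← real_inner_self_eq_norm_sq]
  nth_rw 1 [proj]
  rw [inner_proj]
  refine Finset.sum_congr rfl fun j hj => ?_
  rw [coef_proj, if_pos (Finset.mem_range.1 hj)]; ring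

theorem norm_sub_proj_sq (n J : ℕ) (x : Φ) :
    ‖S.toLevel n (x - S.proj J x)‖ ^ 2
      = ‖S.toLevel n x‖ ^ 2 - ∑ j ∈ Finset.range J, S.coef x j ^ 2 * S.wt n j ^ 2 := by
  rw [map_sub, @norm_sub_sq_real, norm_proj_sq, real_inner_comm]
  have : inner ℝ (S.toLevel n (S.proj J x)) (S.toLevel n x)
      = ∑ j ∈ Finset.range J, S.coef x j ^ 2 * S.wt n j ^ 2 := by
    unfold proj
    rw [inner_proj]
    exact Finset.sum_congr rfl fun j hj => by ring
  rw [this]; ring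

theorem sum_coef_le (n J : ℕ) (x : Φ) :
    ∑ j ∈ Finset.range J, S.coef x j ^ 2 * S.wt n j ^ 2 ≤ ‖S.toLevel n x‖ ^ 2 := by
  have := S.norm_sub_proj_sq n J x
  nlinarith [sq_nonneg ‖S.toLevel n (x - S.proj J x)‖]

theorem norm_sub_proj_le (n J : ℕ) (x : Φ) :
    ‖S.toLevel n (x - S.proj J x)‖ ≤ ‖S.toLevel n x‖ := by
  refine abs_le_of_sq_le_sq' ?_ (norm_nonneg _) |>.2
  rw [norm_sub_proj_sq]
  have : 0 ≤ ∑ j ∈ Finset.range J, S.coef x j ^ 2 * S.wt n j ^ 2 :=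
    Finset.sum_nonneg fun _ _ => by positivity
  linarith

theorem proj_sub (J : ℕ) (x y : Φ) : S.proj J (x - y) = S.proj J x - S.proj J y := by
  simp [proj, coef_sub, sub_smul]

theorem exists_proj_eq {y : Φ} (hy : y ∈ Submodule.span ℝ (Set.range S.phi)) :
    ∃ J₀, ∀ J, J₀ ≤ J → S.proj J y = y := by
  induction hy using Submodule.span_induction with
  | mem y hy =>
    obtain ⟨i, rfl⟩ := hy
    refine ⟨i + 1, fun J hJ => ?_⟩
    unfold proj
    rw [Finset.sum_eq_single i]
    · simp [coef_phi]
    · intro j _ h; simp [coef_phi, h]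
    · intro h; exact absurd (Finset.mem_range.2 (by omega)) h
  | zero => exact ⟨0, fun J _ => by simp [proj, coef_zero]⟩
  | add y z _ _ h1 h2 =>
    obtain ⟨a, ha⟩ := h1
    obtain ⟨b, hb⟩ := h2
    refine ⟨max a b, fun J hJ => ?_⟩
    have e : S.proj J (y + z) = S.proj J y + S.proj J z := by
      simp [proj, coef_add, add_smul, Finset.sum_add_distrib]
    rw [e, ha J (le_trans (le_max_left _ _) hJ), hb J (le_trans (le_max_right _ _) hJ)]
  | smul c y _ h =>
    obtain ⟨a, ha⟩ := h
    refine ⟨a, fun J hJ => ?_⟩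
    have e : S.proj J (c • y) = c • S.proj J y := by
      simp [proj, coef_smul, mul_smul, Finset.smul_sum]
    rw [e, ha J hJ]

/-- For `y` in the span and `J` large, `x - P_J x = (x - y) - P_J (x - y)`, and `1 - P_J` contracts
every norm. -/
theorem tendsto_norm_sub_proj (n : ℕ) (x : Φ) :
    Tendsto (fun J => ‖S.toLevel n (x - S.proj J x)‖) atTop (𝓝 0) := by
  rw [Metric.tendsto_atTop]
  intro ε hε
  obtain ⟨y, hy, hxy⟩ := S.exists_span_close n x hε
  obtain ⟨J₀, hJ₀⟩ := S.exists_proj_eq hy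
  refine ⟨J₀, fun J hJ => ?_⟩
  rw [Real.dist_eq, sub_zero, abs_norm]
  refine lt_of_le_of_lt ?_ hxy
  have e : x - S.proj J x = (x - y) - S.proj J (x - y) := by
    rw [proj_sub, hJ₀ J hJ]; abel
  rw [e]
  exact S.norm_sub_proj_le n J _

/-- The same partial sums converge in all the norms, hence in `Φ`; this is why an arbitrary element
of `Φ'` is determined by its coordinates. -/
theorem tendsto_proj (x : Φ) : Tendsto (fun J => S.proj J x) atTop (𝓝 x) := by
  rw [S.withSeminorms.tendsto_nhds]
  intro n ε hε
  have h := (S.tendsto_norm_sub_proj n x).eventually (gt_mem_nhds hε)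
  filter_upwards [h] with J hJ
  have e : coreNorm (S.ip n) (S.proj J x - x) = ‖S.toLevel n (x - S.proj J x)‖ := by
    rw [← neg_sub, map_neg_eq_map]; rfl
  rw [e]; exact hJ

theorem dual_proj (w : StrongDual ℝ Φ) (J : ℕ) (x : Φ) :
    w (S.proj J x) = ∑ j ∈ Finset.range J, S.coef x j * w (S.phi j) := by
  simp [proj, map_sum]

theorem dual_tendsto (w : StrongDual ℝ Φ) (x : Φ) :
    Tendsto (fun J => ∑ j ∈ Finset.range J, S.coef x j * w (S.phi j)) atTop (𝓝 (w x)) := by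
  have := (w.continuous.tendsto x).comp (S.tendsto_proj x)
  refine this.congr fun J => ?_
  exact S.dual_proj w J x

theorem dual_ext {w z : StrongDual ℝ Φ} (h : ∀ j, w (S.phi j) = z (S.phi j)) : w = z := by
  ext x
  refine tendsto_nhds_unique (S.dual_tendsto w x) ?_
  simp_rw [h]
  exact S.dual_tendsto z x

theorem norm_toLevel_eq_zero {n : ℕ} {x : Φ} (h : ‖S.toLevel n x‖ = 0) : x = 0 := by
  have := norm_eq_zero.1 h
  exact this

theorem enorm_le_negNorm_mul (n : ℕ) (w : StrongDual ℝ Φ) (x : Φ) :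
    ‖w x‖ₑ ≤ S.negNorm n w * ‖S.toLevel n x‖ₑ := by
  by_cases hx : ‖S.toLevel n x‖ = 0
  · rw [S.norm_toLevel_eq_zero hx]; simp
  · have h : ‖w x‖ₑ / ‖S.toLevel n x‖ₑ ≤ S.negNorm n w :=
      le_iSup (fun x : Φ => ‖w x‖ₑ / ‖S.toLevel n x‖ₑ) x
    have h0 : ‖S.toLevel n x‖ₑ ≠ 0 := by
      simpa using hx
    exact (ENNReal.div_le_iff h0 enorm_ne_top).1 h

theorem negNorm_le {n : ℕ} {w : StrongDual ℝ Φ} {c : ℝ≥0∞}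
    (h : ∀ x, ‖w x‖ₑ ≤ c * ‖S.toLevel n x‖ₑ) : S.negNorm n w ≤ c :=
  iSup_le fun x => ENNReal.div_le_of_le_mul (h x)

/-- Test `w` against the truncated Riesz representative `x = ∑ (w[φ_j] / ‖φ_j‖_n²) φ_j`, for which
`w[x] = ‖x‖_n²` is the sum in question. -/
theorem sum_sq_le (n : ℕ) (w : StrongDual ℝ Φ) (hw : S.negNorm n w ≠ ∞) (J : ℕ) :
    ∑ j ∈ Finset.range J, w (S.phi j) ^ 2 / S.wt n j ^ 2 ≤ (S.negNorm n w).toReal ^ 2 := by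
  set c : ℕ → ℝ := fun j => w (S.phi j) / S.wt n j ^ 2
  set x : Φ := ∑ j ∈ Finset.range J, c j • S.phi j
  set s : ℝ := ∑ j ∈ Finset.range J, w (S.phi j) ^ 2 / S.wt n j ^ 2
  have hs : 0 ≤ s := Finset.sum_nonneg fun _ _ => by positivity
  have hcx : ∀ j, j < J → S.coef x j = c j := by
    intro j hj
    have h := S.inner_proj n J c (S.phi j)
    have h2 := S.inner_phi n j x
    rw [real_inner_comm] at h2
    rw [h] at h2
    have h3 : ∑ i ∈ Finset.range J, c i * (S.wt n i ^ 2 * S.coef (S.phi j) i)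
        = c j * S.wt n j ^ 2 := by
      rw [Finset.sum_eq_single j]
      · simp [coef_phi]
      · intro i _ hi; simp [coef_phi, hi]
      · intro h; exact absurd (Finset.mem_range.2 hj) h
    rw [h3, mul_comm] at h2
    exact (mul_left_cancel₀ (pow_pos (S.wt_pos n j) 2).ne' h2).symm
  have hx : ‖S.toLevel n x‖ ^ 2 = s := by
    rw [← real_inner_self_eq_norm_sq, inner_proj]
    refine Finset.sum_congr rfl fun j hj => ?_
    rw [hcx j (Finset.mem_range.1 hj)]
    have := (S.wt_pos n j).ne'
    simp only [c]; field_simp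
  have hwx : w x = s := by
    simp only [x, map_sum, map_smul, smul_eq_mul, c, s]
    refine Finset.sum_congr rfl fun j hj => ?_
    ring
  have h := S.enorm_le_negNorm_mul n w x
  have h2 := ENNReal.toReal_mono (ENNReal.mul_ne_top hw enorm_ne_top) h
  rw [ENNReal.toReal_mul, toReal_enorm, toReal_enorm, hwx, Real.norm_of_nonneg hs] at h2
  set M := (S.negNorm n w).toReal
  have hM : 0 ≤ M := ENNReal.toReal_nonneg
  rcases hs.eq_or_lt with h0 | h0
  · rw [← h0]; positivity
  · have h4 : s ^ 2 ≤ M ^ 2 * s := by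
      rw [← hx, ← mul_pow, hx]; exact pow_le_pow_left₀ hs h2 2
    nlinarith

/-- One inequality is Cauchy–Schwarz on partial sums of coordinates followed by `J → ∞`, the other
is `sum_sq_le`. The value `∞` is allowed, so the identity also decides which functionals belong to
`Φ_{-n}`. -/
theorem negNorm_sq (n : ℕ) (w : StrongDual ℝ Φ) :
    S.negNorm n w ^ 2 = ∑' j, ENNReal.ofReal (w (S.phi j) ^ 2 / S.wt n j ^ 2) := by
  refine le_antisymm ?_ ?_
  · set s : ℝ≥0∞ := ∑' j, ENNReal.ofReal (w (S.phi j) ^ 2 / S.wt n j ^ 2)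
    by_cases hs : s = ∞
    · rw [hs]; exact le_top
    have hsum : ∀ J, ∑ j ∈ Finset.range J, w (S.phi j) ^ 2 / S.wt n j ^ 2 ≤ s.toReal := by
      intro J
      rw [← ENNReal.ofReal_le_iff_le_toReal hs,
        ENNReal.ofReal_sum_of_nonneg fun _ _ => by positivity]
      exact ENNReal.sum_le_tsum _
    have key : S.negNorm n w ≤ ENNReal.ofReal (√s.toReal) := by
      refine S.negNorm_le fun x => ?_
      rw [← ofReal_norm, ← ofReal_norm, ← ENNReal.ofReal_mul (Real.sqrt_nonneg _)]
      refine ENNReal.ofReal_le_ofReal ?_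
      refine le_of_tendsto (S.dual_tendsto w x).norm (Eventually.of_forall fun J => ?_)
      rw [Real.norm_eq_abs]
      refine abs_le_of_sq_le_sq ?_ (by positivity)
      rw [mul_pow, Real.sq_sqrt ENNReal.toReal_nonneg]
      have h1 := Finset.sum_mul_sq_le_sq_mul_sq (Finset.range J)
        (fun j => w (S.phi j) / S.wt n j) (fun j => S.coef x j * S.wt n j)
      have h2 : ∑ j ∈ Finset.range J, w (S.phi j) / S.wt n j * (S.coef x j * S.wt n j)
          = ∑ j ∈ Finset.range J, S.coef x j * w (S.phi j) := by
        refine Finset.sum_congr rfl fun j _ => ?_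
        have := (S.wt_pos n j).ne'
        field_simp
      rw [h2] at h1
      simp only [div_pow, mul_pow] at h1
      refine h1.trans ?_
      gcongr
      · exact hsum J
      · exact S.sum_coef_le n J x
    calc S.negNorm n w ^ 2 ≤ ENNReal.ofReal (√s.toReal) ^ 2 := by gcongr
      _ = s := by
        rw [← ENNReal.ofReal_pow (Real.sqrt_nonneg _), Real.sq_sqrt ENNReal.toReal_nonneg,
          ENNReal.ofReal_toReal hs]
  · by_cases hw : S.negNorm n w = ∞
    · rw [hw]; simp
    refine ENNReal.tsum_le_of_sum_range_le fun J => ?_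
    rw [← ENNReal.ofReal_sum_of_nonneg fun _ _ => by positivity]
    refine (ENNReal.ofReal_le_ofReal (S.sum_sq_le n w hw J)).trans ?_
    rw [ENNReal.ofReal_pow ENNReal.toReal_nonneg, ENNReal.ofReal_toReal hw]

theorem hasSum_negNorm {n : ℕ} {w : StrongDual ℝ Φ} (hw : S.negNorm n w ≠ ∞) :
    HasSum (fun j => w (S.phi j) ^ 2 / S.wt n j ^ 2) ((S.negNorm n w).toReal ^ 2) := by
  have h := S.negNorm_sq n w
  have hne : ∑' j, ENNReal.ofReal (w (S.phi j) ^ 2 / S.wt n j ^ 2) ≠ ∞ := by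
    rw [← h]; exact ENNReal.pow_ne_top hw
  have h1 := ENNReal.hasSum_toReal hne
  rw [← ENNReal.tsum_toReal_eq (fun a => ENNReal.ofReal_ne_top), ← h, ENNReal.toReal_pow] at h1
  refine h1.congr_fun ?_ |> fun h => h
  intro j
  rw [ENNReal.toReal_ofReal (by positivity)]

theorem negNorm_incl (n : ℕ) (u : S.Neg n) : S.negNorm n (S.incl n u) = ‖u‖ₑ := by
  refine le_antisymm (S.negNorm_le fun x => ?_) ?_
  · exact u.le_opENorm (S.toLevel n x)
  · by_cases h : S.negNorm n (S.incl n u) = ∞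
    · rw [h]; exact le_top
    rw [← ofReal_norm, ← ENNReal.ofReal_toReal h]
    refine ENNReal.ofReal_le_ofReal (ContinuousLinearMap.opNorm_le_bound _ ENNReal.toReal_nonneg fun x => ?_)
    have h1 := S.enorm_le_negNorm_mul n (S.incl n u) x
    have h2 := ENNReal.toReal_mono (ENNReal.mul_ne_top h enorm_ne_top) h1
    rw [ENNReal.toReal_mul, toReal_enorm, toReal_enorm] at h2
    exact h2

/-- The hypotheses on `A` and `G` are phrased on `Φ_{-p}`; this transfers them to functionals on `Φ`
of finite dual norm, which is how paths are treated throughout. -/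
theorem exists_incl_eq {n : ℕ} {w : StrongDual ℝ Φ} (hw : S.negNorm n w ≠ ∞) :
    ∃ u : S.Neg n, S.incl n u = w := by
  let L : S.Level n →ₗ[ℝ] ℝ :=
    { toFun := fun x => w (show Φ from x)
      map_add' := fun x y => w.map_add (show Φ from x) (show Φ from y)
      map_smul' := fun c x => w.map_smul c (show Φ from x) }
  refine ⟨L.mkContinuous (S.negNorm n w).toReal fun x => ?_, ?_⟩
  · have h1 := S.enorm_le_negNorm_mul n w x
    have h2 := ENNReal.toReal_mono (ENNReal.mul_ne_top hw enorm_ne_top) h1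
    rw [ENNReal.toReal_mul, toReal_enorm, toReal_enorm] at h2
    exact h2
  · ext x; rfl

end CHNS

/-! ### Dual norms as real numbers: measurability, the operator `θ_p`, Hilbert–Schmidt compactness
-/

namespace CHNS

variable {Φ : Type*} [AddCommGroup Φ] [Module ℝ Φ] [UniformSpace Φ] [IsUniformAddGroup Φ]
  (S : CHNS Φ)

/-- The dual norm `‖·‖_{-n}` as a real number. -/
def nn (n : ℕ) (w : StrongDual ℝ Φ) : ℝ := (S.negNorm n w).toReal

theorem nn_nonneg (n : ℕ) (w : StrongDual ℝ Φ) : 0 ≤ S.nn n w := ENNReal.toReal_nonneg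

theorem ofReal_nn {n : ℕ} {w : StrongDual ℝ Φ} (h : S.negNorm n w ≠ ∞) :
    ENNReal.ofReal (S.nn n w) = S.negNorm n w := ENNReal.ofReal_toReal h

theorem negNorm_mono {m n : ℕ} (h : m ≤ n) (w : StrongDual ℝ Φ) :
    S.negNorm n w ≤ S.negNorm m w := by
  refine S.negNorm_le fun x => (S.enorm_le_negNorm_mul m w x).trans ?_
  gcongr
  rw [← ofReal_norm, ← ofReal_norm]
  exact ENNReal.ofReal_le_ofReal (S.norm_toLevel_mono h x)

theorem negNorm_ne_top_mono {m n : ℕ} (h : m ≤ n) {w : StrongDual ℝ Φ}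
    (hw : S.negNorm m w ≠ ∞) : S.negNorm n w ≠ ∞ :=
  ne_top_of_le_ne_top hw (S.negNorm_mono h w)

theorem nn_mono {m n : ℕ} (h : m ≤ n) {w : StrongDual ℝ Φ} (hw : S.negNorm m w ≠ ∞) :
    S.nn n w ≤ S.nn m w := ENNReal.toReal_mono hw (S.negNorm_mono h w)

theorem negNorm_add_le (n : ℕ) (w z : StrongDual ℝ Φ) :
    S.negNorm n (w + z) ≤ S.negNorm n w + S.negNorm n z := by
  refine S.negNorm_le fun x => ?_
  rw [add_mul]
  exact (enorm_add_le (w x) (z x)).trans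
    (add_le_add (S.enorm_le_negNorm_mul n w x) (S.enorm_le_negNorm_mul n z x))

theorem negNorm_sub_le (n : ℕ) (w z : StrongDual ℝ Φ) :
    S.negNorm n (w - z) ≤ S.negNorm n w + S.negNorm n z := by
  refine S.negNorm_le fun x => ?_
  rw [add_mul]
  exact (enorm_sub_le (a := w x) (b := z x)).trans
    (add_le_add (S.enorm_le_negNorm_mul n w x) (S.enorm_le_negNorm_mul n z x))

theorem negNorm_sub_ne_top {n : ℕ} {w z : StrongDual ℝ Φ} (hw : S.negNorm n w ≠ ∞)
    (hz : S.negNorm n z ≠ ∞) : S.negNorm n (w - z) ≠ ∞ :=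
  ne_top_of_le_ne_top (ENNReal.add_ne_top.2 ⟨hw, hz⟩) (S.negNorm_sub_le n w z)

theorem negNorm_add_ne_top {n : ℕ} {w z : StrongDual ℝ Φ} (hw : S.negNorm n w ≠ ∞)
    (hz : S.negNorm n z ≠ ∞) : S.negNorm n (w + z) ≠ ∞ :=
  ne_top_of_le_ne_top (ENNReal.add_ne_top.2 ⟨hw, hz⟩) (S.negNorm_add_le n w z)

theorem negNorm_zero (n : ℕ) : S.negNorm n 0 = 0 :=
  le_antisymm (S.negNorm_le fun x => by simp) zero_le

theorem negNorm_incl_ne_top (n : ℕ) (u : S.Neg n) : S.negNorm n (S.incl n u) ≠ ∞ := by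
  rw [negNorm_incl]; exact enorm_ne_top

theorem nn_incl (n : ℕ) (u : S.Neg n) : S.nn n (S.incl n u) = ‖u‖ := by
  rw [nn, negNorm_incl, toReal_enorm]

theorem incl_sub (n : ℕ) (u v : S.Neg n) : S.incl n (u - v) = S.incl n u - S.incl n v := rfl

theorem incl_apply (n : ℕ) (u : S.Neg n) (x : Φ) : S.incl n u x = u (S.toLevel n x) := rfl

theorem incl_injective (n : ℕ) : Function.Injective (S.incl n) := by
  intro u v h
  ext x
  exact DFunLike.congr_fun h (show Φ from x)

theorem continuous_incl_apply (n : ℕ) (x : Φ) : Continuous fun u : S.Neg n => S.incl n u x :=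
  (ContinuousLinearMap.apply ℝ ℝ (S.toLevel n x)).continuous

theorem abs_apply_le {n : ℕ} {w : StrongDual ℝ Φ} (hw : S.negNorm n w ≠ ∞) (x : Φ) :
    |w x| ≤ S.nn n w * ‖S.toLevel n x‖ := by
  have h2 := ENNReal.toReal_mono (ENNReal.mul_ne_top hw enorm_ne_top)
    (S.enorm_le_negNorm_mul n w x)
  rwa [ENNReal.toReal_mul, toReal_enorm, toReal_enorm] at h2

theorem abs_apply_phi_le {n : ℕ} {w : StrongDual ℝ Φ} (hw : S.negNorm n w ≠ ∞) (j : ℕ) :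
    |w (S.phi j)| ≤ S.nn n w * S.wt n j := S.abs_apply_le hw _

/-- Polarization, applied coordinatewise to Parseval's identity. -/
theorem hasSum_negInner {n : ℕ} {w z : StrongDual ℝ Φ} (hw : S.negNorm n w ≠ ∞)
    (hz : S.negNorm n z ≠ ∞) :
    HasSum (fun j => w (S.phi j) * z (S.phi j) / S.wt n j ^ 2) (S.negInner n w z) := by
  have h1 := S.hasSum_negNorm (S.negNorm_add_ne_top hw hz)
  have h2 := S.hasSum_negNorm (S.negNorm_sub_ne_top hw hz)
  refine ((h1.sub h2).div_const 4).congr_fun ?_ |> fun h => h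
  intro j
  simp only [add_apply, sub_apply]
  ring

theorem sum_mul_le {n : ℕ} {w z : StrongDual ℝ Φ} (hw : S.negNorm n w ≠ ∞)
    (hz : S.negNorm n z ≠ ∞) (J : ℕ) :
    |∑ j ∈ Finset.range J, w (S.phi j) * z (S.phi j) / S.wt n j ^ 2| ≤ S.nn n w * S.nn n z := by
  refine abs_le_of_sq_le_sq ?_ (mul_nonneg (S.nn_nonneg _ _) (S.nn_nonneg _ _))
  have h1 := Finset.sum_mul_sq_le_sq_mul_sq (Finset.range J)
    (fun j => w (S.phi j) / S.wt n j) (fun j => z (S.phi j) / S.wt n j)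
  have h2 : ∑ j ∈ Finset.range J, w (S.phi j) / S.wt n j * (z (S.phi j) / S.wt n j)
      = ∑ j ∈ Finset.range J, w (S.phi j) * z (S.phi j) / S.wt n j ^ 2 :=
    Finset.sum_congr rfl fun j _ => by ring
  rw [h2] at h1
  simp only [div_pow] at h1
  rw [mul_pow]
  refine h1.trans ?_
  gcongr
  · exact S.sum_sq_le n w hw J
  · exact S.sum_sq_le n z hz J

theorem measurable_eval (x : Φ) :
    @Measurable _ _ (dualSigma Φ) _ (fun w : StrongDual ℝ Φ => w x) := by
  let _ : MeasurableSpace (StrongDual ℝ Φ) := dualSigma Φ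
  exact (measurable_pi_apply x).comp (comap_measurable (fun (u : StrongDual ℝ Φ) (x : Φ) => u x))

theorem measurable_of_eval {Ω : Type*} [MeasurableSpace Ω] {f : Ω → StrongDual ℝ Φ}
    (h : ∀ x, Measurable fun ω => f ω x) : @Measurable _ _ _ (dualSigma Φ) f := by
  let _ : MeasurableSpace (StrongDual ℝ Φ) := dualSigma Φ
  exact measurable_comap_iff.2 (measurable_pi_iff.2 h)

/-- The defining supremum is uncountable; Parseval's identity replaces it by a countable series of
evaluations. -/
theorem measurable_negNorm_comp {Ω : Type*} [MeasurableSpace Ω] {f : Ω → StrongDual ℝ Φ}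
    (h : ∀ x, Measurable fun ω => f ω x) (n : ℕ) : Measurable fun ω => S.negNorm n (f ω) := by
  have e : (fun ω => S.negNorm n (f ω)) = fun ω =>
      (∑' j, ENNReal.ofReal (f ω (S.phi j) ^ 2 / S.wt n j ^ 2)) ^ (2⁻¹ : ℝ) := by
    ext ω
    rw [← S.negNorm_sq, ← ENNReal.rpow_natCast, ← ENNReal.rpow_mul]
    norm_num
  rw [e]
  refine Measurable.pow_const (Measurable.tsum fun j => ?_) _
  exact (((h _).pow_const 2).div_const _).ennreal_ofReal

theorem measurable_nn_comp {Ω : Type*} [MeasurableSpace Ω] {f : Ω → StrongDual ℝ Φ}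
    (h : ∀ x, Measurable fun ω => f ω x) (n : ℕ) : Measurable fun ω => S.nn n (f ω) :=
  (S.measurable_negNorm_comp h n).ennreal_toReal

theorem embed_phi_apply (x : Φ) (j : ℕ) : S.embed x (S.phi j) = S.coef x j := by
  unfold embed coef
  rw [incl_apply, innerSL_apply_apply, real_inner_comm]

/-- `φ_j` as an element of `Φ_{-n}`. -/
def basis (n j : ℕ) : S.Neg n :=
  LinearMap.mkContinuous
    ({ toFun := fun x => S.coef (show Φ from x) j
       map_add' := fun x y => S.coef_add _ _ _
       map_smul' := fun c x => S.coef_smul _ _ _ } : S.Level n →ₗ[ℝ] ℝ) 1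
    fun x => by rw [one_mul]; exact S.abs_coef_le n _ j

theorem incl_basis_apply (n j : ℕ) (x : Φ) : S.incl n (S.basis n j) x = S.coef x j := rfl

theorem incl_basis (n j : ℕ) : S.incl n (S.basis n j) = S.embed (S.phi j) := by
  refine S.dual_ext fun i => ?_
  rw [incl_basis_apply, embed_phi_apply, coef_phi, coef_phi]
  simp [eq_comm]

theorem incl_sum_basis (n J : ℕ) (c : ℕ → ℝ) :
    S.incl n (∑ j ∈ Finset.range J, c j • S.basis n j)
      = S.embed (∑ j ∈ Finset.range J, c j • S.phi j) := by
  have e : S.embed (∑ j ∈ Finset.range J, c j • S.phi j)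
      = ∑ j ∈ Finset.range J, c j • S.embed (S.phi j) := by
    refine S.dual_ext fun i => ?_
    rw [embed_phi_apply]
    simp only [coef, map_sum, inner_sum, map_smul, inner_smul_right]
    rw [sum_apply]
    refine Finset.sum_congr rfl fun j _ => ?_
    rw [smul_apply, embed_phi_apply]
    rfl
  rw [e]
  ext x
  rw [incl_apply, sum_apply, sum_apply]
  refine Finset.sum_congr rfl fun j _ => ?_
  rw [← S.incl_basis n j]
  rfl

theorem coef_sum (J : ℕ) (c : ℕ → ℝ) (i : ℕ) :
    S.coef (∑ j ∈ Finset.range J, c j • S.phi j) i = if i < J then c i else 0 := by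
  induction J with
  | zero => simp [coef_zero]
  | succ J ih =>
    rw [Finset.sum_range_succ, coef_add, ih, coef_smul, coef_phi]
    rcases lt_trichotomy i J with h | h | h
    · simp [h, h.ne, Nat.lt_succ_of_lt h]
    · simp [h]
    · rw [if_neg h.not_gt, if_neg h.ne', if_neg (by omega)]; simp

theorem nn_sq_eq_sum {n J : ℕ} {w : StrongDual ℝ Φ} (h : ∀ j, J ≤ j → w (S.phi j) = 0) :
    S.negNorm n w ≠ ∞ ∧
      S.nn n w ^ 2 = ∑ j ∈ Finset.range J, w (S.phi j) ^ 2 / S.wt n j ^ 2 := by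
  have e : S.negNorm n w ^ 2
      = ENNReal.ofReal (∑ j ∈ Finset.range J, w (S.phi j) ^ 2 / S.wt n j ^ 2) := by
    rw [negNorm_sq, ENNReal.ofReal_sum_of_nonneg fun _ _ => by positivity]
    refine tsum_eq_sum fun j hj => ?_
    rw [h j (by simpa using hj)]; simp
  have h1 : S.negNorm n w ≠ ∞ := by
    intro h2
    rw [h2] at e
    simp at e
  refine ⟨h1, ?_⟩
  rw [nn, ← ENNReal.toReal_pow, e, ENNReal.toReal_ofReal]
  exact Finset.sum_nonneg fun _ _ => by positivity

/-- On finite expansions `θ_p` is diagonal with entries `‖φ_j‖_p⁻²`, so `w[θ_p x]` is the pairing of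
`w` and `x` in `Φ_{-p}`. This turns coercivity into an energy inequality. -/
theorem theta_apply_of_support {p J : ℕ} {x : Φ} (h : ∀ j, J ≤ j → S.coef x j = 0)
    (w : StrongDual ℝ Φ) :
    w (S.theta p x) = ∑ j ∈ Finset.range J, w (S.phi j) * S.coef x j / S.wt p j ^ 2 := by
  have e : ∀ j, S.embed x (S.phiN p j) • S.phiN p j
      = (S.coef x j / S.wt p j ^ 2) • S.phi j := by
    intro j
    unfold phiN
    rw [map_smul, embed_phi_apply, smul_eq_mul, smul_smul]
    congr 1
    have : ‖S.toLevel p (S.phi j)‖ = S.wt p j := rfl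
    rw [this, div_eq_mul_inv, sq, mul_inv]
    ring
  unfold theta
  simp_rw [e]
  rw [tsum_eq_sum (s := Finset.range J) fun j hj => by
    rw [h j (by simpa using hj)]; simp]
  rw [map_sum]
  refine Finset.sum_congr rfl fun j _ => ?_
  rw [map_smul, smul_eq_mul]
  ring

theorem negNorm_embed_phi (n j : ℕ) : S.nn n (S.embed (S.phi j)) = (S.wt n j)⁻¹ := by
  have h := S.nn_sq_eq_sum (n := n) (J := j + 1) (w := S.embed (S.phi j)) fun i hi => by
    rw [embed_phi_apply, coef_phi, if_neg (by omega)]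
  have h2 := h.2
  rw [Finset.sum_eq_single j] at h2
  · rw [embed_phi_apply, coef_phi, if_pos rfl, one_pow, one_div, ← inv_pow] at h2
    exact (pow_left_inj₀ (S.nn_nonneg _ _) (inv_nonneg.2 (S.wt_pos n j).le) two_ne_zero).1 h2
  · intro i _ hi
    rw [embed_phi_apply, coef_phi, if_neg hi]; simp
  · intro h; exact absurd (Finset.mem_range.2 (by omega)) h

/-- The functional `φ_j^{-p}` has the single nonzero coordinate `‖φ_j‖_p`, so its squared norm at
level `r` is the ratio of weights. -/
theorem InjectionHS.summable {S : CHNS Φ} {p r : ℕ} (h : S.InjectionHS p r) :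
    Summable fun j => S.wt p j ^ 2 / S.wt r j ^ 2 := by
  have e : ∀ j, S.negNorm r (S.phiNeg p j) ^ 2
      = ENNReal.ofReal (S.wt p j ^ 2 / S.wt r j ^ 2) := by
    intro j
    have h0 : ∀ i, j + 1 ≤ i → S.phiNeg p j (S.phi i) = 0 := fun i hi => by
      rw [phiNeg, smul_apply, embed_phi_apply, coef_phi, if_neg (by omega),
        smul_zero]
    have h1 := S.nn_sq_eq_sum (n := r) h0
    rw [← S.ofReal_nn h1.1, ← ENNReal.ofReal_pow (S.nn_nonneg _ _), h1.2]
    congr 1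
    have e2 : ∀ i, S.phiNeg p j (S.phi i) = if i = j then S.wt p j else 0 := by
      intro i
      have h3 : (S.negNorm p (S.embed (S.phi j))).toReal = (S.wt p j)⁻¹ := S.negNorm_embed_phi p j
      rw [phiNeg, smul_apply, embed_phi_apply, coef_phi, h3, inv_inv,
        smul_eq_mul, mul_ite, mul_one, mul_zero]
    rw [Finset.sum_eq_single j]
    · rw [e2, if_pos rfl]
    · intro i _ hi
      rw [e2, if_neg hi]; simp
    · intro h; exact absurd (Finset.mem_range.2 (by omega)) h
  unfold InjectionHS at h
  simp_rw [e] at h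
  refine (ENNReal.summable_toReal h.ne).congr fun j => ?_
  rw [ENNReal.toReal_ofReal (by positivity)]

/-- On `‖·‖_{-p}`-bounded sets, `‖·‖_{-r}` is controlled by finitely many coordinates. -/
theorem InjectionHS.exists_tail {S : CHNS Φ} {p r : ℕ} (h : S.InjectionHS p r) (hpr : p ≤ r)
    {ε : ℝ} (hε : 0 < ε) :
    ∃ J, ∀ w : StrongDual ℝ Φ, S.negNorm p w ≠ ∞ →
      S.nn r w ^ 2 ≤ ∑ j ∈ Finset.range J, w (S.phi j) ^ 2 + ε * S.nn p w ^ 2 := by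
  -- Only the convergence of the weight ratios to `0` is used: beyond `J` the squared coordinates
  -- cost at level `r` at most `ε` times what they cost at level `p`.
  have ht := h.summable.tendsto_atTop_zero
  obtain ⟨J, hJ⟩ := eventually_atTop.1 (ht.eventually (gt_mem_nhds hε))
  refine ⟨J, fun w hw => ?_⟩
  have h1 := S.hasSum_negNorm (S.negNorm_ne_top_mono hpr hw)
  refine le_of_tendsto h1.tendsto_sum_nat (eventually_atTop.2 ⟨J, fun I hI => ?_⟩)
  rw [← Finset.sum_range_add_sum_Ico _ hI]
  gcongr with j hj
  · exact div_le_self (sq_nonneg _) (one_le_pow₀ (S.one_le_wt r j))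
  · calc ∑ j ∈ Finset.Ico J I, w (S.phi j) ^ 2 / S.wt r j ^ 2
        ≤ ∑ j ∈ Finset.Ico J I, ε * (w (S.phi j) ^ 2 / S.wt p j ^ 2) := by
          refine Finset.sum_le_sum fun j hj => ?_
          have h2 := (hJ j (Finset.mem_Ico.1 hj).1).le
          have h3 := S.wt_pos p j
          have h4 := S.wt_pos r j
          rw [div_le_iff₀ (by positivity)] at h2
          rw [div_le_iff₀ (by positivity)]
          calc w (S.phi j) ^ 2 = w (S.phi j) ^ 2 / S.wt p j ^ 2 * S.wt p j ^ 2 := by field_simp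
            _ ≤ w (S.phi j) ^ 2 / S.wt p j ^ 2 * (ε * S.wt r j ^ 2) := by gcongr
            _ = _ := by ring
      _ ≤ ε * ∑ j ∈ Finset.range I, w (S.phi j) ^ 2 / S.wt p j ^ 2 := by
          rw [← Finset.mul_sum]
          gcongr
          intro j hj
          exact Finset.mem_range.2 (Finset.mem_Ico.1 hj).2
      _ ≤ ε * S.nn p w ^ 2 := by
          gcongr
          exact S.sum_sq_le p w hw I

theorem negNorm_le_iff {n : ℕ} {w : StrongDual ℝ Φ} {R : ℝ} (hR : 0 ≤ R) :
    S.negNorm n w ≤ ENNReal.ofReal R ↔ ∀ x, |w x| ≤ R * ‖S.toLevel n x‖ := by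
  constructor
  · intro h x
    have h1 : S.negNorm n w ≠ ∞ := ne_top_of_le_ne_top ENNReal.ofReal_ne_top h
    refine (S.abs_apply_le h1 x).trans ?_
    gcongr
    exact ENNReal.toReal_le_of_le_ofReal hR h
  · intro h
    refine S.negNorm_le fun x => ?_
    rw [← ofReal_norm, ← ofReal_norm, ← ENNReal.ofReal_mul hR]
    exact ENNReal.ofReal_le_ofReal (h x)

/-- The bound is a family of constraints on evaluations, each closed in `Φ_{-r}`; hence `‖·‖_{-p}`
bounds survive limits taken in the weaker norm. -/
theorem isClosed_ball (r p : ℕ) {R : ℝ} (hR : 0 ≤ R) :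
    IsClosed {u : S.Neg r | S.negNorm p (S.incl r u) ≤ ENNReal.ofReal R} := by
  simp_rw [S.negNorm_le_iff hR, ofPred_forall]
  exact isClosed_iInter fun x =>
    isClosed_le (S.continuous_incl_apply r x).abs continuous_const

theorem nn_le_of_le {n : ℕ} {w : StrongDual ℝ Φ} {R : ℝ} (hR : 0 ≤ R)
    (h : S.negNorm n w ≤ ENNReal.ofReal R) : S.nn n w ≤ R :=
  ENNReal.toReal_le_of_le_ofReal hR h

theorem norm_sub_sq_le_tail {p r : ℕ} {R : ℝ} (hR : 0 ≤ R) {J : ℕ} {ε : ℝ} (hε : 0 < ε)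
    (hJ : ∀ w : StrongDual ℝ Φ, S.negNorm p w ≠ ∞ →
      S.nn r w ^ 2 ≤ ∑ j ∈ Finset.range J, w (S.phi j) ^ 2 + ε * S.nn p w ^ 2)
    {u v : S.Neg r} (hu : S.negNorm p (S.incl r u) ≤ ENNReal.ofReal R)
    (hv : S.negNorm p (S.incl r v) ≤ ENNReal.ofReal R) :
    ‖u - v‖ ^ 2 ≤ ∑ j ∈ Finset.range J, (S.incl r u (S.phi j) - S.incl r v (S.phi j)) ^ 2
      + ε * (2 * R) ^ 2 := by
  have h1 : S.negNorm p (S.incl r (u - v)) ≤ ENNReal.ofReal (2 * R) := by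
    rw [incl_sub, two_mul, ENNReal.ofReal_add hR hR]
    exact (S.negNorm_sub_le p _ _).trans (add_le_add hu hv)
  have h2 := hJ _ (ne_top_of_le_ne_top ENNReal.ofReal_ne_top h1)
  rw [nn_incl] at h2
  refine h2.trans (add_le_add le_rfl ?_)
  gcongr
  · exact S.nn_nonneg _ _
  · exact S.nn_le_of_le (by positivity) h1

/-- Balls of `Φ_{-p}` are compact in `Φ_{-r}` when the injection is Hilbert–Schmidt. -/
theorem InjectionHS.isCompact_ball {S : CHNS Φ} {p r : ℕ} (h : S.InjectionHS p r) (hpr : p ≤ r)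
    {R : ℝ} (hR : 0 ≤ R) :
    IsCompact {u : S.Neg r | S.negNorm p (S.incl r u) ≤ ENNReal.ofReal R} := by
  set B := {u : S.Neg r | S.negNorm p (S.incl r u) ≤ ENNReal.ofReal R}
  refine TotallyBounded.isCompact_of_isClosed ?_ (S.isClosed_ball r p hR)
  rw [Metric.totallyBounded_iff]
  intro ε hε
  have hR1 : 0 < (2 * R) ^ 2 + 1 := by positivity
  obtain ⟨J, hJ⟩ := h.exists_tail hpr (ε := ε ^ 2 / 4 / ((2 * R) ^ 2 + 1)) (by positivity)
  -- The first `J` coordinates send the ball into a bounded box. A finite `η`-net of the image lifts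
  -- to the ball; it accounts for `ε² / 4` in the squared distance and the tail beyond `J` for
  -- another `ε² / 4`.
  let F : S.Neg r → (Fin J → ℝ) := fun u j => S.incl r u (S.phi j)
  have hFB : TotallyBounded (F '' B) := by
    refine (isCompact_univ_pi fun j : Fin J =>
      isCompact_Icc (a := -(R * S.wt p j)) (b := R * S.wt p j)).totallyBounded.subset ?_
    rintro _ ⟨u, hu, rfl⟩ j _
    exact abs_le.1 ((S.negNorm_le_iff hR).1 hu (S.phi j))
  obtain ⟨η, hη, hη2⟩ : ∃ η > 0, (J : ℝ) * η ^ 2 ≤ ε ^ 2 / 4 := by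
    refine ⟨ε / (2 * √(J + 1)), by positivity, ?_⟩
    rw [div_pow, mul_pow, Real.sq_sqrt (by positivity)]
    rw [mul_div_assoc', div_le_iff₀ (by positivity)]
    nlinarith [sq_nonneg ε]
  obtain ⟨t', ht', htf, ht⟩ := exists_subset_image_finite_and.1
    (Metric.finite_approx_of_totallyBounded hFB η hη)
  refine ⟨t', htf, fun u hu => ?_⟩
  obtain ⟨y, hy, huy⟩ := mem_iUnion₂.1 (ht ⟨u, hu, rfl⟩)
  obtain ⟨v, hv, rfl⟩ := hy
  refine mem_iUnion₂.2 ⟨v, hv, ?_⟩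
  rw [Metric.mem_ball, dist_eq_norm]
  refine lt_of_pow_lt_pow_left₀ 2 hε.le ?_
  have h1 := S.norm_sub_sq_le_tail hR (by positivity) hJ hu (ht' hv)
  have h2 : ∑ j ∈ Finset.range J, (S.incl r u (S.phi j) - S.incl r v (S.phi j)) ^ 2
      ≤ ∑ j ∈ Finset.range J, η ^ 2 := by
    refine Finset.sum_le_sum fun j hj => ?_
    have h3 := (dist_pi_lt_iff hη).1 huy ⟨j, Finset.mem_range.1 hj⟩
    rw [Real.dist_eq] at h3
    exact sq_le_sq' (abs_lt.1 h3).1.le (abs_lt.1 h3).2.le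
  rw [Finset.sum_const, Finset.card_range, nsmul_eq_mul] at h2
  have h4 : ε ^ 2 / 4 / ((2 * R) ^ 2 + 1) * (2 * R) ^ 2 ≤ ε ^ 2 / 4 := by
    rw [div_mul_eq_mul_div, div_le_iff₀ hR1]
    nlinarith [sq_nonneg ε]
  nlinarith [sq_pos_of_pos hε]

end CHNS

/-! ### Fenchel–Young inequalities for the entropy `l` -/

theorem ell_nonneg (r : ℝ≥0) : 0 ≤ ell r := by
  unfold ell
  rcases eq_or_lt_of_le r.coe_nonneg with h | h
  · rw [← h]; norm_num
  · have h1 : Real.log (r : ℝ)⁻¹ ≤ (r : ℝ)⁻¹ - 1 := Real.log_le_sub_one_of_pos (by positivity)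
    rw [Real.log_inv] at h1
    have h2 := mul_le_mul_of_nonneg_left h1 h.le
    have h3 : (r : ℝ) * ((r : ℝ)⁻¹ - 1) = 1 - r := by field_simp
    linarith

/-- The Fenchel–Young inequality for the pair `l(1 + ·)` and `exp a - 1 - a`. -/
theorem mul_sub_one_le_exp_add_ell (a : ℝ) (r : ℝ≥0) :
    a * ((r : ℝ) - 1) ≤ Real.exp a - 1 - a + ell r := by
  unfold ell
  rcases eq_or_lt_of_le r.coe_nonneg with h | h
  · rw [← h]
    have := Real.exp_pos a
    simp only [Real.log_zero, mul_zero, zero_sub]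
    linarith
  · have h1 : a - Real.log r + 1 ≤ Real.exp (a - Real.log r) := Real.add_one_le_exp _
    rw [Real.exp_sub, Real.exp_log h, le_div_iff₀ h] at h1
    nlinarith

/-- For `r < 1` use Fenchel–Young at `-a`; the resulting bound is the smaller one because `a ≤ sinh
a`. -/
theorem mul_abs_sub_one_le {a : ℝ} (ha : 0 ≤ a) (r : ℝ≥0) :
    a * |(r : ℝ) - 1| ≤ Real.exp a - 1 - a + ell r := by
  rcases abs_cases ((r : ℝ) - 1) with ⟨h, _⟩ | ⟨h, _⟩
  · rw [h]; exact mul_sub_one_le_exp_add_ell a r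
  · rw [h]
    have h1 := mul_sub_one_le_exp_add_ell (-a) r
    have h2 : a ≤ Real.sinh a := Real.self_le_sinh_iff.2 ha
    rw [Real.sinh_eq] at h2
    linarith

theorem exp_sub_one_sub_le {a : ℝ} (ha : 0 ≤ a) : Real.exp a - 1 - a ≤ a ^ 2 * Real.exp a := by
  have h1 : -a + 1 ≤ Real.exp (-a) := Real.add_one_le_exp _
  have h2 : Real.exp (-a) * Real.exp a = 1 := by rw [← Real.exp_add]; simp
  have h3 := Real.exp_pos a
  have h4 : (1 - a) * Real.exp a ≤ 1 := by nlinarith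
  have h5 : Real.exp a - 1 ≤ a * Real.exp a := by linarith
  nlinarith

/-- Apply the inequality to `a / ε` and multiply by `ε`: the entropy gets the small factor `ε`, and
for `a ≤ L` the exponential term is quadratic in `a`, with a constant depending on `L / ε`. -/
theorem mul_abs_sub_one_le_of_le {a L ε : ℝ} (ha : 0 ≤ a) (haL : a ≤ L) (hε : 0 < ε) (r : ℝ≥0) :
    a * |(r : ℝ) - 1| ≤ ε⁻¹ * Real.exp (L / ε) * a ^ 2 + ε * ell r := by
  have h1 := mul_abs_sub_one_le (div_nonneg ha hε.le) r
  have h2 := exp_sub_one_sub_le (div_nonneg ha hε.le)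
  have h3 : (a / ε) ^ 2 * Real.exp (a / ε) ≤ (a / ε) ^ 2 * Real.exp (L / ε) := by gcongr
  have h4 : a / ε * |(r : ℝ) - 1| ≤ (a / ε) ^ 2 * Real.exp (L / ε) + ell r := by linarith
  have h5 := mul_le_mul_of_nonneg_left h4 hε.le
  have e1 : ε * (a / ε * |(r : ℝ) - 1|) = a * |(r : ℝ) - 1| := by field_simp
  have e2 : ε * ((a / ε) ^ 2 * Real.exp (L / ε) + ell r)
      = ε⁻¹ * Real.exp (L / ε) * a ^ 2 + ε * ell r := by field_simp
  rwa [e1, e2] at h5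

/-- The companion bound where `h` is large: `h / ε ≤ δ h² + 1 / (4 δ ε²)`, by completing the square,
replaces the exponential of `a / ε` by one that is integrable on the tail. -/
theorem mul_abs_sub_one_le_exp_sq {a h δ ε : ℝ} (ha : 0 ≤ a) (hah : a ≤ h) (hδ : 0 < δ)
    (hε : 0 < ε) (r : ℝ≥0) :
    a * |(r : ℝ) - 1| ≤ ε * Real.exp (1 / (4 * δ * ε ^ 2)) * Real.exp (δ * h ^ 2) + ε * ell r := by
  have h1 := mul_abs_sub_one_le (div_nonneg ha hε.le) r
  have h2 : a / ε ≤ 1 / (4 * δ * ε ^ 2) + δ * h ^ 2 := by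
    have h3 : a / ε ≤ h / ε := by gcongr
    have h4 : 0 ≤ δ * (h - 1 / (2 * δ * ε)) ^ 2 := by positivity
    have h5 : δ * (h - 1 / (2 * δ * ε)) ^ 2 = δ * h ^ 2 - h / ε + 1 / (4 * δ * ε ^ 2) := by
      field_simp; ring
    linarith
  have h3 : Real.exp (a / ε) ≤ Real.exp (1 / (4 * δ * ε ^ 2)) * Real.exp (δ * h ^ 2) := by
    rw [← Real.exp_add]; exact Real.exp_le_exp.2 h2
  have h0 : 0 ≤ a / ε := by positivity
  have h4 : a / ε * |(r : ℝ) - 1|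
      ≤ Real.exp (1 / (4 * δ * ε ^ 2)) * Real.exp (δ * h ^ 2) + ell r := by linarith
  have h5 := mul_le_mul_of_nonneg_left h4 hε.le
  have e1 : ε * (a / ε * |(r : ℝ) - 1|) = a * |(r : ℝ) - 1| := by field_simp
  rw [e1] at h5
  linarith

/-! ### Integrals against `g - 1` for integrands with square-exponential tails -/

section ExpTail

variable {Ω : Type*} [MeasurableSpace Ω] {μ : Measure Ω}

/-- `h` has a square-exponentially integrable upper tail. -/
structure ExpTail (μ : Measure Ω) (h : Ω → ℝ) : Prop where
  measurable : Measurable h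
  nonneg : ∀ z, 0 ≤ h z
  tail : ∃ δ > 0, ∃ L₀ : ℝ, ∫⁻ z in {z | L₀ < h z}, ENNReal.ofReal (Real.exp (δ * h z ^ 2)) ∂μ ≠ ∞

theorem ExpTail.const {c : ℝ} (hc : 0 ≤ c) : ExpTail μ fun _ => c :=
  ⟨measurable_const, fun _ => hc, 1, one_pos, c, by simp⟩

theorem ExpTail.const_mul {h : Ω → ℝ} (hh : ExpTail μ h) {c : ℝ} (hc : 0 < c) :
    ExpTail μ fun z => c * h z := by
  obtain ⟨δ, hδ, L₀, hL⟩ := hh.tail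
  refine ⟨hh.measurable.const_mul c, fun z => mul_nonneg hc.le (hh.nonneg z), δ / c ^ 2,
    by positivity, c * L₀, ?_⟩
  have e : {z | c * L₀ < c * h z} = {z | L₀ < h z} := by
    ext z; exact mul_lt_mul_iff_right₀ hc
  rw [e]
  have e2 : ∀ z, δ / c ^ 2 * (c * h z) ^ 2 = δ * h z ^ 2 := fun z => by field_simp
  simp_rw [e2]
  exact hL

/-- The tail weight `1_{h > L} exp(δ h²)`. -/
theorem ExpTail.exists_weight {h : Ω → ℝ} (hh : ExpTail μ h) :
    ∃ δ > 0, ∀ c : ℝ, ∀ ε : ℝ≥0∞, 0 < ε → ∃ L : ℝ, 0 ≤ L ∧ ∃ W : Ω → ℝ, Measurable W ∧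
      (∀ z, 0 ≤ W z) ∧ (∀ z, L < h z → c * Real.exp (δ * h z ^ 2) ≤ W z) ∧
      ∫⁻ z, ENNReal.ofReal (W z) ∂μ < ε := by
  obtain ⟨δ, hδ, L₀, hL⟩ := hh.tail
  refine ⟨δ, hδ, fun c ε hε => ?_⟩
  have hm := hh.measurable
  set W : ℕ → Ω → ℝ := fun n =>
    {z | L₀ < h z ∧ (n : ℝ) < h z}.indicator fun z => |c| * Real.exp (δ * h z ^ 2)
  have hWm : ∀ n, Measurable (W n) := fun n =>
    Measurable.indicator (by fun_prop)
      ((measurableSet_lt measurable_const hm).inter (measurableSet_lt measurable_const hm))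
  have hW0 : ∀ n z, 0 ≤ W n z := fun n z => indicator_nonneg (fun _ _ => by positivity) _
  -- Dominated convergence: each point leaves `{n < h}` eventually. Taking also `n ≥ L₀` makes the
  -- condition `L₀ < h` automatic on that set.
  have hlim : Tendsto (fun n => ∫⁻ z, ENNReal.ofReal (W n z) ∂μ) atTop (𝓝 (∫⁻ _, 0 ∂μ)) := by
    refine tendsto_lintegral_of_dominated_convergence
      ({z | L₀ < h z}.indicator fun z =>
        ENNReal.ofReal |c| * ENNReal.ofReal (Real.exp (δ * h z ^ 2)))
      (fun n => (hWm n).ennreal_ofReal) (fun n => Eventually.of_forall fun z => ?_) ?_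
      (Eventually.of_forall fun z => ?_)
    · simp only [W, indicator, mem_ofPred_eq]
      split_ifs with h1 h2 h2
      · rw [ENNReal.ofReal_mul (abs_nonneg c)]
      · exact absurd h1.1 h2
      · simp
      · simp
    · rw [lintegral_indicator (measurableSet_lt measurable_const hm), lintegral_const_mul _ (by fun_prop)]
      exact ENNReal.mul_ne_top ENNReal.ofReal_ne_top hL
    · refine tendsto_const_nhds.congr' ?_
      obtain ⟨n₀, hn₀⟩ := exists_nat_ge (h z)
      filter_upwards [eventually_ge_atTop n₀] with n hn
      have : ¬ (L₀ < h z ∧ (n : ℝ) < h z) := by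
        rintro ⟨_, h2⟩
        have : (n₀ : ℝ) ≤ n := by exact_mod_cast hn
        linarith
      simp only [W, indicator, mem_ofPred_eq, if_neg this, ENNReal.ofReal_zero]
  rw [lintegral_zero] at hlim
  obtain ⟨n, hn1, hn2⟩ := ((hlim.eventually (gt_mem_nhds hε)).and
    (eventually_ge_atTop ⌈L₀⌉₊)).exists
  refine ⟨n, Nat.cast_nonneg n, W n, hWm n, hW0 n, fun z hz => ?_, hn1⟩
  have hz2 : L₀ < h z := lt_of_le_of_lt ((Nat.le_ceil L₀).trans (by exact_mod_cast hn2)) hz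
  have hmem : z ∈ {z | L₀ < h z ∧ (n : ℝ) < h z} := ⟨hz2, hz⟩
  simp only [W, indicator_of_mem hmem]
  gcongr
  exact le_abs_self c

/-- Split at a level `L`: below it use the quadratic bound, above it the exponential one. The
constant in front of `exp(δ h²)` depends on `ε` alone, so `L` can be chosen afterwards to make the
tail integral small; only `C` depends on `L`. -/
theorem ExpTail.exists_small {h : Ω → ℝ} (hh : ExpTail μ h) {ε : ℝ} (hε : 0 < ε) :
    ∃ C : ℝ, 0 ≤ C ∧ ∃ W : Ω → ℝ, Measurable W ∧ (∀ z, 0 ≤ W z) ∧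
      ∫⁻ z, ENNReal.ofReal (W z) ∂μ ≤ ENNReal.ofReal ε ∧
      ∀ (z : Ω) (a : ℝ) (r : ℝ≥0), 0 ≤ a → a ≤ h z →
        a * |(r : ℝ) - 1| ≤ C * a ^ 2 + ε * ell r + W z := by
  obtain ⟨δ, hδ, H⟩ := hh.exists_weight
  obtain ⟨L, hL, W, hWm, hW0, hW, hWi⟩ := H (ε * Real.exp (1 / (4 * δ * ε ^ 2)))
    (ENNReal.ofReal ε) (ENNReal.ofReal_pos.2 hε)
  refine ⟨ε⁻¹ * Real.exp (L / ε), by positivity, W, hWm, hW0, hWi.le, fun z a r ha hah => ?_⟩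
  rcases le_or_gt (h z) L with h1 | h1
  · have := mul_abs_sub_one_le_of_le ha (hah.trans h1) hε r
    linarith [hW0 z]
  · have h2 := mul_abs_sub_one_le_exp_sq ha hah hδ hε r
    have h3 := hW z h1
    have h4 : 0 ≤ ε⁻¹ * Real.exp (L / ε) * a ^ 2 := by positivity
    linarith

/-- Here the opposite balance is needed: the coefficient of `a²` must not exceed `1`, so that it can
be absorbed by the monotonicity condition, while the factor in front of the entropy may be large. -/
theorem ExpTail.exists_absorb {h : Ω → ℝ} (hh : ExpTail μ h) :
    ∃ C : ℝ, 0 ≤ C ∧ ∃ W : Ω → ℝ, Measurable W ∧ (∀ z, 0 ≤ W z) ∧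
      ∫⁻ z, ENNReal.ofReal (W z) ∂μ ≠ ∞ ∧
      ∀ (z : Ω) (a : ℝ) (r : ℝ≥0), 0 ≤ a → a ≤ h z →
        2 * (a * |(r : ℝ) - 1|) ≤ a ^ 2 + C * ell r + W z := by
  obtain ⟨δ, hδ, L₀, hL⟩ := hh.tail
  have hm := hh.measurable
  -- Then `L₀ / ε ≤ 1` and `ε⁻¹ ≤ 1/6`, so `ε⁻¹ exp(L₀ / ε) ≤ 3/6`, and twice this is at most `1`.
  set ε : ℝ := |L₀| + 6
  have hε : 0 < ε := by positivity
  set c : ℝ := 2 * (ε * Real.exp (1 / (4 * δ * ε ^ 2)))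
  have hms := measurableSet_lt (measurable_const (a := L₀)) hm
  refine ⟨2 * ε, by positivity,
    {z | L₀ < h z}.indicator fun z => c * Real.exp (δ * h z ^ 2),
    Measurable.indicator (by fun_prop) hms,
    fun z => indicator_nonneg (fun _ _ => by positivity) _, ?_, fun z a r ha hah => ?_⟩
  · have e : ∀ z, ENNReal.ofReal ({z | L₀ < h z}.indicator (fun z => c * Real.exp (δ * h z ^ 2)) z)
        = {z | L₀ < h z}.indicator
          (fun z => ENNReal.ofReal c * ENNReal.ofReal (Real.exp (δ * h z ^ 2))) z := by
      intro z
      simp only [indicator]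
      split_ifs
      · rw [ENNReal.ofReal_mul (by positivity)]
      · simp
    simp_rw [e]
    rw [lintegral_indicator hms, lintegral_const_mul _ (by fun_prop)]
    exact ENNReal.mul_ne_top ENNReal.ofReal_ne_top hL
  · have he := ell_nonneg r
    rcases le_or_gt (h z) L₀ with h1 | h1
    · have h2 := mul_abs_sub_one_le_of_le ha (hah.trans h1) hε r
      have h3 : L₀ / ε ≤ 1 := by
        rw [div_le_one hε]
        have := le_abs_self L₀
        simp only [ε]; linarith
      have h4 : Real.exp (L₀ / ε) ≤ 3 :=
        (Real.exp_le_exp.2 h3).trans (by have := Real.exp_one_lt_d9; linarith)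
      have h5 : ε⁻¹ * Real.exp (L₀ / ε) ≤ 6⁻¹ * 3 := by
        have h6 : ε⁻¹ ≤ 6⁻¹ := inv_anti₀ (by norm_num) (by simp only [ε]; linarith [abs_nonneg L₀])
        gcongr
      have h7 : z ∉ {z | L₀ < h z} := not_lt.2 h1
      rw [indicator_of_notMem h7]
      nlinarith [mul_le_mul_of_nonneg_right h5 (sq_nonneg a)]
    · have h2 := mul_abs_sub_one_le_exp_sq ha hah hδ hε r
      have h7 : z ∈ {z | L₀ < h z} := h1
      rw [indicator_of_mem h7]
      simp only [c]
      nlinarith [sq_nonneg a]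

/-- Integrate `ExpTail.exists_small` with `ε / (N + 1)`: the entropy accounts for `N` shares of `ε`
and the tail for one. The constant depends on neither the control nor the integrand `a`, which makes
every later estimate uniform on `S^N`. -/
theorem lintegral_mul_abs_sub_one_le {h : Ω → ℝ} (hh : ExpTail μ h) (N : ℕ) {ε : ℝ} (hε : 0 < ε) :
    ∃ C : ℝ, 0 ≤ C ∧ ∀ g : Ω → ℝ≥0, Measurable g → ∫⁻ z, ENNReal.ofReal (ell (g z)) ∂μ ≤ N →
      ∀ a : Ω → ℝ, (∀ᵐ z ∂μ, 0 ≤ a z ∧ a z ≤ h z) →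
        ∫⁻ z, ENNReal.ofReal (a z * |(g z : ℝ) - 1|) ∂μ
          ≤ ENNReal.ofReal C * ∫⁻ z, ENNReal.ofReal (a z ^ 2) ∂μ + ENNReal.ofReal ε := by
  have hN : (0 : ℝ) < N + 1 := by positivity
  obtain ⟨C, hC, W, hWm, hW0, hWi, H⟩ := hh.exists_small (div_pos hε hN)
  refine ⟨C, hC, fun g hg hgN a ha => ?_⟩
  calc ∫⁻ z, ENNReal.ofReal (a z * |(g z : ℝ) - 1|) ∂μ
      ≤ ∫⁻ z, (ENNReal.ofReal C * ENNReal.ofReal (a z ^ 2)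
          + (ENNReal.ofReal (ε / (N + 1)) * ENNReal.ofReal (ell (g z))
            + ENNReal.ofReal (W z))) ∂μ := by
        refine lintegral_mono_ae (ha.mono fun z hz => ?_)
        refine (ENNReal.ofReal_le_ofReal (H z (a z) (g z) hz.1 hz.2)).trans ?_
        rw [ENNReal.ofReal_add (by have := ell_nonneg (g z); positivity) (hW0 z),
          ENNReal.ofReal_add (by positivity) (by have := ell_nonneg (g z); positivity),
          ENNReal.ofReal_mul hC, ENNReal.ofReal_mul (by positivity), add_assoc]
    _ = ENNReal.ofReal C * ∫⁻ z, ENNReal.ofReal (a z ^ 2) ∂μ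
          + (ENNReal.ofReal (ε / (N + 1)) * ∫⁻ z, ENNReal.ofReal (ell (g z)) ∂μ
            + ∫⁻ z, ENNReal.ofReal (W z) ∂μ) := by
        have hm : Measurable fun z => ENNReal.ofReal (ell (g z)) :=
          (measurable_ell.comp hg).ennreal_ofReal
        have hm2 : Measurable fun z => ENNReal.ofReal (ε / (N + 1)) * ENNReal.ofReal (ell (g z))
            + ENNReal.ofReal (W z) := (hm.const_mul _).add hWm.ennreal_ofReal
        rw [lintegral_add_right _ hm2,
          lintegral_const_mul' _ _ ENNReal.ofReal_ne_top, lintegral_add_left (hm.const_mul _),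
          lintegral_const_mul _ hm]
    _ ≤ ENNReal.ofReal C * ∫⁻ z, ENNReal.ofReal (a z ^ 2) ∂μ
          + (ENNReal.ofReal (ε / (N + 1)) * N + ENNReal.ofReal (ε / (N + 1))) := by
        gcongr
    _ = _ := by
        congr 1
        rw [← ENNReal.ofReal_natCast, ← ENNReal.ofReal_mul (by positivity),
          ← ENNReal.ofReal_add (by positivity) (by positivity)]
        congr 1
        field_simp

end ExpTail

/-! ### From exponential integrability on sets of finite measure to a tail condition -/

section Extraction

variable {X : Type*} [TopologicalSpace X] [MeasurableSpace X]

instance isFiniteMeasure_lamT (T : ℝ) : IsFiniteMeasure (lamT T) := by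
  refine ⟨?_⟩
  rw [lamT, comap_subtype_coe_apply measurableSet_Icc, image_univ, Subtype.range_coe]
  exact measure_Icc_lt_top

instance nullSingletonClass_lamT (T : ℝ) : NullSingletonClass (lamT T) := by
  refine ⟨fun x => ?_⟩
  rw [lamT, comap_subtype_coe_apply measurableSet_Icc, image_singleton]
  exact measure_singleton _

theorem lamT_singleton_prod (T : ℝ) (ν : Measure X) [SFinite ν] (c : ℝ) :
    nuT T ν {z | (z.1 : ℝ) = c} = 0 := by
  have hsub : {z : Icc (0 : ℝ) T × X | (z.1 : ℝ) = c} = {s : Icc (0 : ℝ) T | (s : ℝ) = c} ×ˢ univ := by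
    ext z; simp
  have hs : lamT T {s : Icc (0 : ℝ) T | (s : ℝ) = c} = 0 := by
    refine Set.Subsingleton.measure_zero (fun a ha b hb => Subtype.ext ?_) _
    exact (show (a : ℝ) = c from ha).trans (show (b : ℝ) = c from hb).symm
  rw [hsub, nuT, Measure.prod_prod, hs, zero_mul]

/-- The time marginal of `ν_T` restricted to `A` is finite without atoms, so the mass of `A` before
time `t` is continuous in `t`, and the intermediate value theorem applies. -/
theorem exists_subset_nuT_eq {T : ℝ} {ν : Measure X} [SigmaFinite ν]
    {A : Set (Icc (0 : ℝ) T × X)} (hA : MeasurableSet A) (hfin : nuT T ν A ≠ ∞)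
    {c : ℝ} (hc : 0 ≤ c) (hcA : ENNReal.ofReal c ≤ nuT T ν A) :
    ∃ B ⊆ A, MeasurableSet B ∧ nuT T ν B = ENNReal.ofReal c := by
  have hm : Measurable fun z : Icc (0 : ℝ) T × X => (z.1 : ℝ) := by fun_prop
  set ρ : Measure ℝ := ((nuT T ν).restrict A).map fun z => (z.1 : ℝ)
  have hρ : ∀ s, MeasurableSet s → ρ s = nuT T ν ({z | (z.1 : ℝ) ∈ s} ∩ A) := fun s hs => by
    rw [Measure.map_apply hm hs, Measure.restrict_apply (hm hs)]; rfl
  have hfm : IsFiniteMeasure ρ := ⟨by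
    rw [hρ _ MeasurableSet.univ]
    exact (measure_mono inter_subset_right).trans_lt hfin.lt_top⟩
  have hna : NullSingletonClass ρ := ⟨fun x => by
    rw [hρ _ (measurableSet_singleton x)]
    exact measure_mono_null inter_subset_left (lamT_singleton_prod T ν x)⟩
  -- The primitive starts at `-1` so that time `0` lies inside the half-open intervals; the right
  -- end `max T (-1)` keeps them correctly ordered for every `T`.
  have hcont : Continuous fun t : ℝ => ∫ x in (-1 : ℝ)..t, (1 : ℝ) ∂ρ :=
    intervalIntegral.continuous_primitive (fun a b => intervalIntegrable_const) _
  have hval : ∀ t, -1 ≤ t → ∫ x in (-1 : ℝ)..t, (1 : ℝ) ∂ρ = (ρ (Ioc (-1) t)).toReal := fun t ht => by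
    rw [intervalIntegral.integral_of_le ht]
    simp [Measure.real]
  have hT : ∀ z ∈ A, z.1.1 ∈ Ioc (-1) (max T (-1)) := fun z _ =>
    ⟨by have := z.1.2.1; linarith, z.1.2.2.trans (le_max_left _ _)⟩
  have hend : ρ (Ioc (-1) (max T (-1))) = nuT T ν A := by
    rw [hρ _ measurableSet_Ioc]
    congr 1
    exact inter_eq_right.2 hT
  have hmem : c ∈ Icc (∫ x in (-1 : ℝ)..(-1), (1 : ℝ) ∂ρ)
      (∫ x in (-1 : ℝ)..(max T (-1)), (1 : ℝ) ∂ρ) := by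
    refine ⟨by simpa using hc, ?_⟩
    rw [hval _ (le_max_right _ _), hend]
    exact (ENNReal.ofReal_le_iff_le_toReal hfin).1 hcA
  obtain ⟨t, ht, htc⟩ := intermediate_value_Icc (le_max_right T (-1)) hcont.continuousOn hmem
  refine ⟨{z | (z.1 : ℝ) ∈ Ioc (-1) t} ∩ A, inter_subset_right,
    (hm measurableSet_Ioc).inter hA, ?_⟩
  rw [← hρ _ measurableSet_Ioc]
  simp only [hval t ht.1] at htc
  rw [← htc, ENNReal.ofReal_toReal (measure_ne_top _ _)]

theorem exp_ofReal_eq (δ h : ℝ) (hδ : 0 < δ) (hh : 0 ≤ h) :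
    EReal.exp ((ENNReal.ofReal δ * ENNReal.ofReal h ^ 2 : ℝ≥0∞) : EReal)
      = ENNReal.ofReal (Real.exp (δ * h ^ 2)) := by
  rw [← ENNReal.ofReal_pow hh, ← ENNReal.ofReal_mul hδ.le, EReal.coe_ennreal_ofReal,
    max_eq_left (by positivity), EReal.exp_coe]

/-- Otherwise every upper level set has infinite measure. Choose levels with `exp(δ L_k²) ≥ 4^k` and
in each level set a piece `B_k` of mass `2^{-k}`: the union has finite measure, but the integral
over `B_k` alone is at least `2^k`. -/
theorem ExpIntegrable.exists_finite_level {T : ℝ} {ν : Measure X} [SigmaFinite ν]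
    {f : Icc (0 : ℝ) T × X → ℝ≥0∞} (hfm : Measurable f) {δ : ℝ} (hδ : 0 < δ)
    (hf : ∀ E : Set (Icc (0 : ℝ) T × X), MeasurableSet E → nuT T ν E < ∞ →
      ∫⁻ z in E, EReal.exp ((ENNReal.ofReal δ * f z ^ 2 : ℝ≥0∞) : EReal) ∂(nuT T ν) < ∞) :
    ∃ L : ℝ, 0 ≤ L ∧ nuT T ν {z | ENNReal.ofReal L < f z} < ∞ := by
  by_contra! hcon
  have hlev : ∀ k : ℕ, ∃ L : ℝ, 0 ≤ L ∧ (4 : ℝ) ^ k ≤ Real.exp (δ * L ^ 2) := by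
    intro k
    refine ⟨√(4 ^ k / δ), Real.sqrt_nonneg _, ?_⟩
    rw [Real.sq_sqrt (by positivity), mul_div_cancel₀ _ hδ.ne']
    exact (by linarith [Real.add_one_le_exp ((4 : ℝ) ^ k)])
  choose L hL0 hL using hlev
  have hms : ∀ k, MeasurableSet {z | ENNReal.ofReal (L k) < f z} := fun k =>
    measurableSet_lt measurable_const hfm
  have hB : ∀ k : ℕ, ∃ B ⊆ {z | ENNReal.ofReal (L k) < f z}, MeasurableSet B ∧
      nuT T ν B = ENNReal.ofReal ((1 / 2) ^ k) := by
    intro k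
    obtain ⟨A, hA, hsub, hlt, hfin⟩ := Measure.exists_subset_measure_lt_top (hms k)
      (r := 1) (lt_of_lt_of_le ENNReal.one_lt_top (hcon (L k) (hL0 k)))
    obtain ⟨B, hBA, hBm, hB⟩ := exists_subset_nuT_eq hA hfin.ne (c := (1 / 2) ^ k) (by positivity)
      ((ENNReal.ofReal_le_one.2 (pow_le_one₀ (by norm_num) (by norm_num))).trans hlt.le)
    exact ⟨B, hBA.trans hsub, hBm, hB⟩
  choose B hBsub hBm hB using hB
  have hE : nuT T ν (⋃ k, B k) < ∞ := by
    refine (measure_iUnion_le _).trans_lt ?_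
    simp_rw [hB]
    rw [← ENNReal.ofReal_tsum_of_nonneg (fun k => by positivity) summable_geometric_two]
    exact ENNReal.ofReal_lt_top
  have hI := hf _ (MeasurableSet.iUnion hBm) hE
  refine hI.ne (ENNReal.eq_top_of_forall_nnreal_le fun r => ?_)
  obtain ⟨k, hk⟩ := pow_unbounded_of_one_lt (r : ℝ) (one_lt_two)
  calc (r : ℝ≥0∞) = ENNReal.ofReal r := by simp
    _ ≤ ENNReal.ofReal (4 ^ k * (1 / 2) ^ k) := by
        refine ENNReal.ofReal_le_ofReal ?_
        rw [← mul_pow]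
        norm_num
        exact hk.le
    _ = ENNReal.ofReal (4 ^ k) * nuT T ν (B k) := by
        rw [hB, ENNReal.ofReal_mul (by positivity)]
    _ = ∫⁻ z in B k, ENNReal.ofReal (4 ^ k) ∂(nuT T ν) := by rw [setLIntegral_const]
    _ ≤ ∫⁻ z in B k, EReal.exp ((ENNReal.ofReal δ * f z ^ 2 : ℝ≥0∞) : EReal) ∂(nuT T ν) := by
        refine setLIntegral_mono' (hBm k) fun z hz => ?_
        refine (ENNReal.ofReal_le_ofReal (hL k)).trans ?_
        rw [← exp_ofReal_eq _ _ hδ (hL0 k)]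
        refine EReal.exp_monotone (EReal.coe_ennreal_le_coe_ennreal_iff.2 ?_)
        gcongr
        exact (hBsub k hz).le
    _ ≤ _ := lintegral_mono_set (subset_iUnion B k)

/-- The hypothesis is applied to one set, an upper level set of finite measure. It gives the tail
integral and also the finiteness almost everywhere that permits a real-valued majorant. -/
theorem ExpIntegrable.exists_expTail {T : ℝ} {ν : Measure X} [SigmaFinite ν]
    {f : Icc (0 : ℝ) T × X → ℝ≥0∞} (hfm : AEMeasurable f (nuT T ν)) (hf : ExpIntegrable ν f) :
    ∃ h, ExpTail (nuT T ν) h ∧ ∀ᵐ z ∂(nuT T ν), f z ≤ ENNReal.ofReal (h z) := by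
  obtain ⟨δ, hδ, H⟩ := hf
  set f' := hfm.mk f
  have hf'm : Measurable f' := hfm.measurable_mk
  have hff' : f =ᵐ[nuT T ν] f' := hfm.ae_eq_mk
  have H' : ∀ E : Set (Icc (0 : ℝ) T × X), MeasurableSet E → nuT T ν E < ∞ →
      ∫⁻ z in E, EReal.exp ((ENNReal.ofReal δ * f' z ^ 2 : ℝ≥0∞) : EReal) ∂(nuT T ν) < ∞ := by
    intro E hE hE2
    refine lt_of_eq_of_lt (lintegral_congr_ae ?_) (H E hE hE2)
    filter_upwards [ae_restrict_of_ae hff'] with z hz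
    rw [hz]
  obtain ⟨L, hL0, hL⟩ := ExpIntegrable.exists_finite_level hf'm hδ H'
  have hms : MeasurableSet {z | ENNReal.ofReal L < f' z} := measurableSet_lt measurable_const hf'm
  have hI := H' _ hms hL
  have hexpm : Measurable fun z =>
      EReal.exp ((ENNReal.ofReal δ * f' z ^ 2 : ℝ≥0∞) : EReal) := by
    refine EReal.measurable_exp.comp (measurable_coe_ennreal_ereal.comp ?_)
    exact (hf'm.pow_const 2).const_mul _
  have hfin : ∀ᵐ z ∂(nuT T ν), f' z ≠ ∞ := by
    have h1 := ae_lt_top hexpm hI.ne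
    rw [ae_restrict_iff' hms] at h1
    filter_upwards [h1] with z hz htop
    have h2 : z ∈ {z | ENNReal.ofReal L < f' z} := by
      change ENNReal.ofReal L < f' z
      rw [htop]; exact ENNReal.ofReal_lt_top
    have h3 := hz h2
    rw [htop, ENNReal.top_pow two_ne_zero,
      ENNReal.mul_top (ENNReal.ofReal_pos.2 hδ).ne'] at h3
    simp at h3
  refine ⟨fun z => (f' z).toReal, ⟨hf'm.ennreal_toReal, fun z => ENNReal.toReal_nonneg,
    δ, hδ, L, ?_⟩, ?_⟩
  · refine ne_top_of_le_ne_top hI.ne ?_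
    have hsub : {z | L < (f' z).toReal} ⊆ {z | ENNReal.ofReal L < f' z} := by
      intro z (hz : L < (f' z).toReal)
      change ENNReal.ofReal L < f' z
      have h0 : f' z ≠ ∞ := by
        intro h; rw [h] at hz; simp at hz; linarith
      exact (ENNReal.ofReal_lt_iff_lt_toReal hL0 h0).2 hz
    refine (lintegral_mono_set hsub).trans (lintegral_mono fun z => ?_)
    rw [← exp_ofReal_eq _ _ hδ ENNReal.toReal_nonneg]
    refine EReal.exp_monotone (EReal.coe_ennreal_le_coe_ennreal_iff.2 ?_)
    gcongr
    exact ENNReal.ofReal_toReal_le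
  · filter_upwards [hff', hfin] with z h1 h2
    rw [h1, ENNReal.ofReal_toReal h2]

end Extraction

/-! ### Vague convergence of controls against integrands outside `C_c` -/

section Weak

theorem integrable_mul_sub_one {Ω : Type*} [MeasurableSpace Ω] {μ : Measure Ω} {h : Ω → ℝ}
    (hh : ExpTail μ h) {g : Ω → ℝ≥0} (hg : Measurable g)
    (hgN : ∫⁻ z, ENNReal.ofReal (ell (g z)) ∂μ ≠ ∞) {ψ : Ω → ℝ}
    (hψ : AEStronglyMeasurable ψ μ) (hψ2 : ∫⁻ z, ENNReal.ofReal (ψ z ^ 2) ∂μ ≠ ∞)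
    (hψh : ∀ᵐ z ∂μ, |ψ z| ≤ h z) : Integrable (fun z => ψ z * ((g z : ℝ) - 1)) μ := by
  obtain ⟨N, hN⟩ := ENNReal.exists_nat_gt hgN
  obtain ⟨C, hC, H⟩ := lintegral_mul_abs_sub_one_le hh N one_pos
  refine ⟨hψ.mul (by fun_prop), ?_⟩
  have h1 := H g hg hN.le (fun z => |ψ z|) (hψh.mono fun z hz => ⟨abs_nonneg _, hz⟩)
  refine lt_of_le_of_lt (b := ∫⁻ z, ENNReal.ofReal (|ψ z| * |(g z : ℝ) - 1|) ∂μ) ?_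
    (h1.trans_lt ?_)
  · refine lintegral_mono fun z => ?_
    rw [← abs_mul, ← Real.norm_eq_abs, ofReal_norm]
  · simp_rw [sq_abs]
    exact ENNReal.add_lt_top.2 ⟨ENNReal.mul_lt_top ENNReal.ofReal_lt_top hψ2.lt_top,
      ENNReal.ofReal_lt_top⟩

theorem abs_integral_mul_sub_one_le {Ω : Type*} [MeasurableSpace Ω] {μ : Measure Ω} {g : Ω → ℝ≥0}
    {ψ : Ω → ℝ} {ε : ℝ} (hε : 0 ≤ ε)
    (h : ∫⁻ z, ENNReal.ofReal (|ψ z| * |(g z : ℝ) - 1|) ∂μ ≤ ENNReal.ofReal ε) :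
    |∫ z, ψ z * ((g z : ℝ) - 1) ∂μ| ≤ ε := by
  rw [← Real.norm_eq_abs]
  refine (norm_integral_le_lintegral_norm _).trans (ENNReal.toReal_le_of_le_ofReal hε ?_)
  refine le_trans (le_of_eq (lintegral_congr fun z => ?_)) h
  rw [Real.norm_eq_abs, abs_mul]

variable {Ω : Type*} [TopologicalSpace Ω] [MeasurableSpace Ω] [BorelSpace Ω] [R1Space Ω] [NormalSpace Ω]
  [WeaklyLocallyCompactSpace Ω] {μ : Measure Ω} [μ.Regular]

/-- A square integrable function dominated by a function with square-exponential tail is, uniformly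
over controls of bounded cost, approximated by functions in `C_c`. -/
theorem exists_compactlySupported_approx {h : Ω → ℝ} (hh : ExpTail μ h) (N : ℕ) {ψ : Ω → ℝ}
    (hψm : Measurable ψ) (hψ2 : ∫⁻ z, ENNReal.ofReal (ψ z ^ 2) ∂μ ≠ ∞)
    (hψh : ∀ᵐ z ∂μ, |ψ z| ≤ h z) {ε : ℝ} (hε : 0 < ε) :
    ∃ f : C_c(Ω, ℝ), (∀ g : Ω → ℝ≥0, Measurable g →
        ∫⁻ z, ENNReal.ofReal (ell (g z)) ∂μ ≤ N →
        |∫ z, ψ z * ((g z : ℝ) - 1) ∂μ - ∫ z, f z * ((g z : ℝ) - 1) ∂μ| ≤ ε ∧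
        Integrable (fun z => f z * ((g z : ℝ) - 1)) μ) ∧ Integrable f μ := by
  have hε4 : 0 < ε / 4 := by positivity
  obtain ⟨C, hC, H⟩ := lintegral_mul_abs_sub_one_le hh N hε4
  -- The part of `ψ` above height `n` has square integral tending to `0`, and it is still dominated
  -- by `h`, so the uniform estimate discards it.
  have hlim : Tendsto (fun n : ℕ => ENNReal.ofReal C * ∫⁻ z, ENNReal.ofReal
      ({z | (n : ℝ) < |ψ z|}.indicator ψ z ^ 2) ∂μ) atTop (𝓝 (ENNReal.ofReal C * ∫⁻ _, 0 ∂μ)) := by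
    refine ENNReal.Tendsto.const_mul ?_ (Or.inr ENNReal.ofReal_ne_top)
    refine tendsto_lintegral_of_dominated_convergence (fun z => ENNReal.ofReal (ψ z ^ 2))
      (fun n => ?_) (fun n => Eventually.of_forall fun z => ?_) hψ2
      (Eventually.of_forall fun z => ?_)
    · exact ((hψm.indicator (measurableSet_lt measurable_const hψm.abs)).pow_const 2).ennreal_ofReal
    · refine ENNReal.ofReal_le_ofReal ?_
      simp only [indicator]
      split_ifs
      · exact le_rfl
      · simp only [ne_eq, OfNat.ofNat_ne_zero, not_false_eq_true, zero_pow]; positivity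
    · refine tendsto_const_nhds.congr' ?_
      obtain ⟨n₀, hn₀⟩ := exists_nat_ge |ψ z|
      filter_upwards [eventually_ge_atTop n₀] with n hn
      have h1 : z ∉ {z | (n : ℝ) < |ψ z|} := by
        have : (n₀ : ℝ) ≤ n := by exact_mod_cast hn
        exact not_lt.2 (hn₀.trans this)
      rw [indicator_of_notMem h1]; simp
  rw [lintegral_zero, mul_zero] at hlim
  obtain ⟨L, hL⟩ := (hlim.eventually (ge_mem_nhds (ENNReal.ofReal_pos.2 hε4))).exists
  set ψ₁ : Ω → ℝ := {z | (L : ℝ) < |ψ z|}.indicator ψ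
  set ψ₂ : Ω → ℝ := fun z => ψ z - ψ₁ z
  have hψ₁m : Measurable ψ₁ := hψm.indicator (measurableSet_lt measurable_const hψm.abs)
  have hψ₂m : Measurable ψ₂ := hψm.sub hψ₁m
  have hψ₁le : ∀ z, |ψ₁ z| ≤ |ψ z| := fun z => by
    simp only [ψ₁, indicator]; split_ifs <;> simp
  have hψ₂ : ∀ z, |ψ₂ z| ≤ |ψ z| ∧ |ψ₂ z| ≤ L := fun z => by
    simp only [ψ₂, ψ₁, indicator, mem_ofPred_eq]
    split_ifs with h1
    · simp
    · simp only [sub_zero, le_refl, true_and]; exact not_lt.1 h1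
  have hψint : Integrable (fun z => ψ z ^ 2) μ :=
    ⟨(hψm.pow_const 2).aestronglyMeasurable, by
      refine lt_of_le_of_lt (lintegral_mono fun z => ?_) hψ2.lt_top
      rw [← ofReal_norm, Real.norm_of_nonneg (sq_nonneg _)]⟩
  have hψ₂mem : MemLp ψ₂ (ENNReal.ofReal 2) μ := by
    rw [ENNReal.ofReal_ofNat, memLp_two_iff_integrable_sq hψ₂m.aestronglyMeasurable]
    refine hψint.mono' (hψ₂m.pow_const 2).aestronglyMeasurable (Eventually.of_forall fun z => ?_)
    rw [Real.norm_of_nonneg (sq_nonneg _)]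
    exact sq_le_sq.2 (hψ₂ z).1
  -- The constant for integrands bounded by `2 L` must be known before the approximant, whose `L²`
  -- accuracy is prescribed in terms of it.
  obtain ⟨C', hC', H'⟩ := lintegral_mul_abs_sub_one_le
    (ExpTail.const (μ := μ) (c := 2 * L) (by positivity)) N hε4
  obtain ⟨f₀, hf₀s, hf₀, hf₀c, hf₀m⟩ := hψ₂mem.exists_hasCompactSupport_integral_rpow_sub_le
    two_pos (ε := ε / 4 / (C' + 1)) (by positivity)
  -- Clipping to `[-L, L]` keeps continuity and compact support, does not increase the distance to
  -- `ψ₂`, and bounds `ψ₂ - f` by `2 L`, as `C'` requires.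
  set f : Ω → ℝ := fun z => max (-(L : ℝ)) (min L (f₀ z))
  have hfc : Continuous f := by fun_prop
  have hf0 : ∀ z, f₀ z = 0 → f z = 0 := fun z hz => by
    simp only [f, hz]
    rw [min_eq_right (Nat.cast_nonneg L), max_eq_right (neg_nonpos.2 (Nat.cast_nonneg L))]
  have hfs : HasCompactSupport f := hf₀s.mono' (by
    intro z hz
    by_contra h1
    exact hz (hf0 z (image_eq_zero_of_notMem_tsupport h1)))
  have hfL : ∀ z, |f z| ≤ L := fun z =>
    abs_le.2 ⟨le_max_left _ _, max_le (by linarith [(Nat.cast_nonneg L : (0 : ℝ) ≤ L)]) (min_le_left _ _)⟩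
  have hclip : ∀ z, |ψ₂ z - f z| ≤ |ψ₂ z - f₀ z| := by
    intro z
    have h1 : ψ₂ z = max (-(L : ℝ)) (min L (ψ₂ z)) := by
      have := abs_le.1 (hψ₂ z).2
      rw [min_eq_right this.2, max_eq_right this.1]
    rw [h1]
    calc |max (-(L : ℝ)) (min L (ψ₂ z)) - f z| ≤ |min (L : ℝ) (ψ₂ z) - min (L : ℝ) (f₀ z)| := by
          have := abs_max_sub_max_le_max (-(L : ℝ)) (min (L : ℝ) (ψ₂ z)) (-(L : ℝ)) (min (L : ℝ) (f₀ z))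
          simpa using this
      _ ≤ |ψ₂ z - f₀ z| := by
          have := abs_min_sub_min_le_max (L : ℝ) (ψ₂ z) L (f₀ z)
          simpa using this
      _ = _ := by rw [← h1]
  have hf₀2 : Integrable (fun z => ‖ψ₂ z - f₀ z‖ ^ (2 : ℝ)) μ := by
    have := (hψ₂mem.sub hf₀m).integrable_norm_rpow (by simp) ENNReal.ofReal_ne_top
    simpa using this
  have hdiff : ∫⁻ z, ENNReal.ofReal (|ψ₂ z - f z| ^ 2) ∂μ ≤ ENNReal.ofReal (ε / 4 / (C' + 1)) := by
    refine le_trans (lintegral_mono fun z => ?_) ((ofReal_integral_eq_lintegral_ofReal hf₀2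
      (Eventually.of_forall fun z => by positivity)).symm.le.trans (ENNReal.ofReal_le_ofReal hf₀))
    refine ENNReal.ofReal_le_ofReal ?_
    rw [Real.rpow_two, Real.norm_eq_abs]
    exact pow_le_pow_left₀ (abs_nonneg _) (hclip z) 2
  have hf2 : ∫⁻ z, ENNReal.ofReal (f z ^ 2) ∂μ ≠ ∞ := by
    have hi : Integrable (fun z => f z ^ 2) μ :=
      by
        have h1 : HasCompactSupport (f * f) := hfs.mul_right
        have h2 : Integrable (f * f) μ := (hfc.mul hfc).integrable_of_hasCompactSupport h1
        exact h2.congr (Eventually.of_forall fun z => (sq (f z)).symm)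
    rw [← ofReal_integral_eq_lintegral_ofReal hi (Eventually.of_forall fun z => sq_nonneg _)]
    exact ENNReal.ofReal_ne_top
  have hconst : ExpTail μ fun _ => (L : ℝ) := ExpTail.const (Nat.cast_nonneg L)
  have hψ₂2 : ∫⁻ z, ENNReal.ofReal (ψ₂ z ^ 2) ∂μ ≠ ∞ :=
    ne_top_of_le_ne_top hψ2 (lintegral_mono fun z =>
      ENNReal.ofReal_le_ofReal (sq_le_sq.2 (hψ₂ z).1))
  have hψ₁2 : ∫⁻ z, ENNReal.ofReal (ψ₁ z ^ 2) ∂μ ≠ ∞ :=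
    ne_top_of_le_ne_top hψ2 (lintegral_mono fun z =>
      ENNReal.ofReal_le_ofReal (sq_le_sq.2 (hψ₁le z)))
  refine ⟨⟨⟨f, hfc⟩, hfs⟩, fun g hg hgN => ?_, hfc.integrable_of_hasCompactSupport hfs⟩
  have hgN' := ne_top_of_le_ne_top (ENNReal.natCast_ne_top N) hgN
  have hif : Integrable (fun z => f z * ((g z : ℝ) - 1)) μ :=
    integrable_mul_sub_one hconst hg hgN' hfc.aestronglyMeasurable hf2 (Eventually.of_forall hfL)
  have hi1 : Integrable (fun z => ψ₁ z * ((g z : ℝ) - 1)) μ :=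
    integrable_mul_sub_one hh hg hgN' hψ₁m.aestronglyMeasurable hψ₁2
      (hψh.mono fun z hz => (hψ₁le z).trans hz)
  have hi2 : Integrable (fun z => ψ₂ z * ((g z : ℝ) - 1)) μ :=
    integrable_mul_sub_one hconst hg hgN' hψ₂m.aestronglyMeasurable hψ₂2
      (Eventually.of_forall fun z => (hψ₂ z).2)
  refine ⟨?_, hif⟩
  have hsplit : ∫ z, ψ z * ((g z : ℝ) - 1) ∂μ - ∫ z, f z * ((g z : ℝ) - 1) ∂μ
      = ∫ z, ψ₁ z * ((g z : ℝ) - 1) ∂μ + ∫ z, (ψ₂ z - f z) * ((g z : ℝ) - 1) ∂μ := by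
    have e1 : ∀ z, ψ z * ((g z : ℝ) - 1) = ψ₁ z * ((g z : ℝ) - 1) + ψ₂ z * ((g z : ℝ) - 1) :=
      fun z => by simp only [ψ₂]; ring
    simp_rw [e1, sub_mul (ψ₂ _)]
    rw [integral_add hi1 hi2, integral_sub hi2 hif]
    ring
  have b1 : |∫ z, ψ₁ z * ((g z : ℝ) - 1) ∂μ| ≤ ε / 2 := by
    refine abs_integral_mul_sub_one_le (by positivity) ?_
    have h1 := H g hg hgN (fun z => |ψ₁ z|)
      (hψh.mono fun z hz => ⟨abs_nonneg _, (hψ₁le z).trans hz⟩)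
    simp_rw [sq_abs] at h1
    refine (h1.trans (add_le_add hL le_rfl)).trans ?_
    rw [← ENNReal.ofReal_add hε4.le hε4.le]
    exact ENNReal.ofReal_le_ofReal (by linarith)
  have b2 : |∫ z, (ψ₂ z - f z) * ((g z : ℝ) - 1) ∂μ| ≤ ε / 2 := by
    refine abs_integral_mul_sub_one_le (by positivity) ?_
    have h1 := H' g hg hgN (fun z => |ψ₂ z - f z|) (Eventually.of_forall fun z =>
      ⟨abs_nonneg _, (abs_sub _ _).trans (by linarith [hfL z, (hψ₂ z).2])⟩)
    refine (h1.trans (add_le_add (mul_le_mul_right hdiff _) le_rfl)).trans ?_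
    rw [← ENNReal.ofReal_mul hC', ← ENNReal.ofReal_add (by positivity) hε4.le]
    refine ENNReal.ofReal_le_ofReal ?_
    have : C' * (ε / 4 / (C' + 1)) ≤ ε / 4 := by
      rw [mul_div_assoc', div_le_iff₀ (by positivity)]
      nlinarith
    linarith
  exact (congrArg abs hsplit).le.trans ((abs_add_le _ _).trans (by linarith))

/-- For `f` in `C_c`, `∫ f (g - 1) dμ = ∫ f d(g μ) - ∫ f dμ`, which converges by hypothesis; the
approximation of `ψ` by such `f` is uniform in the control, so `ε / 3` suffices. -/
theorem tendsto_integral_mul_sub_one {h : Ω → ℝ} (hh : ExpTail μ h) {N : ℕ} {ψ : Ω → ℝ}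
    (hψm : Measurable ψ) (hψ2 : ∫⁻ z, ENNReal.ofReal (ψ z ^ 2) ∂μ ≠ ∞)
    (hψh : ∀ᵐ z ∂μ, |ψ z| ≤ h z) {g : ℕ → Ω → ℝ≥0} {g₀ : Ω → ℝ≥0}
    (hg : ∀ n, Measurable (g n)) (hg₀ : Measurable g₀)
    (hgN : ∀ n, ∫⁻ z, ENNReal.ofReal (ell (g n z)) ∂μ ≤ N)
    (hg₀N : ∫⁻ z, ENNReal.ofReal (ell (g₀ z)) ∂μ ≤ N)
    (hlim : ∀ f : C_c(Ω, ℝ), Tendsto (fun n => ∫ z, f z ∂(μ.withDensity fun z => (g n z : ℝ≥0∞)))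
      atTop (𝓝 (∫ z, f z ∂(μ.withDensity fun z => (g₀ z : ℝ≥0∞))))) :
    Tendsto (fun n => ∫ z, ψ z * ((g n z : ℝ) - 1) ∂μ) atTop
      (𝓝 (∫ z, ψ z * ((g₀ z : ℝ) - 1) ∂μ)) := by
  rw [Metric.tendsto_atTop]
  intro ε hε
  obtain ⟨f, hf, hfi⟩ := exists_compactlySupported_approx hh N hψm hψ2 hψh
    (ε := ε / 3) (by positivity)
  have key : ∀ g : Ω → ℝ≥0, Measurable g → ∫⁻ z, ENNReal.ofReal (ell (g z)) ∂μ ≤ N →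
      ∫ z, f z * ((g z : ℝ) - 1) ∂μ
        = ∫ z, f z ∂(μ.withDensity fun z => (g z : ℝ≥0∞)) - ∫ z, f z ∂μ := by
    intro g hg hgN
    rw [integral_withDensity_eq_integral_smul hg, eq_sub_iff_add_eq,
      ← integral_add (hf g hg hgN).2 hfi]
    refine integral_congr_ae (Eventually.of_forall fun z => ?_)
    simp only [NNReal.smul_def, smul_eq_mul]; ring
  have h3 := (Metric.tendsto_atTop.1 (hlim f)) (ε / 3) (by positivity)
  obtain ⟨n₀, hn₀⟩ := h3
  refine ⟨n₀, fun n hn => ?_⟩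
  have a1 := abs_le.1 (hf (g n) (hg n) (hgN n)).1
  have a2 := abs_le.1 (hf g₀ hg₀ hg₀N).1
  have a3 := abs_lt.1 (hn₀ n hn)
  rw [key _ (hg n) (hgN n)] at a1
  rw [key _ hg₀ hg₀N] at a2
  rw [Real.dist_eq, abs_lt]
  constructor <;> linarith [a1.1, a1.2, a2.1, a2.2, a3.1, a3.2]

end Weak

/-! ### Chain rule for absolutely continuous functions -/

section AbsContinuity

theorem LipschitzOnWith.comp_absolutelyContinuousOnInterval {φ f : ℝ → ℝ} {C : ℝ≥0} {a b : ℝ}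
    {s : Set ℝ} (hφ : LipschitzOnWith C φ s) (hf : AbsolutelyContinuousOnInterval f a b)
    (hs : ∀ t ∈ uIcc a b, f t ∈ s) :
    AbsolutelyContinuousOnInterval (fun t => φ (f t)) a b := by
  rw [absolutelyContinuousOnInterval_iff] at hf ⊢
  intro ε hε
  obtain ⟨δ, hδ, H⟩ := hf (ε / (C + 1)) (by positivity)
  refine ⟨δ, hδ, fun E hE hlen => ?_⟩
  have h1 := H E hE hlen
  rw [lt_div_iff₀ (by positivity)] at h1
  refine lt_of_le_of_lt ?_ h1
  rw [Finset.sum_mul]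
  refine Finset.sum_le_sum fun i hi => ?_
  have h2 := hφ.dist_le_mul _ (hs _ (hE.1 i hi).1) _ (hs _ (hE.1 i hi).2)
  have h3 : 0 ≤ dist (f (E.2 i).1) (f (E.2 i).2) := dist_nonneg
  nlinarith

/-- Since `f` is only integrable, its primitive `F` is merely absolutely continuous; `φ ∘ F` is so
too, as `φ` is Lipschitz on the bounded range of `F`, and it equals the integral of its almost
everywhere derivative. -/
theorem IntervalIntegrable.integral_comp_primitive_mul {f : ℝ → ℝ} {a b c : ℝ}
    (hf : IntervalIntegrable f volume a b) {φ φ' : ℝ → ℝ} (hφ : ∀ x, HasDerivAt φ (φ' x) x)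
    (hφ' : Continuous φ') :
    ∫ t in a..b, f t * φ' (c + ∫ s in a..t, f s) = φ (c + ∫ s in a..b, f s) - φ c := by
  set F : ℝ → ℝ := fun t => c + ∫ s in a..t, f s
  have hF0 : AbsolutelyContinuousOnInterval (fun t => ∫ s in a..t, f s) a b :=
    hf.absolutelyContinuousOnInterval_intervalIntegral left_mem_uIcc
  have hcF : AbsolutelyContinuousOnInterval F a b := by
    have : LipschitzOnWith 1 (fun x : ℝ => c + x) univ :=
      ((isometry_add_left c).lipschitz).lipschitzOnWith
    exact this.comp_absolutelyContinuousOnInterval hF0 fun _ _ => mem_univ _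
  obtain ⟨B, hB⟩ := hcF.exists_bound
  have hB0 : 0 ≤ B := (norm_nonneg _).trans (hB a left_mem_uIcc)
  have hC1 : ContDiff ℝ 1 φ := by
    rw [contDiff_one_iff_deriv]
    refine ⟨fun x => (hφ x).differentiableAt, ?_⟩
    rwa [funext fun x => (hφ x).deriv]
  obtain ⟨C, hC⟩ := hC1.contDiffOn.exists_lipschitzOnWith (s := Icc (-B) B) (by decide)
    (convex_Icc _ _) isCompact_Icc
  have hac : AbsolutelyContinuousOnInterval (fun t => φ (F t)) a b :=
    hC.comp_absolutelyContinuousOnInterval hcF fun t ht => abs_le.1 (hB t ht)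
  have h := hac.integral_deriv_eq_sub
  have hFa : F a = c := by simp [F]
  rw [hFa] at h
  rw [← h]
  refine intervalIntegral.integral_congr_ae ?_
  filter_upwards [hf.ae_hasDerivAt_integral] with t ht htm
  have h1 := ht (uIoc_subset_uIcc htm) a left_mem_uIcc
  have h2 : HasDerivAt (fun t => φ (F t)) (φ' (F t) * f t) t :=
    (hφ (F t)).comp t (h1.const_add c)
  rw [h2.deriv, mul_comm]

end AbsContinuity

/-! ### Calculus on `[0, T]` and a Gronwall inequality -/

section Time

variable {T : ℝ}

/-- Extension by zero from `[0, T]` to `ℝ`. -/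
def extendT (f : Icc (0 : ℝ) T → ℝ) (s : ℝ) : ℝ := if h : s ∈ Icc (0 : ℝ) T then f ⟨s, h⟩ else 0

theorem extendT_coe (f : Icc (0 : ℝ) T → ℝ) (s : Icc (0 : ℝ) T) : extendT f s = f s := by
  simp [extendT]

theorem map_lamT : (lamT T).map Subtype.val = (volume : Measure ℝ).restrict (Icc 0 T) :=
  map_comap_subtype_coe measurableSet_Icc _

theorem measurableSet_le_time (t : Icc (0 : ℝ) T) : MeasurableSet {s : Icc (0 : ℝ) T | s ≤ t} :=
  measurableSet_Iic

theorem integral_lamT_eq (f : Icc (0 : ℝ) T → ℝ) (t : Icc (0 : ℝ) T) :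
    ∫ s in {s | s ≤ t}, f s ∂(lamT T) = ∫ s in (0 : ℝ)..t, extendT f s := by
  have h := (MeasurableEmbedding.subtype_coe (measurableSet_Icc (a := (0 : ℝ)) (b := T))).setIntegral_map
    (μ := lamT T) (extendT f) (Iic (t : ℝ))
  rw [map_lamT, Measure.restrict_restrict measurableSet_Iic] at h
  simp_rw [extendT_coe] at h
  have e1 : (Subtype.val ⁻¹' Iic (t : ℝ) : Set (Icc (0 : ℝ) T)) = {s | s ≤ t} := rfl
  have e2 : Iic (t : ℝ) ∩ Icc 0 T = Icc 0 (t : ℝ) := by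
    ext s
    exact ⟨fun h => ⟨h.2.1, h.1⟩, fun h => ⟨h.2, h.1, h.2.trans t.2.2⟩⟩
  rw [e1, e2] at h
  rw [← h, intervalIntegral.integral_of_le t.2.1, integral_Icc_eq_integral_Ioc]

theorem intervalIntegrable_extendT (hT : 0 ≤ T) {f : Icc (0 : ℝ) T → ℝ}
    (hf : Integrable f (lamT T)) : IntervalIntegrable (extendT f) volume 0 T := by
  rw [intervalIntegrable_iff_integrableOn_Icc_of_le hT, IntegrableOn, ← map_lamT,
    (MeasurableEmbedding.subtype_coe measurableSet_Icc).integrable_map_iff]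
  refine hf.congr (Eventually.of_forall fun s => ?_)
  exact (extendT_coe f s).symm

theorem integral_comp_primitive_lamT {f : Icc (0 : ℝ) T → ℝ} (hf : Integrable f (lamT T))
    {φ φ' : ℝ → ℝ} (hφ : ∀ x, HasDerivAt φ (φ' x) x) (hφ' : Continuous φ') (c : ℝ)
    (t : Icc (0 : ℝ) T) :
    ∫ s in {s | s ≤ t}, f s * φ' (c + ∫ r in {r | r ≤ s}, f r ∂(lamT T)) ∂(lamT T)
      = φ (c + ∫ s in {s | s ≤ t}, f s ∂(lamT T)) - φ c := by
  have hi := intervalIntegrable_extendT (t.2.1.trans t.2.2) hf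
  have hi2 : IntervalIntegrable (extendT f) volume 0 t :=
    hi.mono_set (by
      rw [uIcc_of_le t.2.1, uIcc_of_le (t.2.1.trans t.2.2)]
      exact Icc_subset_Icc_right t.2.2)
  rw [integral_lamT_eq, integral_lamT_eq, ← hi2.integral_comp_primitive_mul hφ hφ']
  refine intervalIntegral.integral_congr fun s hs => ?_
  rw [uIcc_of_le t.2.1] at hs
  have hs' : s ∈ Icc (0 : ℝ) T := ⟨hs.1, hs.2.trans t.2.2⟩
  have e := extendT_coe (fun s => f s * φ' (c + ∫ r in {r | r ≤ s}, f r ∂(lamT T))) ⟨s, hs'⟩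
  rw [integral_lamT_eq] at e
  have e2 := extendT_coe f ⟨s, hs'⟩
  simp only at e e2 ⊢
  rw [e, e2]

/-- The energy identity for a single coordinate of a path. -/
theorem sq_primitive_lamT {f : Icc (0 : ℝ) T → ℝ} (hf : Integrable f (lamT T)) (c : ℝ)
    (t : Icc (0 : ℝ) T) :
    (c + ∫ s in {s | s ≤ t}, f s ∂(lamT T)) ^ 2 = c ^ 2
      + ∫ s in {s | s ≤ t}, 2 * (c + ∫ r in {r | r ≤ s}, f r ∂(lamT T)) * f s ∂(lamT T) := by
  have h := integral_comp_primitive_lamT hf (φ := fun x => x ^ 2) (φ' := fun x => 2 * x)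
    (fun x => by simpa using hasDerivAt_pow 2 x) (by fun_prop) c t
  simp only at h
  rw [eq_sub_iff_add_eq] at h
  rw [← h, add_comm]
  congr 1
  exact integral_congr_ae (Eventually.of_forall fun s => by ring)

theorem setIntegral_le_sub_setIntegral_le {f : Icc (0 : ℝ) T → ℝ} (hf : Integrable f (lamT T))
    {s t : Icc (0 : ℝ) T} (hst : s ≤ t) :
    ∫ r in {r | r ≤ t}, f r ∂(lamT T) - ∫ r in {r | r ≤ s}, f r ∂(lamT T)
      = ∫ r in Ioc s t, f r ∂(lamT T) := by
  have e : {r | r ≤ t} = {r | r ≤ s} ∪ Ioc s t := (Iic_union_Ioc_eq_Iic hst).symm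
  rw [e, setIntegral_union (by
    rw [Set.disjoint_left]; intro r hr hr2; exact absurd hr2.1 (not_lt.2 hr))
    measurableSet_Ioc hf.integrableOn hf.integrableOn]
  ring

theorem continuous_primitive_lamT {f : Icc (0 : ℝ) T → ℝ} (hf : Integrable f (lamT T)) :
    Continuous fun t : Icc (0 : ℝ) T => ∫ s in {s | s ≤ t}, f s ∂(lamT T) := by
  rcases le_or_gt 0 T with hT | hT
  · have hi := intervalIntegrable_extendT hT hf
    have h1 := intervalIntegral.continuousOn_primitive_interval'
      (hi.def' |> fun _ => hi) (left_mem_uIcc (a := (0 : ℝ)) (b := T))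
    rw [uIcc_of_le hT] at h1
    simp_rw [integral_lamT_eq]
    exact h1.domRestrict
  · have : IsEmpty (Icc (0 : ℝ) T) := by
      rw [Icc_eq_empty hT.not_ge]; infer_instance
    exact continuous_of_const fun x => isEmptyElim x

/-- The hypothesis involves increasing majorants `M` of `y` instead of `y`, so that it applies to
delayed equations, whose right side contains past values. Let `k` be the primitive of `κ` and `P`
the supremum of `y exp(-2k)`. With `M = P exp(2k)` the integral is `(P / 2)(exp(2k) - 1)`, so `P ≤ c
+ P / 2`. -/
theorem gronwall_majorant {y κ : Icc (0 : ℝ) T → ℝ} (hκ0 : ∀ t, 0 ≤ κ t)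
    (hκ : Integrable κ (lamT T)) {c : ℝ} (hy0 : ∀ t, 0 ≤ y t)
    (hyb : BddAbove (range y))
    (H : ∀ M : Icc (0 : ℝ) T → ℝ, Monotone M → Continuous M → (∀ t, y t ≤ M t) →
      ∀ t, y t ≤ c + ∫ s in {s | s ≤ t}, κ s * M s ∂(lamT T)) (t : Icc (0 : ℝ) T) :
    y t ≤ 2 * c * Real.exp (2 * ∫ s, κ s ∂(lamT T)) := by
  set k : Icc (0 : ℝ) T → ℝ := fun t => ∫ s in {s | s ≤ t}, κ s ∂(lamT T)
  have hkc : Continuous k := continuous_primitive_lamT hκ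
  have hkm : Monotone k := fun s t hst =>
    setIntegral_mono_set hκ.integrableOn (Eventually.of_forall hκ0)
      (Eventually.of_forall fun r (hr : r ≤ s) => hr.trans hst)
  have hk0 : ∀ t, 0 ≤ k t := fun t => integral_nonneg hκ0
  have hkT : ∀ t, k t ≤ ∫ s, κ s ∂(lamT T) := fun t =>
    setIntegral_le_integral hκ (Eventually.of_forall hκ0)
  obtain ⟨B, hB⟩ := hyb
  have hz : BddAbove (range fun t => y t * Real.exp (-(2 * k t))) := by
    refine ⟨B, ?_⟩
    rintro _ ⟨t, rfl⟩
    refine le_trans (mul_le_of_le_one_right (hy0 t) ?_) (hB ⟨t, rfl⟩)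
    exact Real.exp_le_one_iff.2 (by linarith [hk0 t])
  set P := ⨆ t, y t * Real.exp (-(2 * k t))
  have hP : ∀ t, y t ≤ P * Real.exp (2 * k t) := by
    intro t
    have h1 := le_ciSup hz t
    have h2 : y t = y t * Real.exp (-(2 * k t)) * Real.exp (2 * k t) := by
      rw [mul_assoc, ← Real.exp_add]; simp
    rw [h2]
    gcongr
  have hP0 : 0 ≤ P := Real.iSup_nonneg fun t => mul_nonneg (hy0 t) (Real.exp_pos _).le
  have hexp : ∀ t, ∫ s in {s | s ≤ t}, κ s * (P * Real.exp (2 * k s)) ∂(lamT T)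
      = P / 2 * (Real.exp (2 * k t) - 1) := by
    intro t
    have h := integral_comp_primitive_lamT hκ (φ := fun x => P / 2 * Real.exp (2 * x))
      (φ' := fun x => P * Real.exp (2 * x)) (fun x => by
        have h1 : HasDerivAt (fun x : ℝ => 2 * x) 2 x := by
          simpa using (hasDerivAt_id x).const_mul 2
        refine (h1.exp.const_mul (P / 2)).congr_deriv ?_
        ring) (by fun_prop) 0 t
    simp only [zero_add, mul_zero, Real.exp_zero] at h
    rw [h]; ring
  have key := H (fun t => P * Real.exp (2 * k t))
    (fun s t hst => mul_le_mul_of_nonneg_left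
      (Real.exp_le_exp.2 (by linarith [hkm hst])) hP0) (by fun_prop) hP
  have hne : Nonempty (Icc (0 : ℝ) T) := ⟨t⟩
  -- The sign of `c` is not assumed; it is read off below at time `0`, where the integral vanishes.
  have hcP : P ≤ max c 0 + P / 2 := by
    refine ciSup_le fun t => ?_
    have h1 := key t
    rw [hexp] at h1
    rw [Real.exp_neg, ← div_eq_mul_inv, div_le_iff₀ (Real.exp_pos _)]
    have h2 : 1 ≤ Real.exp (2 * k t) := Real.one_le_exp (by linarith [hk0 t])
    have h3 : max c 0 ≤ max c 0 * Real.exp (2 * k t) :=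
      le_mul_of_one_le_right (le_max_right _ _) h2
    nlinarith [le_max_left c 0]
  have hc0 : 0 ≤ c := by
    have h0 : (0 : ℝ) ≤ T := t.2.1.trans t.2.2
    have h1 := key ⟨0, le_rfl, h0⟩
    rw [hexp] at h1
    have h2 : k ⟨0, le_rfl, h0⟩ = 0 := by simp only [k]; rw [integral_lamT_eq]; simp
    rw [h2] at h1
    simp at h1
    exact (hy0 _).trans h1
  rw [max_eq_left hc0] at hcP
  calc y t ≤ P * Real.exp (2 * k t) := hP t
    _ ≤ 2 * c * Real.exp (2 * ∫ s, κ s ∂(lamT T)) := by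
      have := hkT t
      gcongr
      linarith

end Time

/-! ### Bounds on the coefficients along bounded paths -/

section Context

variable {Φ : Type*} [AddCommGroup Φ] [Module ℝ Φ] [UniformSpace Φ] [IsUniformAddGroup Φ]
  {X : Type*} [TopologicalSpace X] [MeasurableSpace X] {T : ℝ}

theorem MeasurableCoeff.measurable_A {A : Icc (0 : ℝ) T → StrongDual ℝ Φ → StrongDual ℝ Φ}
    {G : Icc (0 : ℝ) T → StrongDual ℝ Φ → X → StrongDual ℝ Φ} (h : MeasurableCoeff A G)
    {Y : Icc (0 : ℝ) T → StrongDual ℝ Φ} (hY : ∀ x, Measurable fun s => Y s x) (x : Φ) :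
    Measurable fun s => A s (Y s) x := by
  let _ : MeasurableSpace (StrongDual ℝ Φ) := dualSigma Φ
  have h1 : Measurable fun s : Icc (0 : ℝ) T => (s, Y s) :=
    measurable_id.prodMk (CHNS.measurable_of_eval hY)
  exact (CHNS.measurable_eval x).comp (h.1.comp h1)

theorem MeasurableCoeff.measurable_G {A : Icc (0 : ℝ) T → StrongDual ℝ Φ → StrongDual ℝ Φ}
    {G : Icc (0 : ℝ) T → StrongDual ℝ Φ → X → StrongDual ℝ Φ} (h : MeasurableCoeff A G)
    {Y : Icc (0 : ℝ) T → StrongDual ℝ Φ} (hY : ∀ x, Measurable fun s => Y s x) (x : Φ) :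
    Measurable fun z : Icc (0 : ℝ) T × X => G z.1 (Y z.1) z.2 x := by
  let _ : MeasurableSpace (StrongDual ℝ Φ) := dualSigma Φ
  have h1 : Measurable fun z : Icc (0 : ℝ) T × X => (z.1, Y z.1, z.2) :=
    measurable_fst.prodMk (((CHNS.measurable_of_eval hY).comp measurable_fst).prodMk measurable_snd)
  exact (CHNS.measurable_eval x).comp (h.2.comp h1)

theorem MeasurableCoeff.measurable_G_right {A : Icc (0 : ℝ) T → StrongDual ℝ Φ → StrongDual ℝ Φ}
    {G : Icc (0 : ℝ) T → StrongDual ℝ Φ → X → StrongDual ℝ Φ} (h : MeasurableCoeff A G)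
    (s : Icc (0 : ℝ) T) (w : StrongDual ℝ Φ) (x : Φ) : Measurable fun v => G s w v x :=
  (h.measurable_G (Y := fun _ => w) (fun _ => measurable_const) x).comp measurable_prodMk_left

/-- The integral part of the skeleton equation. -/
def skInt (ν : Measure X) (A : Icc (0 : ℝ) T → StrongDual ℝ Φ → StrongDual ℝ Φ)
    (G : Icc (0 : ℝ) T → StrongDual ℝ Φ → X → StrongDual ℝ Φ) (g : Icc (0 : ℝ) T × X → ℝ≥0)
    (Y : Icc (0 : ℝ) T → StrongDual ℝ Φ) (x : Φ) (t : Icc (0 : ℝ) T) : ℝ :=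
  ∫ s in {s | s ≤ t}, A s (Y s) x ∂(lamT T)
    + ∫ z in {z | z.1 ≤ t}, G z.1 (Y z.1) z.2 x * ((g z : ℝ) - 1) ∂(nuT T ν)

/-- The control term `∫ G(s, u, v)[x] (g(s, v) - 1) ν(dv)`. -/
def ctrlTerm (ν : Measure X) (G : Icc (0 : ℝ) T → StrongDual ℝ Φ → X → StrongDual ℝ Φ)
    (g : Icc (0 : ℝ) T × X → ℝ≥0) (s : Icc (0 : ℝ) T) (u : StrongDual ℝ Φ) (x : Φ) : ℝ :=
  ∫ v, G s u v x * ((g (s, v) : ℝ) - 1) ∂ν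

/-- Standing assumptions on the coefficients at one level, with the growth norm dominated by a
function with square-exponential tail. -/
structure GrowthContext (S : CHNS Φ) (ν : Measure X)
    (A : Icc (0 : ℝ) T → StrongDual ℝ Φ → StrongDual ℝ Φ)
    (G : Icc (0 : ℝ) T → StrongDual ℝ Φ → X → StrongDual ℝ Φ) (p q : ℕ) (K : ℝ)
    (h₀ : Icc (0 : ℝ) T × X → ℝ) : Prop where
  meas : MeasurableCoeff A G
  le : p ≤ q
  coeff : CoeffCondition S ν A G p q K
  K_nonneg : 0 ≤ K
  tail : ExpTail (nuT T ν) h₀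
  growth : ∀ᵐ z ∂(nuT T ν), growthNorm S G p z ≤ ENNReal.ofReal (h₀ z)

/-- A measurable control of cost at most `N`. -/
structure CostLE (T : ℝ) (ν : Measure X) (N : ℕ) (g : Icc (0 : ℝ) T × X → ℝ≥0) : Prop where
  meas : Measurable g
  cost : ∫⁻ z, ENNReal.ofReal (ell (g z)) ∂(nuT T ν) ≤ N

theorem CostLE.ne_top {ν : Measure X} {N : ℕ} {g : Icc (0 : ℝ) T × X → ℝ≥0}
    (hg : CostLE T ν N g) : ∫⁻ z, ENNReal.ofReal (ell (g z)) ∂(nuT T ν) ≠ ∞ :=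
  ne_top_of_le_ne_top (ENNReal.natCast_ne_top N) hg.cost

/-- A measurable path bounded by `R` in `Φ_{-p}`. -/
structure BoundedPath (S : CHNS Φ) (p : ℕ) (R : ℝ) (Y : Icc (0 : ℝ) T → StrongDual ℝ Φ) :
    Prop where
  meas : ∀ x, Measurable fun s => Y s x
  bound : ∀ s, S.negNorm p (Y s) ≤ ENNReal.ofReal R

variable {S : CHNS Φ} {ν : Measure X}
  {A : Icc (0 : ℝ) T → StrongDual ℝ Φ → StrongDual ℝ Φ}
  {G : Icc (0 : ℝ) T → StrongDual ℝ Φ → X → StrongDual ℝ Φ} {p q : ℕ} {K R : ℝ}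
  {h₀ : Icc (0 : ℝ) T × X → ℝ} {N : ℕ} {g : Icc (0 : ℝ) T × X → ℝ≥0} {Y : Icc (0 : ℝ) T → StrongDual ℝ Φ}

theorem BoundedPath.ne_top (hY : BoundedPath S p R Y) (s : Icc (0 : ℝ) T) :
    S.negNorm p (Y s) ≠ ∞ := ne_top_of_le_ne_top ENNReal.ofReal_ne_top (hY.bound s)

theorem BoundedPath.nn_le (hY : BoundedPath S p R Y) (hR : 0 ≤ R) (s : Icc (0 : ℝ) T) :
    S.nn p (Y s) ≤ R := S.nn_le_of_le hR (hY.bound s)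

namespace CoeffCondition

variable (h : CoeffCondition S ν A G p q K)
include h

theorem A_ne_top (t : Icc (0 : ℝ) T) {w : StrongDual ℝ Φ} (hw : S.negNorm p w ≠ ∞) :
    S.negNorm q (A t w) ≠ ∞ := by
  obtain ⟨u, rfl⟩ := S.exists_incl_eq hw
  exact (h.mem_A t u).ne

theorem nn_A_sq_le (hK : 0 ≤ K) (t : Icc (0 : ℝ) T) {w : StrongDual ℝ Φ}
    (hw : S.negNorm p w ≠ ∞) : S.nn q (A t w) ^ 2 ≤ K * (1 + S.nn p w ^ 2) := by
  obtain ⟨u, rfl⟩ := S.exists_incl_eq hw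
  rw [S.nn_incl, CHNS.nn, ← ENNReal.toReal_pow]
  exact ENNReal.toReal_le_of_le_ofReal (by positivity) (h.growth_A t u)

theorem nn_A_le (hK : 0 ≤ K) (t : Icc (0 : ℝ) T) {w : StrongDual ℝ Φ}
    (hw : S.negNorm p w ≠ ∞) : S.nn q (A t w) ≤ √(K * (1 + S.nn p w ^ 2)) :=
  Real.le_sqrt_of_sq_le (h.nn_A_sq_le hK t hw)

theorem G_ne_top (t : Icc (0 : ℝ) T) {w : StrongDual ℝ Φ} (hw : S.negNorm p w ≠ ∞) (v : X) :
    S.negNorm p (G t w v) ≠ ∞ := by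
  obtain ⟨u, rfl⟩ := S.exists_incl_eq hw
  exact (h.mem_G t u v).ne

theorem lintegral_G_sq_le (t : Icc (0 : ℝ) T) {w : StrongDual ℝ Φ}
    (hw : S.negNorm p w ≠ ∞) :
    ∫⁻ v, ENNReal.ofReal (S.nn p (G t w v) ^ 2) ∂ν ≤ ENNReal.ofReal (K * (1 + S.nn p w ^ 2)) := by
  have e : ∀ v, ENNReal.ofReal (S.nn p (G t w v) ^ 2) = S.negNorm p (G t w v) ^ 2 := fun v => by
    rw [ENNReal.ofReal_pow (S.nn_nonneg _ _), S.ofReal_nn (h.G_ne_top t hw v)]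
  simp_rw [e]
  obtain ⟨u, rfl⟩ := S.exists_incl_eq hw
  rw [S.nn_incl]
  exact h.growth_G t u

end CoeffCondition

theorem nn_G_le_of_growthNorm_le {z : Icc (0 : ℝ) T × X} {c : ℝ} (hc : 0 ≤ c)
    (h : growthNorm S G p z ≤ ENNReal.ofReal c) {w : StrongDual ℝ Φ} (hw : S.negNorm p w ≠ ∞) :
    S.nn p (G z.1 w z.2) ≤ c * (1 + S.nn p w) := by
  obtain ⟨u, rfl⟩ := S.exists_incl_eq hw
  have h1 : S.negNorm p (G z.1 (S.incl p u) z.2) / (1 + ‖u‖ₑ) ≤ ENNReal.ofReal c :=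
    (le_iSup (fun u : S.Neg p => S.negNorm p (G z.1 (S.incl p u) z.2) / (1 + ‖u‖ₑ)) u).trans h
  rw [ENNReal.div_le_iff (by simp) (by simp)] at h1
  have e : ENNReal.ofReal c * (1 + ‖u‖ₑ) = ENNReal.ofReal (c * (1 + ‖u‖)) := by
    rw [ENNReal.ofReal_mul hc, ENNReal.ofReal_add zero_le_one (norm_nonneg _), ENNReal.ofReal_one,
      ofReal_norm]
  rw [e] at h1
  rw [S.nn_incl]
  exact ENNReal.toReal_le_of_le_ofReal (by positivity) h1

theorem nn_G_sub_le_of_lipNorm_le {z : Icc (0 : ℝ) T × X} {c : ℝ} (hc : 0 ≤ c)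
    (h : lipNorm S G q z ≤ ENNReal.ofReal c) {w₁ w₂ : StrongDual ℝ Φ}
    (hw₁ : S.negNorm q w₁ ≠ ∞) (hw₂ : S.negNorm q w₂ ≠ ∞) :
    S.nn q (G z.1 w₁ z.2 - G z.1 w₂ z.2) ≤ c * S.nn q (w₁ - w₂) := by
  obtain ⟨u₁, rfl⟩ := S.exists_incl_eq hw₁
  obtain ⟨u₂, rfl⟩ := S.exists_incl_eq hw₂
  by_cases hne : u₁ = u₂
  · rw [hne, sub_self, sub_self, CHNS.nn, S.negNorm_zero]; simp
  have h1 : S.negNorm q (G z.1 (S.incl q u₁) z.2 - G z.1 (S.incl q u₂) z.2) / ‖u₁ - u₂‖ₑ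
      ≤ ENNReal.ofReal c :=
    (le_iSup_of_le (f := fun u₁ : S.Neg q => ⨆ (u₂ : S.Neg q) (_ : u₁ ≠ u₂),
      S.negNorm q (G z.1 (S.incl q u₁) z.2 - G z.1 (S.incl q u₂) z.2) / ‖u₁ - u₂‖ₑ) u₁
      (le_iSup₂_of_le u₂ hne le_rfl)).trans h
  have h0 : 0 < ‖u₁ - u₂‖ := norm_pos_iff.2 (sub_ne_zero.2 hne)
  rw [← ofReal_norm, ENNReal.div_le_iff (ENNReal.ofReal_pos.2 h0).ne' ENNReal.ofReal_ne_top, ← ENNReal.ofReal_mul hc] at h1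
  rw [← S.incl_sub, S.nn_incl]
  exact ENNReal.toReal_le_of_le_ofReal (by positivity) h1

namespace GrowthContext

variable [SigmaFinite ν] (H : GrowthContext S ν A G p q K h₀)
include H

theorem integrable_A (hR : 0 ≤ R) (hY : BoundedPath S p R Y) (x : Φ) :
    Integrable (fun s => A s (Y s) x) (lamT T) := by
  refine Integrable.of_bound (H.meas.measurable_A hY.meas x).aestronglyMeasurable
    (√(K * (1 + R ^ 2)) * ‖S.toLevel q x‖) (Eventually.of_forall fun s => ?_)
  refine (S.abs_apply_le (H.coeff.A_ne_top s (hY.ne_top s)) x).trans ?_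
  gcongr
  refine (H.coeff.nn_A_le H.K_nonneg s (hY.ne_top s)).trans (Real.sqrt_le_sqrt ?_)
  have := H.K_nonneg
  have := hY.nn_le hR s
  have := S.nn_nonneg p (Y s)
  gcongr

theorem abs_A_le (hR : 0 ≤ R) (hY : BoundedPath S p R Y) (x : Φ) (s : Icc (0 : ℝ) T) :
    |A s (Y s) x| ≤ √(K * (1 + R ^ 2)) * ‖S.toLevel q x‖ := by
  refine (S.abs_apply_le (H.coeff.A_ne_top s (hY.ne_top s)) x).trans ?_
  gcongr
  refine (H.coeff.nn_A_le H.K_nonneg s (hY.ne_top s)).trans (Real.sqrt_le_sqrt ?_)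
  have := H.K_nonneg
  have := hY.nn_le hR s
  have := S.nn_nonneg p (Y s)
  gcongr

theorem measurable_nn_G (hY : BoundedPath S p R Y) (n : ℕ) :
    Measurable fun z : Icc (0 : ℝ) T × X => S.nn n (G z.1 (Y z.1) z.2) :=
  S.measurable_nn_comp (fun x => H.meas.measurable_G hY.meas x) n

/-- The supremum over states is inside `growthNorm`, so one null set serves all `w`; the state may
then be the value of a path. -/
theorem ae_nn_G_le : ∀ᵐ z ∂(nuT T ν), ∀ w, S.negNorm p w ≠ ∞ →
    S.nn p (G z.1 w z.2) ≤ h₀ z * (1 + S.nn p w) :=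
  H.growth.mono fun z hz _ hw => nn_G_le_of_growthNorm_le (H.tail.nonneg z) hz hw

theorem ae_abs_G_le (hR : 0 ≤ R) (hY : BoundedPath S p R Y) (x : Φ) :
    ∀ᵐ z ∂(nuT T ν), |G z.1 (Y z.1) z.2 x| ≤ ((1 + R) * ‖S.toLevel p x‖ + 1) * h₀ z := by
  filter_upwards [H.ae_nn_G_le] with z hz
  have h1 := hz _ (hY.ne_top z.1)
  have h2 := S.abs_apply_le (H.coeff.G_ne_top z.1 (hY.ne_top z.1) z.2) x
  have h3 := hY.nn_le hR z.1
  have h4 := H.tail.nonneg z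
  calc |G z.1 (Y z.1) z.2 x| ≤ S.nn p (G z.1 (Y z.1) z.2) * ‖S.toLevel p x‖ := h2
    _ ≤ h₀ z * (1 + R) * ‖S.toLevel p x‖ := by
      gcongr
      exact h1.trans (by gcongr)
    _ ≤ _ := by nlinarith

theorem lintegral_nn_G_sq_le (hR : 0 ≤ R) (hY : BoundedPath S p R Y)
    (s : Set (Icc (0 : ℝ) T)) :
    ∫⁻ z in s ×ˢ univ, ENNReal.ofReal (S.nn p (G z.1 (Y z.1) z.2) ^ 2) ∂(nuT T ν)
      ≤ ENNReal.ofReal (K * (1 + R ^ 2)) * lamT T s := by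
  have hm := ((H.measurable_nn_G hY p).pow_const 2).ennreal_ofReal
  rw [nuT, ← Measure.prod_restrict, Measure.restrict_univ, lintegral_prod _ hm.aemeasurable]
  refine (lintegral_mono fun t => H.coeff.lintegral_G_sq_le t (hY.ne_top t)).trans ?_
  refine (lintegral_mono fun t => ENNReal.ofReal_le_ofReal (?_ : _ ≤ K * (1 + R ^ 2))).trans ?_
  · have := H.K_nonneg
    have := hY.nn_le hR t
    have := S.nn_nonneg p (Y t)
    gcongr
  · rw [lintegral_const, Measure.restrict_apply_univ]

theorem lintegral_G_apply_sq_le (hR : 0 ≤ R) (hY : BoundedPath S p R Y) (x : Φ)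
    (s : Set (Icc (0 : ℝ) T)) :
    ∫⁻ z in s ×ˢ univ, ENNReal.ofReal (G z.1 (Y z.1) z.2 x ^ 2) ∂(nuT T ν)
      ≤ ENNReal.ofReal (‖S.toLevel p x‖ ^ 2 * (K * (1 + R ^ 2))) * lamT T s := by
  rw [ENNReal.ofReal_mul (by positivity), mul_assoc]
  refine le_trans ?_ (mul_le_mul_right (H.lintegral_nn_G_sq_le hR hY s) _)
  rw [← lintegral_const_mul' _ _ ENNReal.ofReal_ne_top]
  refine lintegral_mono fun z => ?_
  rw [← ENNReal.ofReal_mul (by positivity), ← mul_pow]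
  refine ENNReal.ofReal_le_ofReal (sq_le_sq.2 ?_)
  rw [abs_of_nonneg (mul_nonneg (norm_nonneg _) (S.nn_nonneg _ _)), mul_comm]
  exact S.abs_apply_le (H.coeff.G_ne_top z.1 (hY.ne_top z.1) z.2) x

theorem lintegral_G_apply_sq_ne_top (hR : 0 ≤ R) (hY : BoundedPath S p R Y) (x : Φ) :
    ∫⁻ z, ENNReal.ofReal (G z.1 (Y z.1) z.2 x ^ 2) ∂(nuT T ν) ≠ ∞ := by
  have h := H.lintegral_G_apply_sq_le hR hY x univ
  rw [univ_prod_univ, Measure.restrict_univ] at h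
  exact ne_top_of_le_ne_top (ENNReal.mul_ne_top ENNReal.ofReal_ne_top (measure_ne_top _ _)) h

theorem tail_mul (hR : 0 ≤ R) (x : Φ) :
    ExpTail (nuT T ν) fun z => ((1 + R) * ‖S.toLevel p x‖ + 1) * h₀ z :=
  H.tail.const_mul (by positivity)

theorem integrable_G (hR : 0 ≤ R) (hY : BoundedPath S p R Y) (hg : CostLE T ν N g) (x : Φ) :
    Integrable (fun z => G z.1 (Y z.1) z.2 x * ((g z : ℝ) - 1)) (nuT T ν) :=
  integrable_mul_sub_one (H.tail_mul hR x) hg.meas hg.ne_top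
    (H.meas.measurable_G hY.meas x).aestronglyMeasurable (H.lintegral_G_apply_sq_ne_top hR hY x)
    (H.ae_abs_G_le hR hY x)

theorem integrable_ctrlTerm (hR : 0 ≤ R) (hY : BoundedPath S p R Y) (hg : CostLE T ν N g) (x : Φ) :
    Integrable (fun s => ctrlTerm ν G g s (Y s) x) (lamT T) :=
  (H.integrable_G hR hY hg x).integral_prod_left

/-- Fubini exhibits the integral part as a primitive in time, to which the chain rule applies. -/
theorem skInt_eq (hR : 0 ≤ R) (hY : BoundedPath S p R Y) (hg : CostLE T ν N g) (x : Φ)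
    (t : Icc (0 : ℝ) T) :
    skInt ν A G g Y x t
      = ∫ s in {s | s ≤ t}, (A s (Y s) x + ctrlTerm ν G g s (Y s) x) ∂(lamT T) := by
  have e : {z : Icc (0 : ℝ) T × X | z.1 ≤ t} = {s | s ≤ t} ×ˢ univ := by ext z; simp
  rw [integral_add (H.integrable_A hR hY x).integrableOn
    (H.integrable_ctrlTerm hR hY hg x).integrableOn, skInt, e,
    setIntegral_prod _ (H.integrable_G hR hY hg x).integrableOn]
  simp [ctrlTerm]

/-- Uniform equicontinuity of the integral part along paths bounded in `Φ_{-p}` and controls of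
bounded cost. -/
theorem exists_skInt_modulus (hR : 0 ≤ R) (N : ℕ) (x : Φ) {ε : ℝ} (hε : 0 < ε) :
    ∃ C : ℝ, 0 ≤ C ∧ ∀ (Y : Icc (0 : ℝ) T → StrongDual ℝ Φ), BoundedPath S p R Y →
      ∀ g, CostLE T ν N g → ∀ s t : Icc (0 : ℝ) T, s ≤ t →
        |skInt ν A G g Y x t - skInt ν A G g Y x s| ≤ C * (t - s : ℝ) + ε := by
  obtain ⟨C, hC, HC⟩ := lintegral_mul_abs_sub_one_le (H.tail_mul hR x) N hε
  refine ⟨√(K * (1 + R ^ 2)) * ‖S.toLevel q x‖ + C * (‖S.toLevel p x‖ ^ 2 * (K * (1 + R ^ 2))),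
    by have := H.K_nonneg; positivity, fun Y hY g hg s t hst => ?_⟩
  have hvol : lamT T (Ioc s t) = ENNReal.ofReal (t - s : ℝ) := by
    rw [lamT, comap_subtype_coe_apply measurableSet_Icc]
    have : Subtype.val '' Ioc s t = Ioc (s : ℝ) t := by
      ext r
      constructor
      · rintro ⟨r, hr, rfl⟩; exact hr
      · intro hr
        exact ⟨⟨r, s.2.1.trans hr.1.le, hr.2.trans t.2.2⟩, hr, rfl⟩
    rw [this, Real.volume_Ioc]
  have hts : (0 : ℝ) ≤ t - s := sub_nonneg.2 hst
  have hA := H.integrable_A hR hY x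
  have hI := H.integrable_ctrlTerm hR hY hg x
  rw [H.skInt_eq hR hY hg, H.skInt_eq hR hY hg, setIntegral_le_sub_setIntegral_le (f := fun r => A r (Y r) x + ctrlTerm ν G g r (Y r) x)
      (hA.add hI) hst,
    integral_add hA.integrableOn hI.integrableOn]
  have b1 : |∫ r in Ioc s t, A r (Y r) x ∂(lamT T)|
      ≤ √(K * (1 + R ^ 2)) * ‖S.toLevel q x‖ * (t - s : ℝ) := by
    have h1 := norm_setIntegral_le_of_norm_le_const (μ := lamT T) (s := Ioc s t)
      (f := fun r => A r (Y r) x) (C := √(K * (1 + R ^ 2)) * ‖S.toLevel q x‖)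
      (measure_lt_top _ _) (fun r _ => H.abs_A_le hR hY x r)
    rw [Measure.real, hvol, ENNReal.toReal_ofReal hts] at h1
    exact h1
  -- The increment is an integral over the strip `(s, t] × X`. With the indicator of the strip put
  -- into the integrand, the square integral is of order `t - s`, and the uniform estimate adds only
  -- `ε`.
  have b2 : |∫ r in Ioc s t, ctrlTerm ν G g r (Y r) x ∂(lamT T)|
      ≤ C * (‖S.toLevel p x‖ ^ 2 * (K * (1 + R ^ 2)) * (t - s : ℝ)) + ε := by
    have e : ∫ r in Ioc s t, ctrlTerm ν G g r (Y r) x ∂(lamT T)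
        = ∫ z, (Ioc s t ×ˢ univ).indicator (fun z => G z.1 (Y z.1) z.2 x) z
            * ((g z : ℝ) - 1) ∂(nuT T ν) := by
      have e0 : ∀ z, (Ioc s t ×ˢ univ).indicator (fun z => G z.1 (Y z.1) z.2 x) z
          * ((g z : ℝ) - 1) = (Ioc s t ×ˢ univ).indicator
            (fun z => G z.1 (Y z.1) z.2 x * ((g z : ℝ) - 1)) z := fun z =>
        (indicator_mul_left _ (fun z : Icc (0 : ℝ) T × X => G z.1 (Y z.1) z.2 x)
          fun z => (g z : ℝ) - 1).symm
      simp_rw [e0]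
      rw [integral_indicator (measurableSet_Ioc.prod MeasurableSet.univ),
        setIntegral_prod _ (H.integrable_G hR hY hg x).integrableOn]
      simp [ctrlTerm]
    have hK := H.K_nonneg
    rw [e]
    refine abs_integral_mul_sub_one_le (by positivity) ?_
    refine (HC g hg.meas hg.cost (fun z => |(Ioc s t ×ˢ univ).indicator
      (fun z => G z.1 (Y z.1) z.2 x) z|) ?_).trans ?_
    · filter_upwards [H.ae_abs_G_le hR hY x] with z hz
      refine ⟨abs_nonneg _, le_trans ?_ hz⟩
      simp only [indicator]
      split_ifs
      · exact le_rfl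
      · simp
    · rw [ENNReal.ofReal_add (by positivity) hε.le, ENNReal.ofReal_mul hC]
      gcongr
      have h1 := H.lintegral_G_apply_sq_le hR hY x (Ioc s t)
      rw [hvol, ← ENNReal.ofReal_mul (by positivity)] at h1
      refine le_trans (le_of_eq ?_) h1
      rw [← lintegral_indicator (measurableSet_Ioc.prod MeasurableSet.univ)]
      refine lintegral_congr fun z => ?_
      simp only [indicator, sq_abs]
      split_ifs <;> simp
  refine (abs_add_le _ _).trans ((add_le_add b1 b2).trans (le_of_eq ?_))
  ring

/-- Integrable bound on the control term, uniform in the state up to linear growth. -/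
theorem exists_ctrl_bound (N : ℕ) : ∃ B : ℝ, 0 ≤ B ∧ ∀ g, CostLE T ν N g →
    ∃ b : Icc (0 : ℝ) T → ℝ, (∀ s, 0 ≤ b s) ∧ Integrable b (lamT T) ∧ ∫ s, b s ∂(lamT T) ≤ B ∧
      ∀ᵐ s ∂(lamT T), ∀ w, S.negNorm p w ≠ ∞ → ∀ (F : X → ℝ) (c : ℝ), 0 ≤ c →
        (∀ v, |F v| ≤ c * S.nn p (G s w v)) →
        |∫ v, F v * ((g (s, v) : ℝ) - 1) ∂ν| ≤ c * ((1 + S.nn p w) * b s) := by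
  obtain ⟨C, hC, W, hWm, hW0, hWi, HW⟩ := H.tail.exists_small one_pos
  have hK := H.K_nonneg
  set B₀ : ℝ≥0∞ := ENNReal.ofReal (C * K) * lamT T univ + (N + ENNReal.ofReal 1)
  have hB₀ : B₀ ≠ ∞ := ENNReal.add_ne_top.2
    ⟨ENNReal.mul_ne_top ENNReal.ofReal_ne_top (measure_ne_top _ _), by simp⟩
  refine ⟨B₀.toReal, ENNReal.toReal_nonneg, fun g hg => ?_⟩
  have hgm : Measurable fun z => ENNReal.ofReal (ell (g z)) :=
    (measurable_ell.comp hg.meas).ennreal_ofReal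
  have hWm' := hWm.ennreal_ofReal
  -- The three terms bound the `ν`-integrals of the three terms in `ExpTail.exists_small`; total
  -- mass at most `C K T + N + 1`, whatever the control.
  set bE : Icc (0 : ℝ) T → ℝ≥0∞ := fun s => ENNReal.ofReal (C * K)
    + (∫⁻ v, ENNReal.ofReal (ell (g (s, v))) ∂ν + ∫⁻ v, ENNReal.ofReal (W (s, v)) ∂ν)
  have hbm : Measurable bE :=
    measurable_const.add (hgm.lintegral_prod_right'.add hWm'.lintegral_prod_right')
  have hbi : ∫⁻ s, bE s ∂(lamT T) ≤ B₀ := by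
    simp only [bE]
    have hm1 : Measurable fun s : Icc (0 : ℝ) T => ∫⁻ v, ENNReal.ofReal (ell (g (s, v))) ∂ν :=
      hgm.lintegral_prod_right'
    rw [lintegral_add_left measurable_const, lintegral_const, lintegral_add_left hm1,
      ← lintegral_prod _ hgm.aemeasurable, ← lintegral_prod _ hWm'.aemeasurable]
    exact add_le_add le_rfl (add_le_add hg.cost hWi)
  have hbfin := ae_lt_top hbm (ne_top_of_le_ne_top hB₀ hbi)
  refine ⟨fun s => (bE s).toReal, fun s => ENNReal.toReal_nonneg,
    integrable_toReal_of_lintegral_ne_top hbm.aemeasurable (ne_top_of_le_ne_top hB₀ hbi), ?_, ?_⟩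
  · rw [integral_toReal hbm.aemeasurable hbfin]
    exact ENNReal.toReal_mono hB₀ hbi
  · filter_upwards [hbfin, Measure.ae_ae_of_ae_prod H.ae_nn_G_le] with s hs1 hs2 w hw F c hc hF
    have hn := S.nn_nonneg p w
    have hn1 : 0 < 1 + S.nn p w := by positivity
    have hGm : Measurable fun v => S.nn p (G s w v) :=
      S.measurable_nn_comp (fun x => H.meas.measurable_G_right s w x) p
    rw [← Real.norm_eq_abs]
    refine (norm_integral_le_lintegral_norm _).trans
      (ENNReal.toReal_le_of_le_ofReal (by positivity) ?_)
    have hpt : ∀ᵐ v ∂ν, ENNReal.ofReal ‖F v * ((g (s, v) : ℝ) - 1)‖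
        ≤ ENNReal.ofReal (c * (1 + S.nn p w)) *
          (ENNReal.ofReal (C / (1 + S.nn p w) ^ 2) * ENNReal.ofReal (S.nn p (G s w v) ^ 2)
            + (ENNReal.ofReal (ell (g (s, v))) + ENNReal.ofReal (W (s, v)))) := by
      filter_upwards [hs2] with v hv
      -- Dividing `‖G‖_{-p}` by `1 + ‖w‖_{-p}` puts it below `h₀` independently of the state.
      have h1 := HW (s, v) (S.nn p (G s w v) / (1 + S.nn p w)) (g (s, v))
        (div_nonneg (S.nn_nonneg _ _) hn1.le) ((div_le_iff₀ hn1).2 (hv w hw))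
      have he := ell_nonneg (g (s, v))
      have hW := hW0 (s, v)
      rw [← ENNReal.ofReal_mul (by positivity), ← ENNReal.ofReal_add he hW,
        ← ENNReal.ofReal_add (by positivity) (by positivity), ← ENNReal.ofReal_mul (by positivity)]
      refine ENNReal.ofReal_le_ofReal ?_
      rw [norm_mul, Real.norm_eq_abs, Real.norm_eq_abs]
      calc |F v| * |(g (s, v) : ℝ) - 1|
          ≤ c * S.nn p (G s w v) * |(g (s, v) : ℝ) - 1| := by gcongr; exact hF v
        _ = c * (1 + S.nn p w) * (S.nn p (G s w v) / (1 + S.nn p w) * |(g (s, v) : ℝ) - 1|) := by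
            field_simp
        _ ≤ c * (1 + S.nn p w) * (C * (S.nn p (G s w v) / (1 + S.nn p w)) ^ 2
              + 1 * ell (g (s, v)) + W (s, v)) := by gcongr
        _ = _ := by rw [div_pow]; ring
    refine (lintegral_mono_ae hpt).trans ?_
    have hm3 : Measurable fun v => ENNReal.ofReal (ell (g (s, v))) :=
      hgm.comp measurable_prodMk_left
    rw [lintegral_const_mul' _ _ ENNReal.ofReal_ne_top,
      lintegral_add_left ((hGm.pow_const 2).ennreal_ofReal.const_mul _),
      lintegral_const_mul' _ _ ENNReal.ofReal_ne_top,
      lintegral_add_left hm3]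
    have e : ENNReal.ofReal (c * ((1 + S.nn p w) * (bE s).toReal))
        = ENNReal.ofReal (c * (1 + S.nn p w)) * bE s := by
      rw [← mul_assoc, ENNReal.ofReal_mul (by positivity), ENNReal.ofReal_toReal hs1.ne]
    rw [e]
    simp only [bE]
    gcongr
    refine (mul_le_mul_right (H.coeff.lintegral_G_sq_le s hw) _).trans ?_
    rw [← ENNReal.ofReal_mul (by positivity)]
    refine ENNReal.ofReal_le_ofReal ?_
    rw [div_mul_eq_mul_div, div_le_iff₀ (by positivity)]
    have : 1 + S.nn p w ^ 2 ≤ (1 + S.nn p w) ^ 2 := by nlinarith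
    calc C * (K * (1 + S.nn p w ^ 2)) ≤ C * (K * (1 + S.nn p w) ^ 2) := by gcongr
      _ = _ := by ring

end GrowthContext

end Context

/-! ### Energy of a difference and uniqueness -/

section Uniqueness

variable {Φ : Type*} [AddCommGroup Φ] [Module ℝ Φ] [UniformSpace Φ] [IsUniformAddGroup Φ]
  {X : Type*} [TopologicalSpace X] [MeasurableSpace X] {T : ℝ}
  {S : CHNS Φ} {ν : Measure X}
  {A : Icc (0 : ℝ) T → StrongDual ℝ Φ → StrongDual ℝ Φ}
  {G : Icc (0 : ℝ) T → StrongDual ℝ Φ → X → StrongDual ℝ Φ} {p q : ℕ} {K R : ℝ}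
  {h₀ h₁ : Icc (0 : ℝ) T × X → ℝ} {N : ℕ} {g : Icc (0 : ℝ) T × X → ℝ≥0}
  {Y Z : Icc (0 : ℝ) T → StrongDual ℝ Φ}

theorem CoeffCondition.monotone_nn (h : CoeffCondition S ν A G p q K) (hpq : p ≤ q)
    (t : Icc (0 : ℝ) T) {w z : StrongDual ℝ Φ} (hw : S.negNorm p w ≠ ∞)
    (hz : S.negNorm p z ≠ ∞) :
    2 * S.negInner q (A t w - A t z) (w - z)
      + (∫⁻ v, ENNReal.ofReal (S.nn q (G t w v - G t z v) ^ 2) ∂ν).toReal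
      ≤ K * S.nn q (w - z) ^ 2 := by
  have e : ∀ v, ENNReal.ofReal (S.nn q (G t w v - G t z v) ^ 2)
      = S.negNorm q (G t w v - G t z v) ^ 2 := fun v => by
    rw [ENNReal.ofReal_pow (S.nn_nonneg _ _), S.ofReal_nn]
    exact S.negNorm_ne_top_mono hpq
      (S.negNorm_sub_ne_top (h.G_ne_top t hw v) (h.G_ne_top t hz v))
  simp_rw [e]
  obtain ⟨u, rfl⟩ := S.exists_incl_eq hw
  obtain ⟨u', rfl⟩ := S.exists_incl_eq hz
  exact h.monotone t u u'

theorem nn_sub_sq_le (S : CHNS Φ) {n : ℕ} {w z : StrongDual ℝ Φ} (hw : S.negNorm n w ≠ ∞)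
    (hz : S.negNorm n z ≠ ∞) : S.nn n (w - z) ^ 2 ≤ 2 * S.nn n w ^ 2 + 2 * S.nn n z ^ 2 := by
  have h1 : S.nn n (w - z) ≤ S.nn n w + S.nn n z := by
    rw [CHNS.nn, CHNS.nn, CHNS.nn, ← ENNReal.toReal_add hw hz]
    exact ENNReal.toReal_mono (ENNReal.add_ne_top.2 ⟨hw, hz⟩) (S.negNorm_sub_le n w z)
  have h2 := S.nn_nonneg n (w - z)
  nlinarith [sq_nonneg (S.nn n w - S.nn n z)]

theorem CoeffCondition.lintegral_G_sub_sq_le (h : CoeffCondition S ν A G p q K) (hK : 0 ≤ K)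
    (hR : 0 ≤ R) (hmeas : MeasurableCoeff A G)
    (t : Icc (0 : ℝ) T) {w z : StrongDual ℝ Φ} (hw : S.negNorm p w ≤ ENNReal.ofReal R)
    (hz : S.negNorm p z ≤ ENNReal.ofReal R) :
    ∫⁻ v, ENNReal.ofReal (S.nn p (G t w v - G t z v) ^ 2) ∂ν
      ≤ ENNReal.ofReal (4 * (K * (1 + R ^ 2))) := by
  have hw' := ne_top_of_le_ne_top ENNReal.ofReal_ne_top hw
  have hz' := ne_top_of_le_ne_top ENNReal.ofReal_ne_top hz
  have hb : ∀ u, S.negNorm p u ≤ ENNReal.ofReal R →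
      ∫⁻ v, ENNReal.ofReal (S.nn p (G t u v) ^ 2) ∂ν ≤ ENNReal.ofReal (K * (1 + R ^ 2)) := by
    intro u hu
    refine (h.lintegral_G_sq_le t (ne_top_of_le_ne_top ENNReal.ofReal_ne_top hu)).trans
      (ENNReal.ofReal_le_ofReal ?_)
    have := S.nn_le_of_le hR hu
    have := S.nn_nonneg p u
    gcongr
  have hm : Measurable fun v => ENNReal.ofReal (S.nn p (G t w v) ^ 2) :=
    ((S.measurable_nn_comp (fun x => hmeas.measurable_G_right t w x) p).pow_const 2).ennreal_ofReal
  calc ∫⁻ v, ENNReal.ofReal (S.nn p (G t w v - G t z v) ^ 2) ∂ν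
      ≤ ∫⁻ v, (ENNReal.ofReal 2 * ENNReal.ofReal (S.nn p (G t w v) ^ 2)
          + ENNReal.ofReal 2 * ENNReal.ofReal (S.nn p (G t z v) ^ 2)) ∂ν := by
        refine lintegral_mono fun v => ?_
        rw [← ENNReal.ofReal_mul two_pos.le, ← ENNReal.ofReal_mul two_pos.le,
          ← ENNReal.ofReal_add (by positivity) (by positivity)]
        exact ENNReal.ofReal_le_ofReal
          (nn_sub_sq_le S (h.G_ne_top t hw' v) (h.G_ne_top t hz' v))
    _ = ENNReal.ofReal 2 * ∫⁻ v, ENNReal.ofReal (S.nn p (G t w v) ^ 2) ∂ν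
          + ENNReal.ofReal 2 * ∫⁻ v, ENNReal.ofReal (S.nn p (G t z v) ^ 2) ∂ν := by
        rw [lintegral_add_left (hm.const_mul _), lintegral_const_mul' _ _ ENNReal.ofReal_ne_top,
          lintegral_const_mul' _ _ ENNReal.ofReal_ne_top]
    _ ≤ ENNReal.ofReal 2 * ENNReal.ofReal (K * (1 + R ^ 2))
          + ENNReal.ofReal 2 * ENNReal.ofReal (K * (1 + R ^ 2)) := by
        gcongr
        · exact hb w hw
        · exact hb z hz
    _ = _ := by
        rw [← ENNReal.ofReal_mul two_pos.le, ← ENNReal.ofReal_add (by positivity) (by positivity)]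
        congr 1; ring

theorem integrable_mul_continuous {κ M : Icc (0 : ℝ) T → ℝ} (hκ : Integrable κ (lamT T))
    (hM : Continuous M) : Integrable (fun s => κ s * M s) (lamT T) := by
  obtain ⟨C, hC⟩ := isCompact_univ.exists_bound_of_continuousOn hM.continuousOn
  exact hκ.mul_bdd hM.measurable.aestronglyMeasurable
    (Eventually.of_forall fun s => hC s (mem_univ s))

variable [SigmaFinite ν]

/-- The control contribution to the energy of a difference is absorbed by the square integral of the
difference of the noise coefficients. -/
theorem exists_absorbing_rate (H : GrowthContext S ν A G p q K h₀)
    (h₁tail : ExpTail (nuT T ν) h₁)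
    (hlip : ∀ᵐ z ∂(nuT T ν), lipNorm S G q z ≤ ENNReal.ofReal (h₁ z))
    (hg : CostLE T ν N g) :
    ∃ κ : Icc (0 : ℝ) T → ℝ, (∀ s, 0 ≤ κ s) ∧ Integrable κ (lamT T) ∧
      ∀ᵐ s ∂(lamT T), ∀ w z, S.negNorm p w ≠ ∞ → S.negNorm p z ≠ ∞ → ∀ F : X → ℝ,
        (∀ v, |F v| ≤ S.nn q (w - z) * S.nn q (G s w v - G s z v)) →
        ∫⁻ v, ENNReal.ofReal (S.nn q (G s w v - G s z v) ^ 2) ∂ν ≠ ∞ →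
        2 * ∫ v, F v * ((g (s, v) : ℝ) - 1) ∂ν
          ≤ (∫⁻ v, ENNReal.ofReal (S.nn q (G s w v - G s z v) ^ 2) ∂ν).toReal
            + κ s * S.nn q (w - z) ^ 2 := by
  obtain ⟨C, hC, W, hWm, hW0, hWi, HW⟩ := h₁tail.exists_absorb
  have hgm : Measurable fun z => ENNReal.ofReal (ell (g z)) :=
    (measurable_ell.comp hg.meas).ennreal_ofReal
  have hWm' := hWm.ennreal_ofReal
  -- The rate `κ` collects the entropy and tail terms of `ExpTail.exists_absorb`, integrated in
  -- space; it depends on `g` but not on the two states.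
  set bE : Icc (0 : ℝ) T → ℝ≥0∞ := fun s =>
    ENNReal.ofReal C * ∫⁻ v, ENNReal.ofReal (ell (g (s, v))) ∂ν + ∫⁻ v, ENNReal.ofReal (W (s, v)) ∂ν
  have hm1 : Measurable fun s : Icc (0 : ℝ) T => ∫⁻ v, ENNReal.ofReal (ell (g (s, v))) ∂ν :=
    hgm.lintegral_prod_right'
  have hbm : Measurable bE := (hm1.const_mul _).add hWm'.lintegral_prod_right'
  have hbi : ∫⁻ s, bE s ∂(lamT T) ≠ ∞ := by
    simp only [bE]
    rw [lintegral_add_left (hm1.const_mul _), lintegral_const_mul _ hm1,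
      ← lintegral_prod _ hgm.aemeasurable, ← lintegral_prod _ hWm'.aemeasurable]
    exact ENNReal.add_ne_top.2 ⟨ENNReal.mul_ne_top ENNReal.ofReal_ne_top hg.ne_top, hWi⟩
  have hbfin := ae_lt_top hbm hbi
  refine ⟨fun s => (bE s).toReal, fun s => ENNReal.toReal_nonneg,
    integrable_toReal_of_lintegral_ne_top hbm.aemeasurable hbi, ?_⟩
  filter_upwards [hbfin, Measure.ae_ae_of_ae_prod hlip] with s hs1 hs2 w z hw hz F hF hfin
  set D := S.nn q (w - z)
  have hD : 0 ≤ D := S.nn_nonneg _ _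
  set a : X → ℝ := fun v => S.nn q (G s w v - G s z v)
  have ha : ∀ v, 0 ≤ a v := fun v => S.nn_nonneg _ _
  have ham : Measurable a := S.measurable_nn_comp (fun x =>
    (H.meas.measurable_G_right s w x).sub (H.meas.measurable_G_right s z x)) q
  have hm3 : Measurable fun v => ENNReal.ofReal (ell (g (s, v))) := hgm.comp measurable_prodMk_left
  rw [← integral_const_mul]
  have hbound : ∫⁻ v, ENNReal.ofReal ‖2 * (F v * ((g (s, v) : ℝ) - 1))‖ ∂ν
      ≤ ∫⁻ v, ENNReal.ofReal (a v ^ 2) ∂ν + ENNReal.ofReal (D ^ 2) * bE s := by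
    have hpt : ∀ᵐ v ∂ν, ENNReal.ofReal ‖2 * (F v * ((g (s, v) : ℝ) - 1))‖
        ≤ ENNReal.ofReal (a v ^ 2) + ENNReal.ofReal (D ^ 2) *
          (ENNReal.ofReal C * ENNReal.ofReal (ell (g (s, v))) + ENNReal.ofReal (W (s, v))) := by
      filter_upwards [hs2] with v hv
      have he := ell_nonneg (g (s, v))
      have hWv := hW0 (s, v)
      rw [← ENNReal.ofReal_mul hC, ← ENNReal.ofReal_add (by positivity) hWv,
        ← ENNReal.ofReal_mul (by positivity), ← ENNReal.ofReal_add (by positivity) (by positivity)]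
      refine ENNReal.ofReal_le_ofReal ?_
      rw [norm_mul, norm_mul, Real.norm_eq_abs, Real.norm_eq_abs, Real.norm_eq_abs, abs_two]
      have h1 : a v ≤ h₁ (s, v) * D := nn_G_sub_le_of_lipNorm_le (h₁tail.nonneg _) hv
        (S.negNorm_ne_top_mono H.le hw) (S.negNorm_ne_top_mono H.le hz)
      rcases hD.eq_or_lt with h0 | h0
      · have h2 : |F v| ≤ 0 := by
          have := hF v
          change |F v| ≤ D * a v at this
          rwa [← h0, zero_mul] at this
        have h3 : |F v| = 0 := le_antisymm h2 (abs_nonneg _)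
        rw [h3, zero_mul, mul_zero]
        positivity
      -- The Lipschitz norm bounds `a / D` by `h₁`. After multiplication by `D²` the quadratic term
      -- is `a²` with coefficient exactly `1`, and the rest is proportional to `D²`.
      · have h2 := HW (s, v) (a v / D) (g (s, v)) (div_nonneg (ha v) hD) ((div_le_iff₀ h0).2 h1)
        calc 2 * (|F v| * |(g (s, v) : ℝ) - 1|) ≤ 2 * (D * a v * |(g (s, v) : ℝ) - 1|) := by
              gcongr; exact hF v
          _ = D ^ 2 * (2 * (a v / D * |(g (s, v) : ℝ) - 1|)) := by field_simp
          _ ≤ D ^ 2 * ((a v / D) ^ 2 + C * ell (g (s, v)) + W (s, v)) := by gcongr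
          _ = _ := by field_simp; ring
    refine (lintegral_mono_ae hpt).trans (le_of_eq ?_)
    rw [lintegral_add_left (ham.pow_const 2).ennreal_ofReal,
      lintegral_const_mul' _ _ ENNReal.ofReal_ne_top, lintegral_add_left (hm3.const_mul _),
      lintegral_const_mul' _ _ ENNReal.ofReal_ne_top]
  refine (le_abs_self _).trans ?_
  rw [← Real.norm_eq_abs]
  refine (norm_integral_le_lintegral_norm _).trans ?_
  have hfin2 : ENNReal.ofReal (D ^ 2) * bE s ≠ ∞ := ENNReal.mul_ne_top ENNReal.ofReal_ne_top hs1.ne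
  refine (ENNReal.toReal_mono (ENNReal.add_ne_top.2 ⟨hfin, hfin2⟩) hbound).trans (le_of_eq ?_)
  rw [ENNReal.toReal_add hfin hfin2, ENNReal.toReal_mul, ENNReal.toReal_ofReal (by positivity),
    mul_comm]

/-- Sum the coordinate energy identities with weights `‖φ_j‖_q⁻²` over `j < J`. The control term is
absorbed already at finite `J`, because truncated pairings obey Cauchy–Schwarz too. Monotonicity,
which needs the full inner product, is applied only after `J → ∞`, where it cancels the square
integral just introduced. -/
theorem skeleton_energy_le (H : GrowthContext S ν A G p q K h₀) (hg : CostLE T ν N g)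
    {κ : Icc (0 : ℝ) T → ℝ} (hκi : Integrable κ (lamT T))
    (hκ : ∀ᵐ s ∂(lamT T), ∀ w z, S.negNorm p w ≠ ∞ → S.negNorm p z ≠ ∞ → ∀ F : X → ℝ,
        (∀ v, |F v| ≤ S.nn q (w - z) * S.nn q (G s w v - G s z v)) →
        ∫⁻ v, ENNReal.ofReal (S.nn q (G s w v - G s z v) ^ 2) ∂ν ≠ ∞ →
        2 * ∫ v, F v * ((g (s, v) : ℝ) - 1) ∂ν
          ≤ (∫⁻ v, ENNReal.ofReal (S.nn q (G s w v - G s z v) ^ 2) ∂ν).toReal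
            + κ s * S.nn q (w - z) ^ 2)
    (hR : 0 ≤ R) (hY : BoundedPath S p R Y) (hZ : BoundedPath S p R Z) {c : ℕ → ℝ}
    (eY : ∀ j t, Y t (S.phi j) = c j + skInt ν A G g Y (S.phi j) t)
    (eZ : ∀ j t, Z t (S.phi j) = c j + skInt ν A G g Z (S.phi j) t) (t : Icc (0 : ℝ) T) :
    S.nn q (Y t - Z t) ^ 2
      ≤ ∫ s in {s | s ≤ t}, (K + κ s) * S.nn q (Y s - Z s) ^ 2 ∂(lamT T) := by
  have hK := H.K_nonneg
  have hpq := H.le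
  have hDp : ∀ s, S.negNorm p (Y s - Z s) ≠ ∞ := fun s =>
    S.negNorm_sub_ne_top (hY.ne_top s) (hZ.ne_top s)
  have hDq : ∀ s, S.negNorm q (Y s - Z s) ≠ ∞ := fun s => S.negNorm_ne_top_mono hpq (hDp s)
  have hAq : ∀ s, S.negNorm q (A s (Y s) - A s (Z s)) ≠ ∞ := fun s =>
    S.negNorm_sub_ne_top (H.coeff.A_ne_top s (hY.ne_top s)) (H.coeff.A_ne_top s (hZ.ne_top s))
  have hGq : ∀ s v, S.negNorm q (G s (Y s) v - G s (Z s) v) ≠ ∞ := fun s v =>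
    S.negNorm_ne_top_mono hpq (S.negNorm_sub_ne_top (H.coeff.G_ne_top s (hY.ne_top s) v)
      (H.coeff.G_ne_top s (hZ.ne_top s) v))
  have hDm : ∀ x, Measurable fun s => (Y s - Z s) x := fun x => (hY.meas x).sub (hZ.meas x)
  set y : Icc (0 : ℝ) T → ℝ := fun s => S.nn q (Y s - Z s) ^ 2
  have hym : Measurable y := (S.measurable_nn_comp hDm q).pow_const 2
  have hyb : ∀ s, y s ≤ 4 * R ^ 2 := fun s => by
    have h1 := nn_sub_sq_le S (S.negNorm_ne_top_mono hpq (hY.ne_top s))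
      (S.negNorm_ne_top_mono hpq (hZ.ne_top s))
    have h2 := (S.nn_mono hpq (hY.ne_top s)).trans (hY.nn_le hR s)
    have h3 := (S.nn_mono hpq (hZ.ne_top s)).trans (hZ.nn_le hR s)
    have h4 := pow_le_pow_left₀ (S.nn_nonneg _ _) h2 2
    have h5 := pow_le_pow_left₀ (S.nn_nonneg _ _) h3 2
    simp only [y]; linarith
  set Q : Icc (0 : ℝ) T → ℝ≥0∞ := fun s =>
    ∫⁻ v, ENNReal.ofReal (S.nn q (G s (Y s) v - G s (Z s) v) ^ 2) ∂ν
  have hQb : ∀ s, Q s ≤ ENNReal.ofReal (4 * (K * (1 + R ^ 2))) := fun s => by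
    refine le_trans (lintegral_mono fun v => ENNReal.ofReal_le_ofReal ?_)
      (H.coeff.lintegral_G_sub_sq_le hK hR H.meas s (hY.bound s) (hZ.bound s))
    exact pow_le_pow_left₀ (S.nn_nonneg _ _) (S.nn_mono hpq
      (S.negNorm_sub_ne_top (H.coeff.G_ne_top s (hY.ne_top s) v)
      (H.coeff.G_ne_top s (hZ.ne_top s) v))) 2
  have hQm : Measurable Q := by
    have h1 : Measurable fun z : Icc (0 : ℝ) T × X =>
        ENNReal.ofReal (S.nn q (G z.1 (Y z.1) z.2 - G z.1 (Z z.1) z.2) ^ 2) :=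
      ((S.measurable_nn_comp (fun x => (H.meas.measurable_G hY.meas x).sub
        (H.meas.measurable_G hZ.meas x)) q).pow_const 2).ennreal_ofReal
    exact h1.lintegral_prod_right'
  have hQi : Integrable (fun s => (Q s).toReal) (lamT T) :=
    Integrable.of_bound hQm.ennreal_toReal.aestronglyMeasurable (4 * (K * (1 + R ^ 2)))
      (Eventually.of_forall fun s => by
        rw [Real.norm_of_nonneg ENNReal.toReal_nonneg]
        exact ENNReal.toReal_le_of_le_ofReal (by positivity) (hQb s))
  have hκy : Integrable (fun s => κ s * y s) (lamT T) :=
    hκi.mul_bdd hym.aestronglyMeasurable (Eventually.of_forall fun s => by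
      rw [Real.norm_of_nonneg (sq_nonneg _)]; exact hyb s)
  have hyi : Integrable y (lamT T) := Integrable.of_bound hym.aestronglyMeasurable (4 * R ^ 2)
    (Eventually.of_forall fun s => by rw [Real.norm_of_nonneg (sq_nonneg _)]; exact hyb s)
  -- Truncated drift pairing. It is bounded uniformly in `J` and in time, and tends to twice the
  -- inner product in `Φ_{-q}`, so dominated convergence applies.
  set E : ℕ → Icc (0 : ℝ) T → ℝ := fun J s => 2 * ∑ j ∈ Finset.range J,
    (A s (Y s) - A s (Z s)) (S.phi j) * (Y s - Z s) (S.phi j) / S.wt q j ^ 2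
  have hEm : ∀ J, Measurable (E J) := fun J => by
    refine Measurable.const_mul (Finset.measurable_fun_sum _ fun j _ => ?_) _
    exact ((((H.meas.measurable_A hY.meas _).sub (H.meas.measurable_A hZ.meas _)).mul
      (hDm _)).div_const _)
  have hEb : ∀ J s, |E J s| ≤ 2 * (2 * √(K * (1 + R ^ 2)) * (2 * R)) := by
    intro J s
    simp only [E]
    rw [abs_mul, abs_two]
    refine mul_le_mul_of_nonneg_left ?_ two_pos.le
    refine (S.sum_mul_le (hAq s) (hDq s) J).trans ?_
    have hb : ∀ V : Icc (0 : ℝ) T → StrongDual ℝ Φ, BoundedPath S p R V →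
        S.nn q (A s (V s)) ≤ √(K * (1 + R ^ 2)) := fun V hV =>
      (H.coeff.nn_A_le hK s (hV.ne_top s)).trans (Real.sqrt_le_sqrt (by
        have := hV.nn_le hR s
        have := S.nn_nonneg p (V s)
        gcongr))
    have hsub : ∀ {w z : StrongDual ℝ Φ}, S.negNorm q w ≠ ∞ → S.negNorm q z ≠ ∞ →
        S.nn q (w - z) ≤ S.nn q w + S.nn q z := by
      intro w z hw hz
      rw [CHNS.nn, CHNS.nn, CHNS.nn, ← ENNReal.toReal_add hw hz]
      exact ENNReal.toReal_mono (ENNReal.add_ne_top.2 ⟨hw, hz⟩) (S.negNorm_sub_le q w z)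
    have h1 := hsub (H.coeff.A_ne_top s (hY.ne_top s)) (H.coeff.A_ne_top s (hZ.ne_top s))
    have h2 := hsub (S.negNorm_ne_top_mono hpq (hY.ne_top s))
      (S.negNorm_ne_top_mono hpq (hZ.ne_top s))
    have h3 := (S.nn_mono hpq (hY.ne_top s)).trans (hY.nn_le hR s)
    have h4 := (S.nn_mono hpq (hZ.ne_top s)).trans (hZ.nn_le hR s)
    have := hb Y hY
    have := hb Z hZ
    exact mul_le_mul (by linarith) (by linarith) (S.nn_nonneg _ _) (by positivity)
  have hEi : ∀ J, Integrable (E J) (lamT T) := fun J =>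
    Integrable.of_bound (hEm J).aestronglyMeasurable _ (Eventually.of_forall (hEb J))
  set E' : Icc (0 : ℝ) T → ℝ := fun s => 2 * S.negInner q (A s (Y s) - A s (Z s)) (Y s - Z s)
  have hElim : ∀ s, Tendsto (fun J => E J s) atTop (𝓝 (E' s)) := fun s =>
    ((S.hasSum_negInner (hAq s) (hDq s)).tendsto_sum_nat).const_mul 2
  have hstep : ∀ J, ∑ j ∈ Finset.range J, (Y t - Z t) (S.phi j) ^ 2 / S.wt q j ^ 2
      ≤ ∫ s in {s | s ≤ t}, (E J s + ((Q s).toReal + κ s * y s)) ∂(lamT T) := by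
    intro J
    set f : ℕ → Icc (0 : ℝ) T → ℝ := fun j s =>
      (A s (Y s) (S.phi j) + ctrlTerm ν G g s (Y s) (S.phi j))
        - (A s (Z s) (S.phi j) + ctrlTerm ν G g s (Z s) (S.phi j))
    have hYi : ∀ j, Integrable (fun s => A s (Y s) (S.phi j) + ctrlTerm ν G g s (Y s) (S.phi j))
        (lamT T) := fun j =>
      (H.integrable_A hR hY (S.phi j)).add (H.integrable_ctrlTerm hR hY hg (S.phi j))
    have hZi : ∀ j, Integrable (fun s => A s (Z s) (S.phi j) + ctrlTerm ν G g s (Z s) (S.phi j))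
        (lamT T) := fun j =>
      (H.integrable_A hR hZ (S.phi j)).add (H.integrable_ctrlTerm hR hZ hg (S.phi j))
    have hfi : ∀ j, Integrable (f j) (lamT T) := fun j => (hYi j).sub (hZi j)
    have hDf : ∀ j r, (Y r - Z r) (S.phi j) = 0 + ∫ s in {s | s ≤ r}, f j s ∂(lamT T) := by
      intro j r
      rw [sub_apply, eY, eZ, H.skInt_eq hR hY hg, H.skInt_eq hR hZ hg,
        integral_sub (hYi j).integrableOn (hZi j).integrableOn]
      ring
    have hsq : ∀ j, (Y t - Z t) (S.phi j) ^ 2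
        = ∫ s in {s | s ≤ t}, 2 * (Y s - Z s) (S.phi j) * f j s ∂(lamT T) := by
      intro j
      rw [hDf, sq_primitive_lamT (hfi j) 0 t]
      simp_rw [← hDf]
      ring
    have hpi : ∀ j, Integrable (fun s => 2 * (Y s - Z s) (S.phi j) * f j s) (lamT T) := by
      intro j
      have h1 : Integrable (fun s => f j s * (2 * (Y s - Z s) (S.phi j))) (lamT T) := by
        refine (hfi j).mul_bdd (c := 2 * (2 * R * S.wt p j)) ((hDm _).const_mul 2).aestronglyMeasurable
          (Eventually.of_forall fun s => ?_)
        rw [norm_mul, Real.norm_eq_abs, Real.norm_eq_abs, abs_two, sub_apply]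
        have h2 := S.abs_apply_phi_le (hY.ne_top s) j
        have h3 := S.abs_apply_phi_le (hZ.ne_top s) j
        have h4 := mul_le_mul_of_nonneg_right (hY.nn_le hR s) (S.wt_pos p j).le
        have h5 := mul_le_mul_of_nonneg_right (hZ.nn_le hR s) (S.wt_pos p j).le
        have := abs_sub (Y s (S.phi j)) (Z s (S.phi j))
        linarith
      exact h1.congr (Eventually.of_forall fun s => by ring)
    calc ∑ j ∈ Finset.range J, (Y t - Z t) (S.phi j) ^ 2 / S.wt q j ^ 2
        = ∫ s in {s | s ≤ t}, ∑ j ∈ Finset.range J,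
            2 * (Y s - Z s) (S.phi j) * f j s / S.wt q j ^ 2 ∂(lamT T) := by
          rw [integral_finsetSum _ fun j _ => ((hpi j).div_const _).integrableOn]
          refine Finset.sum_congr rfl fun j _ => ?_
          rw [hsq, integral_div]
      _ ≤ _ := by
          refine setIntegral_mono_ae
            (integrable_finsetSum _ fun j _ => (hpi j).div_const _).integrableOn
            ((hEi J).add (hQi.add hκy)).integrableOn ?_
          have hintY : ∀ᵐ s ∂(lamT T), ∀ j, Integrable
              (fun v => G s (Y s) v (S.phi j) * ((g (s, v) : ℝ) - 1)) ν :=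
            ae_all_iff.2 fun j => (H.integrable_G hR hY hg (S.phi j)).prod_right_ae
          have hintZ : ∀ᵐ s ∂(lamT T), ∀ j, Integrable
              (fun v => G s (Z s) v (S.phi j) * ((g (s, v) : ℝ) - 1)) ν :=
            ae_all_iff.2 fun j => (H.integrable_G hR hZ hg (S.phi j)).prod_right_ae
          filter_upwards [hκ, hintY, hintZ] with s hs hsY hsZ
          -- The test function is the truncated pairing of `Y - Z` with the difference of the noise
          -- coefficients.
          have hs' := hs (Y s) (Z s) (hY.ne_top s) (hZ.ne_top s)
            (fun v => ∑ j ∈ Finset.range J, (Y s - Z s) (S.phi j)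
              * (G s (Y s) v - G s (Z s) v) (S.phi j) / S.wt q j ^ 2)
            (fun v => S.sum_mul_le (hDq s) (hGq s v) J)
            (ne_top_of_le_ne_top ENNReal.ofReal_ne_top (hQb s))
          have e1 : ∫ v, (∑ j ∈ Finset.range J, (Y s - Z s) (S.phi j)
              * (G s (Y s) v - G s (Z s) v) (S.phi j) / S.wt q j ^ 2) * ((g (s, v) : ℝ) - 1) ∂ν
              = ∑ j ∈ Finset.range J, (Y s - Z s) (S.phi j) / S.wt q j ^ 2 *
                (ctrlTerm ν G g s (Y s) (S.phi j) - ctrlTerm ν G g s (Z s) (S.phi j)) := by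
            simp_rw [ctrlTerm, Finset.sum_mul]
            rw [integral_finsetSum _ fun j _ => ?_]
            · refine Finset.sum_congr rfl fun j _ => ?_
              rw [← integral_sub (hsY j) (hsZ j), ← integral_const_mul]
              refine integral_congr_ae (Eventually.of_forall fun v => ?_)
              simp only [sub_apply]; ring
            · refine (((hsY j).sub (hsZ j)).const_mul
                ((Y s - Z s) (S.phi j) / S.wt q j ^ 2)).congr (Eventually.of_forall fun v => ?_)
              simp only [sub_apply, Pi.sub_apply]; ring
          rw [e1] at hs'
          have e2 : ∑ j ∈ Finset.range J, 2 * (Y s - Z s) (S.phi j) * f j s / S.wt q j ^ 2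
              = E J s + 2 * ∑ j ∈ Finset.range J, (Y s - Z s) (S.phi j) / S.wt q j ^ 2 *
                (ctrlTerm ν G g s (Y s) (S.phi j) - ctrlTerm ν G g s (Z s) (S.phi j)) := by
            simp only [E, f]
            rw [Finset.mul_sum, Finset.mul_sum, ← Finset.sum_add_distrib]
            refine Finset.sum_congr rfl fun j _ => ?_
            simp only [sub_apply]; ring
          rw [e2]
          linarith
  have hE'm : Measurable E' := measurable_of_tendsto_metrizable hEm (tendsto_pi_nhds.2 hElim)
  have hE'i : Integrable E' (lamT T) :=
    Integrable.of_bound hE'm.aestronglyMeasurable (2 * (2 * √(K * (1 + R ^ 2)) * (2 * R)))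
      (Eventually.of_forall fun s => le_of_tendsto (hElim s).abs
        (Eventually.of_forall fun J => hEb J s))
  have hQκ : Integrable (fun s => (Q s).toReal + κ s * y s) (lamT T) := hQi.add hκy
  have hlim : Tendsto (fun J => ∫ s in {s | s ≤ t}, (E J s + ((Q s).toReal + κ s * y s)) ∂(lamT T))
      atTop (𝓝 (∫ s in {s | s ≤ t}, (E' s + ((Q s).toReal + κ s * y s)) ∂(lamT T))) := by
    have h1 : Tendsto (fun J => ∫ s in {s | s ≤ t}, E J s ∂(lamT T)) atTop
        (𝓝 (∫ s in {s | s ≤ t}, E' s ∂(lamT T))) :=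
      tendsto_integral_of_dominated_convergence (fun _ => 2 * (2 * √(K * (1 + R ^ 2)) * (2 * R)))
        (fun J => (hEm J).aestronglyMeasurable) (integrable_const _)
        (fun J => Eventually.of_forall (hEb J)) (Eventually.of_forall hElim)
    rw [integral_add hE'i.integrableOn hQκ.integrableOn]
    have e : ∀ J, ∫ s in {s | s ≤ t}, (E J s + ((Q s).toReal + κ s * y s)) ∂(lamT T)
        = ∫ s in {s | s ≤ t}, E J s ∂(lamT T)
          + ∫ s in {s | s ≤ t}, ((Q s).toReal + κ s * y s) ∂(lamT T) := fun J =>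
      integral_add (hEi J).integrableOn hQκ.integrableOn
    simp_rw [e]
    exact h1.add_const _
  have hle := le_of_tendsto_of_tendsto' (S.hasSum_negNorm (hDq t)).tendsto_sum_nat hlim hstep
  refine hle.trans (integral_mono_ae (hE'i.add hQκ).integrableOn ?_
    (Eventually.of_forall fun s => ?_))
  · exact ((hyi.const_mul K).add hκy |>.congr
      (Eventually.of_forall fun s => by simp only [Pi.add_apply, y]; ring)).integrableOn
  · have := H.coeff.monotone_nn hpq s (hY.ne_top s) (hZ.ne_top s)
    simp only [E', Q, y] at this ⊢
    linarith

/-- Two solutions of the coordinate equations with the same control and initial value agree. -/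
theorem skeleton_unique (H : GrowthContext S ν A G p q K h₀) (h₁tail : ExpTail (nuT T ν) h₁)
    (hlip : ∀ᵐ z ∂(nuT T ν), lipNorm S G q z ≤ ENNReal.ofReal (h₁ z))
    (hg : CostLE T ν N g) (hR : 0 ≤ R) (hY : BoundedPath S p R Y) (hZ : BoundedPath S p R Z)
    {c : ℕ → ℝ} (eY : ∀ j t, Y t (S.phi j) = c j + skInt ν A G g Y (S.phi j) t)
    (eZ : ∀ j t, Z t (S.phi j) = c j + skInt ν A G g Z (S.phi j) t) (t : Icc (0 : ℝ) T) :
    Y t = Z t := by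
  have hK := H.K_nonneg
  obtain ⟨κ, hκ0, hκi, hκ⟩ := exists_absorbing_rate H h₁tail hlip hg
  have hDq : ∀ s, S.negNorm q (Y s - Z s) ≠ ∞ := fun s => S.negNorm_ne_top_mono H.le
    (S.negNorm_sub_ne_top (hY.ne_top s) (hZ.ne_top s))
  have hκ' : Integrable (fun s => K + κ s) (lamT T) := (integrable_const K).add hκi
  have hm : Measurable fun s => S.nn q (Y s - Z s) ^ 2 :=
    (S.measurable_nn_comp (fun x => (hY.meas x).sub (hZ.meas x)) q).pow_const 2
  have hyb : ∀ s, S.nn q (Y s - Z s) ^ 2 ≤ 4 * R ^ 2 := fun s => by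
    have h1 := nn_sub_sq_le S (S.negNorm_ne_top_mono H.le (hY.ne_top s))
      (S.negNorm_ne_top_mono H.le (hZ.ne_top s))
    have h2 := (S.nn_mono H.le (hY.ne_top s)).trans (hY.nn_le hR s)
    have h3 := (S.nn_mono H.le (hZ.ne_top s)).trans (hZ.nn_le hR s)
    have h4 := pow_le_pow_left₀ (S.nn_nonneg _ _) h2 2
    have h5 := pow_le_pow_left₀ (S.nn_nonneg _ _) h3 2
    linarith
  have h := gronwall_majorant (κ := fun s => K + κ s) (c := 0)
    (y := fun s => S.nn q (Y s - Z s) ^ 2)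
    (fun s => add_nonneg hK (hκ0 s)) hκ' (fun s => sq_nonneg _)
    ⟨4 * R ^ 2, by rintro _ ⟨s, rfl⟩; exact hyb s⟩
    (fun M _ hMc hM t => by
      rw [zero_add]
      refine (skeleton_energy_le H hg hκi hκ hR hY hZ eY eZ t).trans (integral_mono_ae
        (hκ'.mul_bdd hm.aestronglyMeasurable (Eventually.of_forall fun s => by
          rw [Real.norm_of_nonneg (sq_nonneg _)]; exact hyb s)).integrableOn
        (integrable_mul_continuous hκ' hMc).integrableOn (Eventually.of_forall fun s =>
          mul_le_mul_of_nonneg_left (hM s) (add_nonneg hK (hκ0 s))))) t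
  have h0 : S.nn q (Y t - Z t) = 0 := by
    have : S.nn q (Y t - Z t) ^ 2 ≤ 0 := by simpa using h
    exact pow_eq_zero_iff two_ne_zero |>.1 (le_antisymm this (sq_nonneg _))
  ext x
  have := S.abs_apply_le (hDq t) x
  rw [h0, zero_mul, sub_apply] at this
  exact sub_eq_zero.1 (abs_nonpos_iff.1 this)

end Uniqueness

/-! ### Passing to the limit in the integral part -/

section Limits

variable {Φ : Type*} [AddCommGroup Φ] [Module ℝ Φ] [UniformSpace Φ] [IsUniformAddGroup Φ]
  {X : Type*} [TopologicalSpace X] [PolishSpace X] [LocallyCompactSpace X]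
  [MeasurableSpace X] [BorelSpace X] {T : ℝ}
  {S : CHNS Φ} {ν : Measure X} [IsFiniteMeasureOnCompacts ν]
  {A : Icc (0 : ℝ) T → StrongDual ℝ Φ → StrongDual ℝ Φ}
  {G : Icc (0 : ℝ) T → StrongDual ℝ Φ → X → StrongDual ℝ Φ} {p q p₁ q₁ : ℕ} {K K₁ R : ℝ}
  {h₀ : Icc (0 : ℝ) T × X → ℝ} {N : ℕ}

theorem setIntegral_mul_eq_indicator {Ω : Type*} [MeasurableSpace Ω] {μ : Measure Ω} {s : Set Ω}
    (hs : MeasurableSet s) (ψ f : Ω → ℝ) :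
    ∫ z in s, ψ z * f z ∂μ = ∫ z, s.indicator ψ z * f z ∂μ := by
  rw [← integral_indicator hs]
  refine integral_congr_ae (Eventually.of_forall fun z => ?_)
  by_cases hz : z ∈ s <;> simp [hz]

theorem measurableSet_fst_le (t : Icc (0 : ℝ) T) :
    MeasurableSet {z : Icc (0 : ℝ) T × X | z.1 ≤ t} :=
  measurableSet_le measurable_fst measurable_const

/-- The square integral of the difference of the noise coefficients vanishes along pointwise
convergent bounded paths. -/
theorem GrowthContext.tendsto_lintegral_G_sub_sq (H : GrowthContext S ν A G p q K h₀)
    (hc₁ : CoeffCondition S ν A G p₁ q₁ K₁) (hR : 0 ≤ R)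
    {Z : ℕ → Icc (0 : ℝ) T → S.Neg p₁} {Y : Icc (0 : ℝ) T → S.Neg p₁}
    (hZ : ∀ n, BoundedPath S p R fun s => S.incl p₁ (Z n s))
    (hY : BoundedPath S p R fun s => S.incl p₁ (Y s))
    (hlim : ∀ s, Tendsto (fun n => Z n s) atTop (𝓝 (Y s))) (x : Φ) :
    Tendsto (fun n => ∫⁻ z, ENNReal.ofReal (((G z.1 (S.incl p₁ (Z n z.1)) z.2
      - G z.1 (S.incl p₁ (Y z.1)) z.2) x) ^ 2) ∂(nuT T ν)) atTop (𝓝 0) := by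
  have hm : ∀ n, Measurable fun z : Icc (0 : ℝ) T × X => ENNReal.ofReal
      (((G z.1 (S.incl p₁ (Z n z.1)) z.2 - G z.1 (S.incl p₁ (Y z.1)) z.2) x) ^ 2) := fun n =>
    (((H.meas.measurable_G (hZ n).meas x).sub
      (H.meas.measurable_G hY.meas x)).pow_const 2).ennreal_ofReal
  rw [nuT, funext fun n => lintegral_prod _ (hm n).aemeasurable]
  have hle : ∀ (m : ℕ) (w : StrongDual ℝ Φ), S.negNorm m w ≠ ∞ →
      ENNReal.ofReal ((w x) ^ 2)
        ≤ ENNReal.ofReal (‖S.toLevel m x‖ ^ 2) * ENNReal.ofReal (S.nn m w ^ 2) := by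
    intro m w hw
    rw [← ENNReal.ofReal_mul (by positivity), ← mul_pow]
    refine ENNReal.ofReal_le_ofReal (sq_le_sq.2 ?_)
    rw [abs_of_nonneg (mul_nonneg (norm_nonneg _) (S.nn_nonneg _ _)), mul_comm]
    exact S.abs_apply_le hw x
  have h0 : (0 : ℝ≥0∞) = ∫⁻ _ : Icc (0 : ℝ) T, 0 ∂(lamT T) := by simp
  rw [h0]
  -- The dominating constant comes from level `p`, where the paths are bounded; convergence at fixed
  -- time comes from continuity of `G` at level `p₁`, where the paths converge.
  refine tendsto_lintegral_of_dominated_convergence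
    (fun _ => ENNReal.ofReal (‖S.toLevel p x‖ ^ 2) * ENNReal.ofReal (4 * (K * (1 + R ^ 2))))
    (fun n => (hm n).lintegral_prod_right') (fun n => Eventually.of_forall fun s => ?_) ?_
    (Eventually.of_forall fun s => ?_)
  · refine le_trans ?_ (mul_le_mul_right (H.coeff.lintegral_G_sub_sq_le H.K_nonneg hR H.meas s
      ((hZ n).bound s) (hY.bound s)) _)
    rw [← lintegral_const_mul' _ _ ENNReal.ofReal_ne_top]
    exact lintegral_mono fun v => hle p _ (S.negNorm_sub_ne_top
      (H.coeff.G_ne_top s ((hZ n).ne_top s) v) (H.coeff.G_ne_top s (hY.ne_top s) v))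
  · rw [lintegral_const]
    exact ENNReal.mul_ne_top (ENNReal.mul_ne_top ENNReal.ofReal_ne_top ENNReal.ofReal_ne_top)
      (measure_ne_top _ _)
  · have h1 := ENNReal.Tendsto.const_mul ((hc₁.continuous_G s (Y s)).comp (hlim s))
      (Or.inr (ENNReal.ofReal_ne_top (r := ‖S.toLevel p₁ x‖ ^ 2)))
    rw [mul_zero] at h1
    refine tendsto_of_tendsto_of_tendsto_of_le_of_le tendsto_const_nhds h1
      (fun n => zero_le) (fun n => ?_)
    simp only [Function.comp_apply]
    rw [← lintegral_const_mul' _ _ ENNReal.ofReal_ne_top]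
    refine lintegral_mono fun v => ?_
    have hne := S.negNorm_sub_ne_top
      (hc₁.G_ne_top s (S.negNorm_incl_ne_top p₁ (Z n s)) v)
      (hc₁.G_ne_top s (S.negNorm_incl_ne_top p₁ (Y s)) v)
    refine (hle p₁ _ hne).trans (le_of_eq ?_)
    rw [ENNReal.ofReal_pow (S.nn_nonneg _ _), S.ofReal_nn hne]

/-- The integral part is jointly continuous in bounded paths and controls of bounded cost. -/
theorem GrowthContext.tendsto_skInt (H : GrowthContext S ν A G p q K h₀)
    (hc₁ : CoeffCondition S ν A G p₁ q₁ K₁) (hR : 0 ≤ R)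
    {Z : ℕ → Icc (0 : ℝ) T → S.Neg p₁} {Y : Icc (0 : ℝ) T → S.Neg p₁}
    (hZ : ∀ n, BoundedPath S p R fun s => S.incl p₁ (Z n s))
    (hY : BoundedPath S p R fun s => S.incl p₁ (Y s))
    (hlim : ∀ s, Tendsto (fun n => Z n s) atTop (𝓝 (Y s)))
    {g : ℕ → Icc (0 : ℝ) T × X → ℝ≥0} {g₀ : Icc (0 : ℝ) T × X → ℝ≥0}
    (hg : ∀ n, CostLE T ν N (g n)) (hg₀ : CostLE T ν N g₀)
    (hglim : ∀ f : C_c(Icc (0 : ℝ) T × X, ℝ), Tendsto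
      (fun n => ∫ z, f z ∂((nuT T ν).withDensity fun z => (g n z : ℝ≥0∞)))
      atTop (𝓝 (∫ z, f z ∂((nuT T ν).withDensity fun z => (g₀ z : ℝ≥0∞)))))
    (x : Φ) (t : Icc (0 : ℝ) T) :
    Tendsto (fun n => skInt ν A G (g n) (fun s => S.incl p₁ (Z n s)) x t) atTop
      (𝓝 (skInt ν A G g₀ (fun s => S.incl p₁ (Y s)) x t)) := by
  refine Tendsto.add ?_ ?_
  · refine tendsto_integral_of_dominated_convergence
      (fun _ => √(K * (1 + R ^ 2)) * ‖S.toLevel q x‖)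
      (fun n => (H.meas.measurable_A (hZ n).meas x).aestronglyMeasurable) (integrable_const _)
      (fun n => Eventually.of_forall fun s => H.abs_A_le hR (hZ n) x s)
      (Eventually.of_forall fun s => ?_)
    have h1 := (ENNReal.tendsto_toReal ENNReal.zero_ne_top).comp
      ((hc₁.continuous_A s (Y s)).comp (hlim s))
    have h2 := h1.mul_const ‖S.toLevel q₁ x‖
    rw [ENNReal.toReal_zero, zero_mul] at h2
    rw [tendsto_iff_norm_sub_tendsto_zero]
    refine squeeze_zero (fun n => norm_nonneg _) (fun n => ?_) h2
    exact S.abs_apply_le (S.negNorm_sub_ne_top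
      (hc₁.A_ne_top s (S.negNorm_incl_ne_top p₁ (Z n s)))
      (hc₁.A_ne_top s (S.negNorm_incl_ne_top p₁ (Y s)))) x
  · set s : Set (Icc (0 : ℝ) T × X) := {z | z.1 ≤ t}
    have hs : MeasurableSet s := measurableSet_fst_le t
    set ψ : ℕ → Icc (0 : ℝ) T × X → ℝ := fun n => s.indicator fun z =>
      G z.1 (S.incl p₁ (Z n z.1)) z.2 x
    set ψ₀ : Icc (0 : ℝ) T × X → ℝ := s.indicator fun z => G z.1 (S.incl p₁ (Y z.1)) z.2 x
    simp_rw [setIntegral_mul_eq_indicator hs]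
    have hsq : ∀ f : Icc (0 : ℝ) T × X → ℝ, ∀ z, s.indicator f z ^ 2 ≤ f z ^ 2 := fun f z => by
      by_cases hz : z ∈ s <;> simp [hz, sq_nonneg]
    have hab : ∀ f : Icc (0 : ℝ) T × X → ℝ, ∀ z, |s.indicator f z| ≤ |f z| := fun f z =>
      sq_le_sq.1 (hsq f z)
    have hfin : ∀ V, BoundedPath S p R V → ∫⁻ z, ENNReal.ofReal
        (s.indicator (fun z : Icc (0 : ℝ) T × X => G z.1 (V z.1) z.2 x) z ^ 2) ∂(nuT T ν) ≠ ∞ :=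
      fun V hV => ne_top_of_le_ne_top (H.lintegral_G_apply_sq_ne_top hR hV x)
        (lintegral_mono fun z => ENNReal.ofReal_le_ofReal (hsq _ z))
    have hdom : ∀ V, BoundedPath S p R V → ∀ᵐ z ∂(nuT T ν),
        |s.indicator (fun z : Icc (0 : ℝ) T × X => G z.1 (V z.1) z.2 x) z|
          ≤ ((1 + R) * ‖S.toLevel p x‖ + 1) * h₀ z := fun V hV =>
      (H.ae_abs_G_le hR hV x).mono fun z hz => (hab _ z).trans hz
    have hψm : ∀ n, Measurable (ψ n) := fun n => (H.meas.measurable_G (hZ n).meas x).indicator hs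
    have hψ₀m : Measurable ψ₀ := (H.meas.measurable_G hY.meas x).indicator hs
    have hψf : ∀ n, ∫⁻ z, ENNReal.ofReal (ψ n z ^ 2) ∂(nuT T ν) ≠ ∞ := fun n =>
      hfin (fun s => S.incl p₁ (Z n s)) (hZ n)
    have hψd : ∀ n, ∀ᵐ z ∂(nuT T ν), |ψ n z| ≤ ((1 + R) * ‖S.toLevel p x‖ + 1) * h₀ z := fun n =>
      hdom (fun s => S.incl p₁ (Z n s)) (hZ n)
    have hψ₀f : ∫⁻ z, ENNReal.ofReal (ψ₀ z ^ 2) ∂(nuT T ν) ≠ ∞ :=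
      hfin (fun s => S.incl p₁ (Y s)) hY
    have hψ₀d : ∀ᵐ z ∂(nuT T ν), |ψ₀ z| ≤ ((1 + R) * ‖S.toLevel p x‖ + 1) * h₀ z :=
      hdom (fun s => S.incl p₁ (Y s)) hY
    have hψi : ∀ n, Integrable (fun z => ψ n z * ((g n z : ℝ) - 1)) (nuT T ν) := fun n =>
      integrable_mul_sub_one (H.tail_mul hR x) (hg n).meas (hg n).ne_top
        (hψm n).aestronglyMeasurable (hψf n) (hψd n)
    have hψ₀i : ∀ n, Integrable (fun z => ψ₀ z * ((g n z : ℝ) - 1)) (nuT T ν) := fun n =>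
      integrable_mul_sub_one (H.tail_mul hR x) (hg n).meas (hg n).ne_top
        hψ₀m.aestronglyMeasurable hψ₀f hψ₀d
    -- The difference of the two control integrals is split as `∫ (ψ_n - ψ₀)(g_n - 1)` plus `∫ ψ₀
    -- (g_n - g₀)`; the second part is handled here, with a fixed integrand.
    have hweak := tendsto_integral_mul_sub_one (H.tail_mul hR x) hψ₀m hψ₀f hψ₀d
      (fun n => (hg n).meas) hg₀.meas (fun n => (hg n).cost) hg₀.cost hglim
    have hdiff : Tendsto (fun n => ∫ z, (ψ n z - ψ₀ z) * ((g n z : ℝ) - 1) ∂(nuT T ν))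
        atTop (𝓝 0) := by
      rw [Metric.tendsto_atTop]
      intro ε hε
      -- Both `ψ_n` and `ψ₀` lie below the same majorant, so their difference lies below its double;
      -- the estimate uniform in `g_n` reduces the claim to `L²` convergence.
      obtain ⟨C, hC, HC⟩ := lintegral_mul_abs_sub_one_le
        ((H.tail_mul hR x).const_mul (c := 2) (by norm_num)) N (ε := ε / 3) (by positivity)
      have h1 := ENNReal.Tendsto.const_mul (H.tendsto_lintegral_G_sub_sq hc₁ hR hZ hY hlim x)
        (Or.inr (ENNReal.ofReal_ne_top (r := C)))
      rw [mul_zero] at h1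
      have h2 := h1.eventually (gt_mem_nhds (ENNReal.ofReal_pos.2 (by positivity : 0 < ε / 3)))
      obtain ⟨n₀, hn₀⟩ := eventually_atTop.1 h2
      refine ⟨n₀, fun n hn => ?_⟩
      rw [Real.dist_eq, sub_zero]
      refine lt_of_le_of_lt (abs_integral_mul_sub_one_le (ε := ε / 3 + ε / 3) (by positivity) ?_)
        (by linarith)
      refine (HC (g n) (hg n).meas (hg n).cost _ ?_).trans ?_
      · filter_upwards [hψd n, hψ₀d] with z hz1 hz2
        refine ⟨abs_nonneg _, (abs_sub _ _).trans ?_⟩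
        simp only [ψ, ψ₀]
        linarith
      · rw [ENNReal.ofReal_add (by positivity) (by positivity)]
        gcongr
        refine le_trans (mul_le_mul_right (lintegral_mono fun z => ?_) _) (hn₀ n hn).le
        refine ENNReal.ofReal_le_ofReal ?_
        rw [sq_abs]
        have := hsq (fun z => (G z.1 (S.incl p₁ (Z n z.1)) z.2
          - G z.1 (S.incl p₁ (Y z.1)) z.2) x) z
        refine le_trans (le_of_eq ?_) this
        simp only [ψ, ψ₀, sub_apply, indicator_sub]
    have hsum := hdiff.add hweak
    rw [zero_add] at hsum
    refine hsum.congr fun n => ?_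
    rw [← integral_add]
    · refine integral_congr_ae (Eventually.of_forall fun z => ?_)
      simp only; ring
    · exact ((hψi n).sub (hψ₀i n)).congr (Eventually.of_forall fun z => by
        simp only [Pi.sub_apply]; ring)
    · exact hψ₀i n

end Limits

/-! ### Compactness of approximate solutions -/

section Compactness

variable {Φ : Type*} [AddCommGroup Φ] [Module ℝ Φ] [UniformSpace Φ] [IsUniformAddGroup Φ]
  {X : Type*} [TopologicalSpace X] [PolishSpace X] [LocallyCompactSpace X]
  [MeasurableSpace X] [BorelSpace X] {T : ℝ}
  {S : CHNS Φ} {ν : Measure X} [IsFiniteMeasureOnCompacts ν]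
  {A : Icc (0 : ℝ) T → StrongDual ℝ Φ → StrongDual ℝ Φ}
  {G : Icc (0 : ℝ) T → StrongDual ℝ Φ → X → StrongDual ℝ Φ} {p q p₁ q₁ : ℕ} {K K₁ R : ℝ}
  {h₀ : Icc (0 : ℝ) T × X → ℝ} {N : ℕ} {g : Icc (0 : ℝ) T × X → ℝ≥0}
  {Y : Icc (0 : ℝ) T → StrongDual ℝ Φ}

theorem GrowthContext.skInt_proj (H : GrowthContext S ν A G p q K h₀) (hR : 0 ≤ R)
    (hY : BoundedPath S p R Y) (hg : CostLE T ν N g) (J : ℕ) (x : Φ) (t : Icc (0 : ℝ) T) :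
    skInt ν A G g Y (S.proj J x) t
      = ∑ j ∈ Finset.range J, S.coef x j * skInt ν A G g Y (S.phi j) t := by
  simp only [skInt, S.dual_proj, Finset.sum_mul, mul_add, Finset.sum_add_distrib]
  congr 1
  · rw [integral_finsetSum _ fun j _ => ((H.integrable_A hR hY (S.phi j)).const_mul _).integrableOn]
    simp_rw [integral_const_mul]
  · have h : ∀ j, Integrable (fun z => S.coef x j * G z.1 (Y z.1) z.2 (S.phi j) * ((g z : ℝ) - 1))
        (nuT T ν) := fun j => by
      simp_rw [mul_assoc]
      exact (H.integrable_G hR hY hg (S.phi j)).const_mul _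
    rw [integral_finsetSum _ fun j _ => (h j).integrableOn]
    simp_rw [mul_assoc, integral_const_mul]

/-- Dominated convergence along the partial sums of `x`, whose norms at each level are bounded; the
majorant of the control term is a multiple of `‖G‖_{-p} |g - 1|`. This upgrades equations for the
coordinates to equations tested on all of `Φ`. -/
theorem GrowthContext.tendsto_skInt_proj (H : GrowthContext S ν A G p q K h₀) (hR : 0 ≤ R)
    (hY : BoundedPath S p R Y) (hg : CostLE T ν N g) (x : Φ) (t : Icc (0 : ℝ) T) :
    Tendsto (fun J => skInt ν A G g Y (S.proj J x) t) atTop (𝓝 (skInt ν A G g Y x t)) := by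
  have hbd : ∀ n, ∃ C, 0 ≤ C ∧ ∀ J, ‖S.toLevel n (S.proj J x)‖ ≤ C := by
    intro n
    obtain ⟨C, hC⟩ := (S.tendsto_norm_sub_proj n x).bddAbove_range
    refine ⟨‖S.toLevel n x‖ + C, add_nonneg (norm_nonneg _)
      ((norm_nonneg _).trans (hC ⟨0, rfl⟩)), fun J => ?_⟩
    have h1 := hC ⟨J, rfl⟩
    have h2 := norm_sub_le (S.toLevel n x) (S.toLevel n (x - S.proj J x))
    rw [← map_sub, sub_sub_cancel] at h2
    linarith
  refine Tendsto.add ?_ ?_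
  · obtain ⟨C, hC, hCJ⟩ := hbd q
    refine tendsto_integral_of_dominated_convergence (fun _ => √(K * (1 + R ^ 2)) * C)
      (fun J => (H.meas.measurable_A hY.meas _).aestronglyMeasurable) (integrable_const _)
      (fun J => Eventually.of_forall fun s => (H.abs_A_le hR hY _ s).trans ?_)
      (Eventually.of_forall fun s => ((A s (Y s)).continuous.tendsto x).comp (S.tendsto_proj x))
    gcongr
    exact hCJ J
  · obtain ⟨C, hC, hCJ⟩ := hbd p
    have hm := H.measurable_nn_G hY p
    have hi : Integrable (fun z => S.nn p (G z.1 (Y z.1) z.2) * ((g z : ℝ) - 1)) (nuT T ν) := by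
      refine integrable_mul_sub_one (H.tail.const_mul (c := 1 + R) (by positivity)) hg.meas
        hg.ne_top hm.aestronglyMeasurable ?_ ?_
      · have h := H.lintegral_nn_G_sq_le hR hY univ
        rw [univ_prod_univ, Measure.restrict_univ] at h
        exact ne_top_of_le_ne_top
          (ENNReal.mul_ne_top ENNReal.ofReal_ne_top (measure_ne_top _ _)) h
      · filter_upwards [H.ae_nn_G_le] with z hz
        rw [abs_of_nonneg (S.nn_nonneg _ _), mul_comm]
        refine (hz _ (hY.ne_top z.1)).trans ?_
        have := hY.nn_le hR z.1
        have := H.tail.nonneg z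
        gcongr
    refine tendsto_integral_of_dominated_convergence
      (fun z => C * ‖S.nn p (G z.1 (Y z.1) z.2) * ((g z : ℝ) - 1)‖)
      (fun J => (H.integrable_G hR hY hg _).integrableOn.aestronglyMeasurable)
      (hi.norm.const_mul C).integrableOn
      (fun J => Eventually.of_forall fun z => ?_)
      (Eventually.of_forall fun z =>
        (((G z.1 (Y z.1) z.2).continuous.tendsto x).comp (S.tendsto_proj x)).mul_const _)
    rw [norm_mul, norm_mul, ← mul_assoc, Real.norm_of_nonneg (S.nn_nonneg _ _), mul_comm C]
    refine mul_le_mul_of_nonneg_right ?_ (norm_nonneg _)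
    refine (S.abs_apply_le (H.coeff.G_ne_top z.1 (hY.ne_top z.1) z.2) _).trans ?_
    exact mul_le_mul_of_nonneg_left (hCJ J) (S.nn_nonneg _ _)

/-- The coordinate equations imply the equation tested against every `x ∈ Φ`. -/
theorem GrowthContext.equation_of_coord (H : GrowthContext S ν A G p q K h₀) (hR : 0 ≤ R)
    (hY : BoundedPath S p R Y) (hg : CostLE T ν N g) {w : StrongDual ℝ Φ}
    (h : ∀ j t, Y t (S.phi j) = w (S.phi j) + skInt ν A G g Y (S.phi j) t)
    (x : Φ) (t : Icc (0 : ℝ) T) : Y t x = w x + skInt ν A G g Y x t := by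
  refine tendsto_nhds_unique (S.dual_tendsto (Y t) x) ?_
  refine ((S.dual_tendsto w x).add (H.tendsto_skInt_proj hR hY hg x t)).congr fun J => ?_
  rw [H.skInt_proj hR hY hg, ← Finset.sum_add_distrib]
  exact Finset.sum_congr rfl fun j _ => by rw [h j t, mul_add]

/-- Families of paths bounded in `Φ_{-p}` whose coordinates are equicontinuous are equicontinuous in
`Φ_{-p₁}` when the injection is Hilbert–Schmidt. -/
theorem equicontinuous_of_coord (hHS : S.InjectionHS p p₁) (hpp₁ : p ≤ p₁) (hR : 0 ≤ R)
    {ι : Type*} {Y : ι → Icc (0 : ℝ) T → S.Neg p₁}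
    (hYb : ∀ n t, S.negNorm p (S.incl p₁ (Y n t)) ≤ ENNReal.ofReal R)
    (hmod : ∀ j, ∀ ε > 0, ∃ C : ℝ, 0 ≤ C ∧ ∀ n, ∀ s t : Icc (0 : ℝ) T, s ≤ t →
      |S.incl p₁ (Y n t) (S.phi j) - S.incl p₁ (Y n s) (S.phi j)| ≤ C * (t - s : ℝ) + ε) :
    Equicontinuous Y := by
  refine UniformEquicontinuous.equicontinuous (Metric.uniformEquicontinuous_iff.2 fun ε hε => ?_)
  obtain ⟨J, hJ⟩ := hHS.exists_tail hpp₁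
    (show 0 < ε ^ 2 / 4 / ((2 * R) ^ 2 + 1) by positivity)
  -- Each of the `J` coordinates will move by at most `2 ε'`, so their squares sum to at most `ε² /
  -- 4`; the tail contributes the same.
  set ε' := ε / (4 * (J + 1))
  have hε' : 0 < ε' := by positivity
  choose C hC0 hC using fun j => hmod j ε' hε'
  set D := ∑ j ∈ Finset.range J, C j
  have hD : 0 ≤ D := Finset.sum_nonneg fun j _ => hC0 j
  have key : ∀ n, ∀ s t : Icc (0 : ℝ) T, s ≤ t → (t - s : ℝ) < ε' / (D + 1) →
      dist (Y n t) (Y n s) < ε := by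
    intro n s t hst hd
    rw [dist_eq_norm]
    refine lt_of_pow_lt_pow_left₀ 2 hε.le ?_
    have hst' : (0 : ℝ) ≤ t - s := sub_nonneg.2 hst
    have h1 := S.norm_sub_sq_le_tail hR (by positivity) hJ (hYb n t) (hYb n s)
    have h2 : ∀ j ∈ Finset.range J,
        (S.incl p₁ (Y n t) (S.phi j) - S.incl p₁ (Y n s) (S.phi j)) ^ 2 ≤ (2 * ε') ^ 2 := by
      intro j hj
      refine sq_le_sq.2 ?_
      rw [abs_of_pos (show 0 < 2 * ε' by positivity)]
      refine (hC j n s t hst).trans ?_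
      have h3 : C j ≤ D + 1 := (Finset.single_le_sum (fun i _ => hC0 i) hj).trans (by linarith)
      have h4 : C j * (t - s : ℝ) ≤ (D + 1) * (ε' / (D + 1)) := by gcongr
      rw [mul_div_cancel₀ _ (by positivity)] at h4
      linarith
    have h5 := Finset.sum_le_card_nsmul _ _ _ h2
    rw [Finset.card_range, nsmul_eq_mul] at h5
    have h6 : (J : ℝ) * (2 * ε') ^ 2 ≤ ε ^ 2 / 4 := by
      have e : (J : ℝ) * (2 * ε') ^ 2 = ε ^ 2 / 4 * (J / (J + 1) ^ 2) := by
        simp only [ε']; field_simp; ring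
      rw [e]
      refine mul_le_of_le_one_right (by positivity) ((div_le_one (by positivity)).2 ?_)
      nlinarith [(Nat.cast_nonneg J : (0 : ℝ) ≤ J)]
    have h7 : ε ^ 2 / 4 / ((2 * R) ^ 2 + 1) * (2 * R) ^ 2 ≤ ε ^ 2 / 4 := by
      rw [div_mul_eq_mul_div, div_le_iff₀ (by positivity)]
      have : 0 ≤ ε ^ 2 / 4 := by positivity
      nlinarith
    have : 0 < ε ^ 2 := by positivity
    linarith
  refine ⟨ε' / (D + 1), by positivity, fun s t hst n => ?_⟩
  rw [Subtype.dist_eq, Real.dist_eq] at hst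
  rcases le_total s t with h | h
  · rw [dist_comm]
    refine key n s t h ?_
    rw [abs_sub_comm] at hst
    exact (le_abs_self _).trans_lt hst
  · exact key n t s h ((le_abs_self _).trans_lt hst)

/-- The Arzelà–Ascoli theorem for sequences. -/
theorem ContinuousMap.exists_subseq_tendsto {α β : Type*} [TopologicalSpace α] [CompactSpace α]
    [MetricSpace β] {B : Set β} (hB : IsCompact B) {Y : ℕ → C(α, β)} (hYB : ∀ n t, Y n t ∈ B)
    (hY : Equicontinuous fun n => (Y n : α → β)) :
    ∃ (Y₀ : C(α, β)) (σ : ℕ → ℕ), StrictMono σ ∧ Tendsto (Y ∘ σ) atTop (𝓝 Y₀) := by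
  set e := ContinuousMap.isometryEquivBoundedOfCompact α β
  have hcomp := BoundedContinuousFunction.arzela_ascoli B hB (range fun n => e (Y n))
    (by rintro _ t ⟨n, rfl⟩; exact hYB n t) (by
      choose k hk using fun f : range fun n => e (Y n) => f.2
      have h1 := hY.comp k
      convert h1 using 1
      funext f
      rw [← hk f]; rfl)
  obtain ⟨V, -, σ, hσ, hV⟩ := hcomp.tendsto_subseq (x := fun n => e (Y n))
    fun n => subset_closure ⟨n, rfl⟩
  refine ⟨e.symm V, σ, hσ, ((e.symm.continuous.tendsto V).comp hV).congr fun n => ?_⟩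
  simp

/-- Compactness of approximate solutions, and identification of their limits. -/
theorem GrowthContext.exists_subseq_solution (H : GrowthContext S ν A G p q K h₀)
    (hc₁ : CoeffCondition S ν A G p₁ q₁ K₁) (hpp₁ : p ≤ p₁) (hHS : S.InjectionHS p p₁)
    (hR : 0 ≤ R) (w : StrongDual ℝ Φ)
    {Y : ℕ → C(Icc (0 : ℝ) T, S.Neg p₁)} {τ : ℕ → Icc (0 : ℝ) T → Icc (0 : ℝ) T}
    (hτ : ∀ n, Measurable (τ n)) (hτlim : ∀ s, Tendsto (fun n => τ n s) atTop (𝓝 s))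
    {g : ℕ → Icc (0 : ℝ) T × X → ℝ≥0} {g₀ : Icc (0 : ℝ) T × X → ℝ≥0}
    (hg : ∀ n, CostLE T ν N (g n)) (hg₀ : CostLE T ν N g₀)
    (hglim : ∀ f : C_c(Icc (0 : ℝ) T × X, ℝ), Tendsto
      (fun n => ∫ z, f z ∂((nuT T ν).withDensity fun z => (g n z : ℝ≥0∞)))
      atTop (𝓝 (∫ z, f z ∂((nuT T ν).withDensity fun z => (g₀ z : ℝ≥0∞)))))
    (hYb : ∀ n t, S.negNorm p (S.incl p₁ (Y n t)) ≤ ENNReal.ofReal R)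
    (hY : ∀ n j, (∀ t, S.incl p₁ (Y n t) (S.phi j) = w (S.phi j)
        + skInt ν A G (g n) (fun s => S.incl p₁ (Y n (τ n s))) (S.phi j) t) ∨
      (n ≤ j ∧ ∀ s t, S.incl p₁ (Y n s) (S.phi j) = S.incl p₁ (Y n t) (S.phi j))) :
    ∃ (Y₀ : C(Icc (0 : ℝ) T, S.Neg p₁)) (σ : ℕ → ℕ), StrictMono σ ∧
      Tendsto (Y ∘ σ) atTop (𝓝 Y₀) ∧
      (∀ t, S.negNorm p (S.incl p₁ (Y₀ t)) ≤ ENNReal.ofReal R) ∧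
      ∀ x t, S.incl p₁ (Y₀ t) x = w x + skInt ν A G g₀ (fun s => S.incl p₁ (Y₀ s)) x t := by
  have hpath : ∀ (V : C(Icc (0 : ℝ) T, S.Neg p₁)) (r : Icc (0 : ℝ) T → Icc (0 : ℝ) T),
      Measurable r → (∀ t, S.negNorm p (S.incl p₁ (V t)) ≤ ENNReal.ofReal R) →
      BoundedPath S p R fun s => S.incl p₁ (V (r s)) := fun V r hr hV =>
    ⟨fun x => (((S.continuous_incl_apply p₁ x).comp V.continuous).measurable).comp hr,
      fun s => hV (r s)⟩
  have heq : Equicontinuous fun n => (Y n : Icc (0 : ℝ) T → S.Neg p₁) := by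
    refine equicontinuous_of_coord hHS hpp₁ hR hYb fun j ε hε => ?_
    obtain ⟨C, hC, HC⟩ := H.exists_skInt_modulus hR N (S.phi j) hε
    refine ⟨C, hC, fun n s t hst => ?_⟩
    -- A coordinate either follows the equation, with the uniform modulus, or is constant in time,
    -- as the unused coordinates of a finite-dimensional approximation are.
    rcases hY n j with h | ⟨-, h⟩
    · rw [h t, h s, add_sub_add_left_eq_sub]
      exact HC _ (hpath (Y n) (τ n) (hτ n) (hYb n)) (g n) (hg n) s t hst
    · rw [h t s, sub_self, abs_zero]
      have : (0 : ℝ) ≤ t - s := sub_nonneg.2 hst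
      positivity
  obtain ⟨Y₀, σ, hσ, hlim⟩ :=
    ContinuousMap.exists_subseq_tendsto (hHS.isCompact_ball hpp₁ hR) hYb heq
  have hpt : ∀ t, Tendsto (fun n => Y (σ n) t) atTop (𝓝 (Y₀ t)) := fun t =>
    ((continuous_eval_const t).tendsto Y₀).comp hlim
  have hY₀b : ∀ t, S.negNorm p (S.incl p₁ (Y₀ t)) ≤ ENNReal.ofReal R := fun t =>
    (S.isClosed_ball p₁ p hR).mem_of_tendsto (hpt t) (Eventually.of_forall fun n => hYb (σ n) t)
  have hY₀ := hpath Y₀ id measurable_id hY₀b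
  refine ⟨Y₀, σ, hσ, hlim, hY₀b, H.equation_of_coord hR hY₀ hg₀ fun j t => ?_⟩
  -- Uniform convergence of the paths together with `τ n s → s` gives convergence of the delayed
  -- states, by joint continuity of evaluation.
  have hsk := H.tendsto_skInt hc₁ hR (Z := fun n s => Y (σ n) (τ (σ n) s))
    (Y := fun s => Y₀ s) (fun n => hpath (Y (σ n)) (τ (σ n)) (hτ _) (hYb _)) hY₀
    (fun s => by
      have h1 := (hτlim s).comp hσ.tendsto_atTop
      exact ((continuous_eval (F := C(Icc (0 : ℝ) T, S.Neg p₁))).tendsto (Y₀, s)).comp (hlim.prodMk_nhds h1))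
    (fun n => hg (σ n)) hg₀ (fun f => (hglim f).comp hσ.tendsto_atTop) (S.phi j) t
  refine tendsto_nhds_unique
    (((S.continuous_incl_apply p₁ (S.phi j)).tendsto (Y₀ t)).comp (hpt t)) ?_
  refine (hsk.const_add (w (S.phi j))).congr' ?_
  -- For fixed `j`, all late approximations have index above `j`, which rules out the second
  -- alternative.
  filter_upwards [eventually_gt_atTop j] with n hn
  rcases hY (σ n) j with h | ⟨h, -⟩
  · exact (h t).symm
  · exact absurd (hn.trans_le hσ.le_apply) h.not_gt

end Compactness

/-! ### Delayed finite-dimensional equations -/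

section Galerkin

variable {Φ : Type*} [AddCommGroup Φ] [Module ℝ Φ] [UniformSpace Φ] [IsUniformAddGroup Φ]
  {X : Type*} [TopologicalSpace X] [MeasurableSpace X] {T : ℝ}
  {S : CHNS Φ} {ν : Measure X} [SigmaFinite ν]
  {A : Icc (0 : ℝ) T → StrongDual ℝ Φ → StrongDual ℝ Φ}
  {G : Icc (0 : ℝ) T → StrongDual ℝ Φ → X → StrongDual ℝ Φ} {p q : ℕ} {K R : ℝ}
  {h₀ : Icc (0 : ℝ) T × X → ℝ} {N : ℕ} {g : Icc (0 : ℝ) T × X → ℝ≥0}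

/-- The path in `Φ ⊆ Φ'` with coordinates `c_j`, `j < d`. -/
def galPath (S : CHNS Φ) (d : ℕ) (c : ℕ → Icc (0 : ℝ) T → ℝ) (s : Icc (0 : ℝ) T) :
    StrongDual ℝ Φ :=
  S.embed (∑ j ∈ Finset.range d, c j s • S.phi j)

theorem galPath_apply_phi (d : ℕ) (c : ℕ → Icc (0 : ℝ) T → ℝ) (s : Icc (0 : ℝ) T) (i : ℕ) :
    galPath S d c s (S.phi i) = if i < d then c i s else 0 := by
  rw [galPath, S.embed_phi_apply]
  exact S.coef_sum d (fun j => c j s) i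

theorem nn_galPath_sq (d : ℕ) (c : ℕ → Icc (0 : ℝ) T → ℝ) (s : Icc (0 : ℝ) T) (n : ℕ) :
    S.negNorm n (galPath S d c s) ≠ ∞ ∧ S.nn n (galPath S d c s) ^ 2
      = ∑ j ∈ Finset.range d, c j s ^ 2 / S.wt n j ^ 2 := by
  have h := S.nn_sq_eq_sum (n := n) (J := d) (w := galPath S d c s) fun j hj => by
    rw [galPath_apply_phi, if_neg hj.not_gt]
  refine ⟨h.1, h.2.trans (Finset.sum_congr rfl fun j hj => ?_)⟩
  rw [galPath_apply_phi, if_pos (Finset.mem_range.1 hj)]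

/-- Rewrites the left side of the coercivity condition as the weighted sum that appears in the
energy of the approximation. -/
theorem apply_theta_galPath (d : ℕ) (c : ℕ → Icc (0 : ℝ) T → ℝ) (s : Icc (0 : ℝ) T) (p : ℕ)
    (w : StrongDual ℝ Φ) :
    w (S.theta p (∑ j ∈ Finset.range d, c j s • S.phi j))
      = ∑ j ∈ Finset.range d, w (S.phi j) * c j s / S.wt p j ^ 2 := by
  have hc := S.coef_sum d (fun j => c j s)
  rw [S.theta_apply_of_support (J := d) fun j hj => by rw [hc, if_neg hj.not_gt]]
  refine Finset.sum_congr rfl fun j hj => ?_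
  rw [hc, if_pos (Finset.mem_range.1 hj)]

theorem continuous_galPath_apply {c : ℕ → Icc (0 : ℝ) T → ℝ} (hc : ∀ j, Continuous (c j)) (d : ℕ)
    (x : Φ) : Continuous fun s => galPath S d c s x := by
  have e : ∀ s, galPath S d c s x
      = S.incl 0 (∑ j ∈ Finset.range d, c j s • S.basis 0 j) x := fun s => by
    rw [S.incl_sum_basis 0 d fun j => c j s]; rfl
  simp_rw [e]
  exact (S.continuous_incl_apply 0 x).comp
    (continuous_finsetSum _ fun j _ => (hc j).smul continuous_const)

theorem exists_boundedPath_galPath {c : ℕ → Icc (0 : ℝ) T → ℝ} (hc : ∀ j, Continuous (c j))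
    (d : ℕ) (n : ℕ) {τ : Icc (0 : ℝ) T → Icc (0 : ℝ) T} (hτ : Measurable τ) :
    ∃ R, 0 ≤ R ∧ BoundedPath S n R fun s => galPath S d c (τ s) := by
  have h1 : Continuous fun s => ∑ j ∈ Finset.range d, c j s ^ 2 / S.wt n j ^ 2 :=
    continuous_finsetSum _ fun j _ => ((hc j).pow 2).div_const _
  obtain ⟨C, hC⟩ := isCompact_univ.exists_bound_of_continuousOn h1.continuousOn
  refine ⟨√C, Real.sqrt_nonneg _, fun x => (continuous_galPath_apply hc d x).measurable.comp hτ,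
    fun s => ?_⟩
  obtain ⟨h2, h3⟩ := nn_galPath_sq (S := S) d c (τ s) n
  rw [← S.ofReal_nn h2]
  refine ENNReal.ofReal_le_ofReal (Real.le_sqrt_of_sq_le ?_)
  rw [h3]
  exact (le_abs_self _).trans (hC (τ s) (mem_univ _))

theorem GrowthContext.continuous_skInt (H : GrowthContext S ν A G p q K h₀) (hR : 0 ≤ R)
    {Y : Icc (0 : ℝ) T → StrongDual ℝ Φ} (hY : BoundedPath S p R Y) (hg : CostLE T ν N g) (x : Φ) :
    Continuous fun t => skInt ν A G g Y x t := by
  simp_rw [H.skInt_eq hR hY hg]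
  exact continuous_primitive_lamT ((H.integrable_A hR hY x).add (H.integrable_ctrlTerm hR hY hg x))

/-- Causality: only the past of the path enters. -/
theorem skInt_congr {Y Z : Icc (0 : ℝ) T → StrongDual ℝ Φ} (t : Icc (0 : ℝ) T)
    (h : ∀ s ≤ t, Y s = Z s) (x : Φ) : skInt ν A G g Y x t = skInt ν A G g Z x t := by
  rw [skInt, skInt]
  congr 1
  · exact setIntegral_congr_fun (measurableSet_le_time t) fun s hs => by rw [h s hs]
  · refine setIntegral_congr_fun (measurableSet_le measurable_fst measurable_const)
      fun z hz => ?_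
    simp only [h z.1 hz]

/-- The delay `s ↦ (s - δ) ∨ 0`. -/
def delay (hT : 0 ≤ T) (δ : ℝ) (s : Icc (0 : ℝ) T) : Icc (0 : ℝ) T := projIcc 0 T hT (s - δ)

theorem continuous_delay (hT : 0 ≤ T) (δ : ℝ) : Continuous (delay hT δ) :=
  continuous_projIcc.comp (continuous_subtype_val.sub continuous_const)

theorem coe_delay (hT : 0 ≤ T) {δ : ℝ} (hδ : 0 ≤ δ) (s : Icc (0 : ℝ) T) :
    (delay hT δ s : ℝ) = max 0 (s - δ) := by
  rw [delay, coe_projIcc, min_eq_right]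
  linarith [s.2.2]

theorem delay_le (hT : 0 ≤ T) {δ : ℝ} (hδ : 0 ≤ δ) (s : Icc (0 : ℝ) T) : delay hT δ s ≤ s := by
  rw [← Subtype.coe_le_coe, coe_delay hT hδ]
  exact max_le s.2.1 (by linarith)

theorem sub_delay_le (hT : 0 ≤ T) {δ : ℝ} (hδ : 0 ≤ δ) (s : Icc (0 : ℝ) T) :
    (s : ℝ) - delay hT δ s ≤ δ := by
  rw [coe_delay hT hδ]
  linarith [le_max_right 0 ((s : ℝ) - δ)]

/-- The delayed finite-dimensional equations have a solution. -/
theorem GrowthContext.exists_galerkin (H : GrowthContext S ν A G p q K h₀) (hg : CostLE T ν N g)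
    (hT : 0 ≤ T) (d : ℕ) {δ : ℝ} (hδ : 0 < δ) (w : ℕ → ℝ) :
    ∃ c : ℕ → Icc (0 : ℝ) T → ℝ, (∀ j, Continuous (c j)) ∧
      ∀ j t, c j t = w j + skInt ν A G g (fun s => galPath S d c (delay hT δ s)) (S.phi j) t := by
  -- The map produces all coordinates, but only those with `j < d` feed back, through `galPath`.
  set Ψ : (ℕ → Icc (0 : ℝ) T → ℝ) → ℕ → Icc (0 : ℝ) T → ℝ := fun c j t =>
    w j + skInt ν A G g (fun s => galPath S d c (delay hT δ s)) (S.phi j) t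
  have hΨc : ∀ c, (∀ j, Continuous (c j)) → ∀ j, Continuous (Ψ c j) := fun c hc j => by
    obtain ⟨R, hR, hb⟩ := exists_boundedPath_galPath (S := S) hc d p (continuous_delay hT δ).measurable
    exact continuous_const.add (H.continuous_skInt hR hb hg (S.phi j))
  set c : ℕ → ℕ → Icc (0 : ℝ) T → ℝ := fun k => Ψ^[k] fun j _ => w j
  have hcs : ∀ k, c (k + 1) = Ψ (c k) := fun k => Function.iterate_succ_apply' _ _ _
  have hcc : ∀ k j, Continuous (c k j) := by
    intro k
    induction k with
    | zero => exact fun j => continuous_const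
    | succ k ih => rw [hcs]; exact hΨc _ ih
  -- Because of the delay, the value of `Ψ c` at `t` depends on `c` only up to `(t - δ) ∨ 0`; each
  -- iteration therefore settles one more interval of length `δ`, and finitely many cover `[0, T]`.
  have hagree : ∀ k : ℕ, ∀ t : Icc (0 : ℝ) T, (t : ℝ) ≤ k * δ → ∀ j, c (k + 1) j t = c k j t := by
    intro k
    induction k with
    | zero =>
      intro t ht j
      -- For `k = 0` the time is `0`, and both integrals run over null sets.
      have ht0 : ∀ r : Icc (0 : ℝ) T, r ≤ t ↔ r = t := fun r => by
        constructor
        · intro h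
          refine le_antisymm h (Subtype.coe_le_coe.1 ?_)
          have := r.2.1
          simp only [Nat.cast_zero, zero_mul] at ht
          linarith
        · exact fun h => h.le
      have e1 : {s : Icc (0 : ℝ) T | s ≤ t} = {t} := by ext r; simp [ht0]
      have e2 : {z : Icc (0 : ℝ) T × X | z.1 ≤ t} = {t} ×ˢ univ := by ext r; simp [ht0]
      have h1 : lamT T {t} = 0 := measure_singleton t
      have h2 : nuT T ν ({t} ×ˢ univ) = 0 := by rw [nuT, Measure.prod_prod, h1, zero_mul]
      rw [hcs]
      simp only [Ψ, skInt, e1, e2, Measure.restrict_eq_zero.2 h1, Measure.restrict_eq_zero.2 h2,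
        integral_zero_measure, add_zero]
      rfl
    | succ k ih =>
      intro t ht j
      rw [hcs (k + 1)]
      conv_rhs => rw [hcs k]
      simp only [Ψ]
      congr 1
      refine skInt_congr t (fun s hs => ?_) _
      simp only [galPath]
      congr 1
      refine Finset.sum_congr rfl fun i _ => ?_
      rw [ih]
      rw [coe_delay hT hδ.le]
      have hs' : (s : ℝ) ≤ t := hs
      refine max_le (by positivity) ?_
      push_cast at ht
      linarith
  obtain ⟨k, hk⟩ := exists_nat_ge (T / δ)
  rw [div_le_iff₀ hδ] at hk
  refine ⟨c k, hcc k, fun j t => ?_⟩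
  rw [← hagree k t (t.2.2.trans hk) j, hcs]

end Galerkin

/-! ### A priori bound uniform in the dimension -/

section GalerkinBound

variable {Φ : Type*} [AddCommGroup Φ] [Module ℝ Φ] [UniformSpace Φ] [IsUniformAddGroup Φ]
  {X : Type*} [TopologicalSpace X] [MeasurableSpace X] {T : ℝ}
  {S : CHNS Φ} {ν : Measure X} [SigmaFinite ν]
  {A : Icc (0 : ℝ) T → StrongDual ℝ Φ → StrongDual ℝ Φ}
  {G : Icc (0 : ℝ) T → StrongDual ℝ Φ → X → StrongDual ℝ Φ} {p q : ℕ} {K R : ℝ}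
  {h₀ : Icc (0 : ℝ) T × X → ℝ} {N : ℕ} {g : Icc (0 : ℝ) T × X → ℝ≥0}

/-- A priori bound for the delayed finite-dimensional equations; it does not depend on the
dimension once the delay is small enough. -/
theorem GrowthContext.galerkin_bound (H : GrowthContext S ν A G p q K h₀) (hg : CostLE T ν N g)
    (hT : 0 ≤ T) {d : ℕ} {δ : ℝ} (hδ : 0 < δ) {w : StrongDual ℝ Φ} (hw : S.negNorm p w ≠ ∞)
    {c : ℕ → Icc (0 : ℝ) T → ℝ} (hc : ∀ j, Continuous (c j))
    (heq : ∀ j t, c j t = w (S.phi j)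
      + skInt ν A G g (fun s => galPath S d c (delay hT δ s)) (S.phi j) t)
    {b : Icc (0 : ℝ) T → ℝ} (hb0 : ∀ s, 0 ≤ b s) (hbi : Integrable b (lamT T)) {B : ℝ}
    (hbB : ∫ s, b s ∂(lamT T) ≤ B)
    (hb : ∀ᵐ s ∂(lamT T), ∀ w, S.negNorm p w ≠ ∞ → ∀ (F : X → ℝ) (c : ℝ), 0 ≤ c →
        (∀ v, |F v| ≤ c * S.nn p (G s w v)) →
        |∫ v, F v * ((g (s, v) : ℝ) - 1) ∂ν| ≤ c * ((1 + S.nn p w) * b s))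
    {η : ℝ} (hη0 : 0 ≤ η)
    (hη : ∀ s, ∫ r in Ioc (delay hT δ s) s, (√K + 2 * b r) ∂(lamT T) ≤ η)
    (hηd : 2 * η * √K * ∑ j ∈ Finset.range d, S.wt q j ^ 2 / S.wt p j ^ 2 ≤ 1)
    (t : Icc (0 : ℝ) T) :
    1 + S.nn p (galPath S d c t) ^ 2 ≤ 2 * (1 + S.nn p w ^ 2)
      * Real.exp (2 * ((K + 1) * (lamT T univ).toReal + 4 * B)) := by
  have hK := H.K_nonneg
  set τ := delay hT δ
  have hτ : Measurable τ := (continuous_delay hT δ).measurable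
  obtain ⟨R, hR, hV'⟩ := exists_boundedPath_galPath (S := S) hc d p hτ
  obtain ⟨R₁, hR₁, hV⟩ := exists_boundedPath_galPath (S := S) hc d p
    (measurable_id (α := Icc (0 : ℝ) T))
  set V : Icc (0 : ℝ) T → StrongDual ℝ Φ := galPath S d c
  have hVne : ∀ s, S.negNorm p (V s) ≠ ∞ := fun s => (nn_galPath_sq d c s p).1
  have hV'ne : ∀ s, S.negNorm p (V (τ s)) ≠ ∞ := fun s => hVne _
  set f : ℕ → Icc (0 : ℝ) T → ℝ := fun j s =>
    A s (V (τ s)) (S.phi j) + ctrlTerm ν G g s (V (τ s)) (S.phi j)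
  have hfi : ∀ j, Integrable (f j) (lamT T) := fun j =>
    (H.integrable_A hR hV' (S.phi j)).add (H.integrable_ctrlTerm hR hV' hg (S.phi j))
  have hcf : ∀ j t, c j t = w (S.phi j) + ∫ s in {s | s ≤ t}, f j s ∂(lamT T) := fun j t => by
    rw [heq, H.skInt_eq hR hV' hg]
  have hpi : ∀ j, Integrable (fun s => 2 * c j s * f j s) (lamT T) := fun j =>
    (integrable_mul_continuous (hfi j) ((hc j).const_mul 2)).congr
      (Eventually.of_forall fun s => by ring)
  have hsq : ∀ j t, c j t ^ 2
      = w (S.phi j) ^ 2 + ∫ s in {s | s ≤ t}, 2 * c j s * f j s ∂(lamT T) := fun j t => by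
    rw [hcf, sq_primitive_lamT (hfi j) _ t]
    simp_rw [← hcf]
  have hw0 : ∑ j ∈ Finset.range d, w (S.phi j) ^ 2 / S.wt p j ^ 2 ≤ S.nn p w ^ 2 :=
    (S.hasSum_negNorm hw).summable.sum_le_tsum _ (fun j _ => by positivity) |>.trans
      (S.hasSum_negNorm hw).tsum_eq.le
  have henergy : ∀ t, 1 + S.nn p (V t) ^ 2 ≤ (1 + S.nn p w ^ 2) + ∫ s in {s | s ≤ t},
      ∑ j ∈ Finset.range d, 2 * c j s * f j s / S.wt p j ^ 2 ∂(lamT T) := by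
    intro t
    rw [(nn_galPath_sq d c t p).2,
      integral_finsetSum _ fun j _ => ((hpi j).div_const _).integrableOn]
    simp_rw [integral_div, hsq _ t, add_div, Finset.sum_add_distrib]
    linarith
  have hκi : Integrable (fun s => K + 1 + 4 * b s) (lamT T) :=
    (integrable_const _).add (hbi.const_mul 4)
  -- In the rate `K + 1 + 4 b`, the term `K` comes from coercivity, `1` from the delay error and `4
  -- b` from the control.
  have hgr := gronwall_majorant (κ := fun s => K + 1 + 4 * b s) (c := 1 + S.nn p w ^ 2)
    (y := fun t => 1 + S.nn p (V t) ^ 2) (fun s => by have := hb0 s; positivity) hκi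
    (fun s => by positivity) ⟨1 + R₁ ^ 2, by
      rintro _ ⟨s, rfl⟩
      have := hV.nn_le hR₁ s
      have h0 := S.nn_nonneg p (V s)
      change S.nn p (V s) ≤ R₁ at this
      simp only
      gcongr⟩ ?_ t
  · refine hgr.trans ?_
    have e : ∫ s, (K + 1 + 4 * b s) ∂(lamT T)
        = (K + 1) * (lamT T univ).toReal + 4 * ∫ s, b s ∂(lamT T) := by
      rw [integral_add (integrable_const _) (hbi.const_mul 4), integral_const_mul, integral_const,
        smul_eq_mul, Measure.real, mul_comm]
    rw [e]
    gcongr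
  intro M hMm hMc hM t
  refine (henergy t).trans (add_le_add le_rfl ?_)
  refine setIntegral_mono_ae (integrable_finsetSum _ fun j _ => (hpi j).div_const _).integrableOn
    (integrable_mul_continuous hκi hMc).integrableOn ?_
  have hM1 : ∀ s, 1 ≤ M s := fun s => le_trans (by simp [sq_nonneg]) (hM s)
  have hVM : ∀ s, S.nn p (V s) ≤ √(M s) := fun s =>
    Real.le_sqrt_of_sq_le (by linarith [hM s])
  have hτs : ∀ s, τ s ≤ s := delay_le hT hδ.le
  -- The majorant is increasing, so it also dominates the energy at the earlier time `τ s`.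
  have hV'M2 : ∀ s, 1 + S.nn p (V (τ s)) ^ 2 ≤ M s := fun s => (hM _).trans (hMm (hτs s))
  have hV'M : ∀ s, S.nn p (V (τ s)) ≤ √(M s) := fun s =>
    Real.le_sqrt_of_sq_le (by linarith [hV'M2 s])
  have hsqrt1 : ∀ s, 1 ≤ √(M s) := fun s => by
    rw [Real.one_le_sqrt]; exact hM1 s
  have hAM : ∀ s, S.nn q (A s (V (τ s))) ≤ √K * √(M s) := fun s => by
    rw [← Real.sqrt_mul hK]
    exact (H.coeff.nn_A_le hK s (hV'ne s)).trans
      (Real.sqrt_le_sqrt (mul_le_mul_of_nonneg_left (hV'M2 s) hK))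
  have hAj : ∀ j s, |A s (V (τ s)) (S.phi j)| ≤ √K * √(M s) * S.wt q j := fun j s =>
    (S.abs_apply_phi_le (H.coeff.A_ne_top s (hV'ne s)) j).trans
      (mul_le_mul_of_nonneg_right (hAM s) (S.wt_pos q j).le)
  have hf : ∀ᵐ r ∂(lamT T), ∀ j, |f j r| ≤ S.wt q j * ((√K + 2 * b r) * √(M r)) := by
    filter_upwards [hb] with r hr j
    have h1 := hr (V (τ r)) (hV'ne r) (fun v => G r (V (τ r)) v (S.phi j)) (S.wt p j)
      (S.wt_pos p j).le fun v => by
        rw [mul_comm]; exact S.abs_apply_phi_le (H.coeff.G_ne_top r (hV'ne r) v) j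
    have h2 : S.wt p j * ((1 + S.nn p (V (τ r))) * b r) ≤ S.wt q j * (2 * √(M r) * b r) := by
      have := S.wt_mono H.le j
      have := (S.wt_pos p j).le
      have := (S.wt_pos q j).le
      have := hb0 r
      have := S.nn_nonneg p (V (τ r))
      have : 1 + S.nn p (V (τ r)) ≤ 2 * √(M r) := by linarith [hV'M r, hsqrt1 r]
      gcongr
    refine (abs_add_le _ _).trans ((add_le_add (hAj j r) (h1.trans h2)).trans (le_of_eq ?_))
    ring
  have hbi' : Integrable (fun r => √K + 2 * b r) (lamT T) :=
    (integrable_const _).add (hbi.const_mul 2)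
  -- A coordinate moves little over one delay interval: the integrated rate there is at most `η`,
  -- and the size of the state is controlled by `M` at the end point.
  have hΔ : ∀ s j, |c j s - c j (τ s)| ≤ S.wt q j * √(M s) * η := by
    intro s j
    rw [hcf j s, hcf j (τ s), add_sub_add_left_eq_sub,
      setIntegral_le_sub_setIntegral_le (hfi j) (hτs s)]
    have hwM : 0 ≤ S.wt q j * √(M s) := mul_nonneg (S.wt_pos q j).le (Real.sqrt_nonneg _)
    calc |∫ r in Ioc (τ s) s, f j r ∂(lamT T)|
        ≤ ∫ r in Ioc (τ s) s, |f j r| ∂(lamT T) := abs_integral_le_integral_abs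
      _ ≤ ∫ r in Ioc (τ s) s, S.wt q j * √(M s) * (√K + 2 * b r) ∂(lamT T) := by
          refine integral_mono_ae (hfi j).abs.integrableOn (hbi'.const_mul _).integrableOn ?_
          filter_upwards [ae_restrict_of_ae hf, ae_restrict_mem measurableSet_Ioc] with r hr hrs
          refine (hr j).trans ?_
          have h1 : √(M r) ≤ √(M s) := Real.sqrt_le_sqrt (hMm hrs.2)
          have := hb0 r
          have := (S.wt_pos q j).le
          calc S.wt q j * ((√K + 2 * b r) * √(M r)) ≤ S.wt q j * ((√K + 2 * b r) * √(M s)) := by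
                gcongr
            _ = _ := by ring
      _ ≤ S.wt q j * √(M s) * η := by
          rw [integral_const_mul]
          exact mul_le_mul_of_nonneg_left (hη s) hwM
  have hint : ∀ᵐ s ∂(lamT T), ∀ j, Integrable
      (fun v => G s (V (τ s)) v (S.phi j) * ((g (s, v) : ℝ) - 1)) ν :=
    ae_all_iff.2 fun j => (H.integrable_G hR hV' hg (S.phi j)).prod_right_ae
  filter_upwards [hb, hint] with s hs hsi
  have hMs : √(M s) * √(M s) = M s := Real.mul_self_sqrt (zero_le_one.trans (hM1 s))
  -- Coercivity requires drift and test vector at the same state, so the drift is paired with the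
  -- delayed coordinates.
  have T1 : 2 * ∑ j ∈ Finset.range d, A s (V (τ s)) (S.phi j) * c j (τ s) / S.wt p j ^ 2
      ≤ K * M s := by
    rw [← apply_theta_galPath (S := S) d c (τ s) p]
    refine (H.coeff.coercive s _).trans (mul_le_mul_of_nonneg_left (hV'M2 s) hK)
  -- The error of that replacement. The weights `‖φ_j‖_q² / ‖φ_j‖_p²` may sum to something large as
  -- `d` grows; `hηd` says that the delay compensates.
  have T2 : ∑ j ∈ Finset.range d, 2 * (c j s - c j (τ s)) * A s (V (τ s)) (S.phi j)
      / S.wt p j ^ 2 ≤ M s := by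
    calc _ ≤ ∑ j ∈ Finset.range d, M s * (2 * η * √K * (S.wt q j ^ 2 / S.wt p j ^ 2)) := by
          refine Finset.sum_le_sum fun j _ => ?_
          have h1 : 2 * (c j s - c j (τ s)) * A s (V (τ s)) (S.phi j)
              ≤ 2 * ((S.wt q j * √(M s) * η) * (√K * √(M s) * S.wt q j)) := by
            rw [mul_assoc]
            refine mul_le_mul_of_nonneg_left ?_ two_pos.le
            refine (le_abs_self _).trans ?_
            rw [abs_mul]
            exact mul_le_mul (hΔ s j) (hAj j s) (abs_nonneg _)
              (mul_nonneg (mul_nonneg (S.wt_pos q j).le (Real.sqrt_nonneg _)) hη0)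
          have h2 : M s * (2 * η * √K * (S.wt q j ^ 2 / S.wt p j ^ 2))
              = 2 * ((S.wt q j * √(M s) * η) * (√K * √(M s) * S.wt q j)) / S.wt p j ^ 2 := by
            calc _ = √(M s) * √(M s) * (2 * η * √K * (S.wt q j ^ 2 / S.wt p j ^ 2)) := by rw [hMs]
              _ = _ := by ring
          rw [h2]
          exact div_le_div_of_nonneg_right h1 (by positivity)
      _ = M s * (2 * η * √K * ∑ j ∈ Finset.range d, S.wt q j ^ 2 / S.wt p j ^ 2) := by
          rw [Finset.mul_sum, Finset.mul_sum]
      _ ≤ M s := mul_le_of_le_one_right (zero_le_one.trans (hM1 s)) hηd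
  -- Cauchy–Schwarz in `Φ_{-p}` and the integrable rate give `‖V s‖ (1 + ‖V (τ s)‖) b ≤ 2 M b`,
  -- since `1 ≤ √M`.
  have T3 : 2 * ∑ j ∈ Finset.range d, c j s * ctrlTerm ν G g s (V (τ s)) (S.phi j)
      / S.wt p j ^ 2 ≤ 4 * b s * M s := by
    have h1 := hs (V (τ s)) (hV'ne s)
      (fun v => ∑ j ∈ Finset.range d, V s (S.phi j) * G s (V (τ s)) v (S.phi j) / S.wt p j ^ 2)
      (S.nn p (V s)) (S.nn_nonneg _ _)
      fun v => S.sum_mul_le (hVne s) (H.coeff.G_ne_top s (hV'ne s) v) d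
    have e : ∫ v, (∑ j ∈ Finset.range d, V s (S.phi j) * G s (V (τ s)) v (S.phi j)
          / S.wt p j ^ 2) * ((g (s, v) : ℝ) - 1) ∂ν
        = ∑ j ∈ Finset.range d, c j s * ctrlTerm ν G g s (V (τ s)) (S.phi j)
          / S.wt p j ^ 2 := by
      have e1 : ∀ v, (∑ j ∈ Finset.range d, V s (S.phi j) * G s (V (τ s)) v (S.phi j)
          / S.wt p j ^ 2) * ((g (s, v) : ℝ) - 1)
          = ∑ j ∈ Finset.range d, c j s / S.wt p j ^ 2 *
            (G s (V (τ s)) v (S.phi j) * ((g (s, v) : ℝ) - 1)) := fun v => by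
        rw [Finset.sum_mul]
        refine Finset.sum_congr rfl fun j hj => ?_
        simp only [V]
        rw [galPath_apply_phi, if_pos (Finset.mem_range.1 hj)]
        ring
      simp_rw [e1]
      rw [integral_finsetSum _ fun j _ => (hsi j).const_mul _]
      refine Finset.sum_congr rfl fun j _ => ?_
      rw [integral_const_mul, ctrlTerm]
      ring
    rw [e] at h1
    have h2 : S.nn p (V s) * ((1 + S.nn p (V (τ s))) * b s)
        ≤ √(M s) * (2 * √(M s) * b s) := by
      have := hb0 s
      have := S.nn_nonneg p (V (τ s))
      gcongr
      · exact hVM s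
      · linarith [hV'M s, hsqrt1 s]
    have h3 := (le_abs_self _).trans (h1.trans h2)
    calc _ ≤ 2 * (√(M s) * (2 * √(M s) * b s)) := by linarith
      _ = 4 * b s * (√(M s) * √(M s)) := by ring
      _ = _ := by rw [hMs]
  calc ∑ j ∈ Finset.range d, 2 * c j s * f j s / S.wt p j ^ 2
      = 2 * ∑ j ∈ Finset.range d, A s (V (τ s)) (S.phi j) * c j (τ s) / S.wt p j ^ 2
        + ∑ j ∈ Finset.range d, 2 * (c j s - c j (τ s)) * A s (V (τ s)) (S.phi j)
          / S.wt p j ^ 2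
        + 2 * ∑ j ∈ Finset.range d, c j s * ctrlTerm ν G g s (V (τ s)) (S.phi j)
          / S.wt p j ^ 2 := by
        rw [Finset.mul_sum, Finset.mul_sum, ← Finset.sum_add_distrib, ← Finset.sum_add_distrib]
        refine Finset.sum_congr rfl fun j _ => ?_
        simp only [f]; ring
    _ ≤ (K + 1 + 4 * b s) * M s := by linarith

end GalerkinBound

/-! ### Existence, uniqueness and selection by the skeleton map -/

section Existence

variable {Φ : Type*} [AddCommGroup Φ] [Module ℝ Φ] [UniformSpace Φ] [IsUniformAddGroup Φ]
  {X : Type*} [TopologicalSpace X] [PolishSpace X] [LocallyCompactSpace X]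
  [MeasurableSpace X] [BorelSpace X] {T : ℝ}
  {S : CHNS Φ} {ν : Measure X} [IsFiniteMeasureOnCompacts ν]
  {A : Icc (0 : ℝ) T → StrongDual ℝ Φ → StrongDual ℝ Φ}
  {G : Icc (0 : ℝ) T → StrongDual ℝ Φ → X → StrongDual ℝ Φ} {p q p₁ q₁ : ℕ} {K K₁ R : ℝ}
  {h₀ h₁ : Icc (0 : ℝ) T × X → ℝ} {N : ℕ} {X₀ : S.Neg p} {g g' : Control T ν}
  {Y Z : C(Icc (0 : ℝ) T, S.Neg p₁)}

/-- A delay so small that an absolutely continuous function oscillates by at most `η` over it. -/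
theorem exists_small_delay {f : Icc (0 : ℝ) T → ℝ} (hf : Integrable f (lamT T)) (hT : 0 ≤ T)
    {η ε : ℝ} (hη : 0 < η) (hε : 0 < ε) :
    ∃ δ, 0 < δ ∧ δ ≤ ε ∧ ∀ s, ∫ r in Ioc (delay hT δ s) s, f r ∂(lamT T) ≤ η := by
  have huc := CompactSpace.uniformContinuous_of_continuous (continuous_primitive_lamT hf)
  obtain ⟨δ, hδ, h⟩ := Metric.uniformContinuous_iff.1 huc η hη
  refine ⟨min (δ / 2) ε, by positivity, min_le_right _ _, fun s => ?_⟩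
  have hδ' : 0 ≤ min (δ / 2) ε := by positivity
  rw [← setIntegral_le_sub_setIntegral_le hf (delay_le hT hδ' s)]
  refine (le_abs_self _).trans (h (a := s) (b := delay hT (min (δ / 2) ε) s) ?_).le
  rw [Subtype.dist_eq, Real.dist_eq, abs_of_nonneg
    (sub_nonneg.2 (Subtype.coe_le_coe.2 (delay_le hT hδ' s)))]
  refine (sub_delay_le hT hδ' s).trans_lt ((min_le_left _ _).trans_lt (by linarith))

/-- Solutions exist and are bounded uniformly over controls of bounded cost. -/
theorem GrowthContext.exists_solution (H : GrowthContext S ν A G p q K h₀)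
    (hc₁ : CoeffCondition S ν A G p₁ q₁ K₁) (hpp₁ : p ≤ p₁) (hHS : S.InjectionHS p p₁)
    (hT : 0 ≤ T) {w : StrongDual ℝ Φ} (hw : S.negNorm p w ≠ ∞) (N : ℕ) :
    ∃ R, 0 ≤ R ∧ ∀ g : Icc (0 : ℝ) T × X → ℝ≥0, CostLE T ν N g →
      ∃ Y : C(Icc (0 : ℝ) T, S.Neg p₁),
        (∀ t, S.negNorm p (S.incl p₁ (Y t)) ≤ ENNReal.ofReal R) ∧
        ∀ x t, S.incl p₁ (Y t) x = w x + skInt ν A G g (fun s => S.incl p₁ (Y s)) x t := by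
  obtain ⟨B, hB, HB⟩ := H.exists_ctrl_bound N
  -- The radius from `galerkin_bound`: it involves the control only through `B`, hence only through
  -- `N`.
  refine ⟨√(2 * (1 + S.nn p w ^ 2)
    * Real.exp (2 * ((K + 1) * (lamT T univ).toReal + 4 * B))), Real.sqrt_nonneg _, fun g hg => ?_⟩
  obtain ⟨b, hb0, hbi, hbB, hb⟩ := HB g hg
  set E : ℕ → ℝ := fun d => ∑ j ∈ Finset.range d, S.wt q j ^ 2 / S.wt p j ^ 2
  have hE : ∀ d, 0 ≤ E d := fun d => Finset.sum_nonneg fun j _ => by positivity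
  -- Chosen so that the delay error in dimension `d` is at most the majorant; the added `1` keeps
  -- the denominator positive.
  set η : ℕ → ℝ := fun d => 1 / (2 * √K * E d + 1)
  have hη : ∀ d, 0 < η d := fun d => by have := hE d; positivity
  have hηd : ∀ d, 2 * η d * √K * E d ≤ 1 := fun d => by
    have h1 := hE d
    have h2 : 2 * η d * √K * E d = 2 * √K * E d / (2 * √K * E d + 1) := by
      simp only [η]; ring
    rw [h2, div_le_one (by positivity)]
    linarith
  -- The extra constraint `δ d ≤ 1 / (d + 1)` makes the delays vanish in the limit.
  choose δ hδ hδ1 hδη using fun d : ℕ => exists_small_delay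
    (f := fun r => √K + 2 * b r) ((integrable_const _).add (hbi.const_mul 2)) hT (hη d)
    (show (0 : ℝ) < 1 / ((d : ℝ) + 1) by positivity)
  choose c hcc hceq using fun d : ℕ => H.exists_galerkin hg hT d (hδ d) fun j => w (S.phi j)
  set Y : ℕ → C(Icc (0 : ℝ) T, S.Neg p₁) := fun d =>
    ⟨fun t => ∑ j ∈ Finset.range d, c d j t • S.basis p₁ j,
      continuous_finsetSum _ fun j _ => (hcc d j).smul continuous_const⟩
  have hYgal : ∀ d t, S.incl p₁ (Y d t) = galPath S d (c d) t := fun d t =>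
    S.incl_sum_basis p₁ d fun j => c d j t
  have hYb : ∀ d t, S.negNorm p (S.incl p₁ (Y d t)) ≤ ENNReal.ofReal √(2 * (1 + S.nn p w ^ 2)
      * Real.exp (2 * ((K + 1) * (lamT T univ).toReal + 4 * B))) := fun d t => by
    have h1 := H.galerkin_bound hg hT (hδ d) hw (hcc d) (hceq d) hb0 hbi hbB hb (hη d).le (hδη d)
      (hηd d) t
    rw [hYgal, ← S.ofReal_nn (nn_galPath_sq d (c d) t p).1]
    exact ENNReal.ofReal_le_ofReal (Real.le_sqrt_of_sq_le (by linarith))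
  obtain ⟨Y₀, -, -, -, hb₀, heq₀⟩ := H.exists_subseq_solution hc₁ hpp₁ hHS (Real.sqrt_nonneg _) w
    (Y := Y) (τ := fun d => delay hT (δ d)) (fun d => (continuous_delay hT (δ d)).measurable)
    (fun s => by
      rw [tendsto_iff_dist_tendsto_zero]
      refine squeeze_zero (fun d => dist_nonneg) (fun d => ?_)
        (tendsto_one_div_add_atTop_nhds_zero_nat (𝕜 := ℝ))
      rw [dist_comm, Subtype.dist_eq, Real.dist_eq, abs_of_nonneg
        (sub_nonneg.2 (Subtype.coe_le_coe.2 (delay_le hT (hδ d).le s)))]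
      exact (sub_delay_le hT (hδ d).le s).trans (hδ1 d))
    (fun _ => hg) hg (fun f => tendsto_const_nhds) hYb
    (fun d j => by
      simp_rw [hYgal, galPath_apply_phi]
      rcases lt_or_ge j d with h | h
      · left
        intro t
        rw [if_pos h]
        exact hceq d j t
      · right
        refine ⟨h, fun s t => ?_⟩
        rw [if_neg h.not_gt, if_neg h.not_gt])
  exact ⟨Y₀, hb₀, heq₀⟩

theorem boundedPath_of_continuousMap (hY : ∀ t, S.negNorm p (S.incl p₁ (Y t)) ≤ ENNReal.ofReal R) :
    BoundedPath S p R fun s => S.incl p₁ (Y s) :=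
  ⟨fun x => ((S.continuous_incl_apply p₁ x).comp Y.continuous).measurable, hY⟩

theorem GrowthContext.isSkeletonSolution (H : GrowthContext S ν A G p q K h₀) (hR : 0 ≤ R)
    (hg : CostLE T ν N g.1) (hY : ∀ t, S.negNorm p (S.incl p₁ (Y t)) ≤ ENNReal.ofReal R)
    (heq : ∀ x t, S.incl p₁ (Y t) x = S.incl p X₀ x
      + skInt ν A G g.1 (fun s => S.incl p₁ (Y s)) x t) :
    IsSkeletonSolution S ν A G p p₁ X₀ g Y where
  bounded := (iSup_le hY).trans_lt ENNReal.ofReal_lt_top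
  integrable_A := H.integrable_A hR (boundedPath_of_continuousMap hY)
  integrable_G := H.integrable_G hR (boundedPath_of_continuousMap hY) hg
  equation x t := by rw [heq x t, skInt, add_assoc]

theorem IsSkeletonSolution.exists_bound (h : IsSkeletonSolution S ν A G p p₁ X₀ g Y) :
    ∃ R₀, 0 ≤ R₀ ∧ ∀ R, R₀ ≤ R → ∀ t, S.negNorm p (S.incl p₁ (Y t)) ≤ ENNReal.ofReal R := by
  refine ⟨(⨆ t, S.negNorm p (S.incl p₁ (Y t))).toReal, ENNReal.toReal_nonneg, fun R hR t => ?_⟩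
  have h1 := le_iSup (fun t => S.negNorm p (S.incl p₁ (Y t))) t
  rw [← ENNReal.ofReal_toReal h.bounded.ne] at h1
  exact h1.trans (ENNReal.ofReal_le_ofReal hR)

theorem IsSkeletonSolution.apply_eq (h : IsSkeletonSolution S ν A G p p₁ X₀ g Y) (x : Φ)
    (t : Icc (0 : ℝ) T) : S.incl p₁ (Y t) x
      = S.incl p X₀ x + skInt ν A G g.1 (fun s => S.incl p₁ (Y s)) x t := by
  rw [h.equation x t, skInt, add_assoc]

theorem Control.exists_costLE (g : Control T ν) : ∃ N, CostLE T ν N g.1 := by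
  obtain ⟨N, hN⟩ := ENNReal.exists_nat_gt g.2.2.ne
  exact ⟨N, g.2.1, hN.le⟩

/-- The skeleton equation has at most one solution. -/
theorem IsSkeletonSolution.unique (H : GrowthContext S ν A G p q K h₀)
    (h₁tail : ExpTail (nuT T ν) h₁)
    (hlip : ∀ᵐ z ∂(nuT T ν), lipNorm S G q z ≤ ENNReal.ofReal (h₁ z))
    (hY : IsSkeletonSolution S ν A G p p₁ X₀ g Y) (hZ : IsSkeletonSolution S ν A G p p₁ X₀ g Z) :
    Y = Z := by
  obtain ⟨N, hN⟩ := g.exists_costLE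
  obtain ⟨R₁, hR₁, hYb⟩ := hY.exists_bound
  obtain ⟨R₂, hR₂, hZb⟩ := hZ.exists_bound
  ext1 t
  refine S.incl_injective p₁ (skeleton_unique H h₁tail hlip hN (le_max_of_le_left hR₁)
    (boundedPath_of_continuousMap (hYb (max R₁ R₂) (le_max_left _ _)))
    (boundedPath_of_continuousMap (hZb (max R₁ R₂) (le_max_right _ _)))
    (c := fun j => S.incl p X₀ (S.phi j)) (fun j t => hY.apply_eq _ t)
    (fun j t => hZ.apply_eq _ t) t)

/-- Being a solution depends only on the measure `ν_T^g`. -/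
theorem IsSkeletonSolution.congr_control (h : IsSkeletonSolution S ν A G p p₁ X₀ g Y)
    (hgg' : controlMeasure T ν g = controlMeasure T ν g') :
    IsSkeletonSolution S ν A G p p₁ X₀ g' Y := by
  have h1 : nuTg T ν g.1 = nuTg T ν g'.1 := congrArg Subtype.val hgg'
  have h2 : (fun z => (g.1 z : ℝ≥0∞)) =ᵐ[nuT T ν] fun z => (g'.1 z : ℝ≥0∞) :=
    (withDensity_eq_iff_of_sigmaFinite g.2.1.coe_nnreal_ennreal.aemeasurable
      g'.2.1.coe_nnreal_ennreal.aemeasurable).1 h1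
  have h3 : ∀ x : Φ, (fun z => G z.1 (S.incl p₁ (Y z.1)) z.2 x * ((g.1 z : ℝ) - 1))
      =ᵐ[nuT T ν] fun z => G z.1 (S.incl p₁ (Y z.1)) z.2 x * ((g'.1 z : ℝ) - 1) := fun x =>
    h2.mono fun z hz => by
      have : g.1 z = g'.1 z := ENNReal.coe_injective hz
      simp only [this]
  exact ⟨h.bounded, h.integrable_A, fun x => (h.integrable_G x).congr (h3 x), fun x t => by
    rw [h.equation x t, integral_congr_ae (ae_restrict_of_ae (h3 x))]⟩

/-- If the skeleton equation with control `g` has a solution, then the skeleton map selects one. -/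
theorem IsSkeletonSolution.skeletonMap (h : IsSkeletonSolution S ν A G p p₁ X₀ g Y) :
    IsSkeletonSolution S ν A G p p₁ X₀ g
      (skeletonMap S ν A G p p₁ X₀ (controlMeasure T ν g)) := by
  have hex : ∃ Y, ∃ g' : Control T ν, controlMeasure T ν g' = controlMeasure T ν g ∧
      IsSkeletonSolution S ν A G p p₁ X₀ g' Y := ⟨Y, g, rfl, h⟩
  rw [_root_.skeletonMap, dif_pos hex]
  obtain ⟨g', hg', hs⟩ := hex.choose_spec
  exact hs.congr_control hg'

/-- Coercivity at `φ = 0`, where `θ_p φ = 0`, gives the sign of the constant, which is not assumed.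
-/
theorem CoeffCondition.K_nonneg (h : CoeffCondition S ν A G p q K) (t : Icc (0 : ℝ) T) :
    0 ≤ K := by
  have h1 := h.coercive t 0
  rw [S.theta_apply_of_support (J := 0) fun j _ => S.coef_zero j, Finset.range_zero,
    Finset.sum_empty, mul_zero] at h1
  exact nonneg_of_mul_nonneg_left h1 (by positivity)

/-- Unfolds the two induced topologies: controls to measures, and measures to integrals of `C_c`
functions. -/
theorem Control.tendsto_integral {g : ℕ → Control T ν} {g₀ : Control T ν}
    (h : Tendsto g atTop (𝓝 g₀)) (f : C_c(Icc (0 : ℝ) T × X, ℝ)) : Tendsto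
      (fun n => ∫ z, f z ∂((nuT T ν).withDensity fun z => ((g n).1 z : ℝ≥0∞)))
      atTop (𝓝 (∫ z, f z ∂((nuT T ν).withDensity fun z => (g₀.1 z : ℝ≥0∞)))) := by
  have h1 : Continuous (controlMeasure T ν) := continuous_induced_dom
  have h2 : Continuous fun (μ : FCMeasure (Icc (0 : ℝ) T × X)) (f : C_c(Icc (0 : ℝ) T × X, ℝ)) =>
    ∫ y, f y ∂μ.1 := continuous_induced_dom
  exact (((continuous_apply f).comp (h2.comp h1)).tendsto g₀).comp h

end Existence

end

/-! ### Well-posedness and continuity of the skeleton map -/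

theorem mainTheorem6
    {Φ : Type*} [AddCommGroup Φ] [Module ℝ Φ] [UniformSpace Φ] [IsUniformAddGroup Φ] (S : CHNS Φ)
    {X : Type*} [TopologicalSpace X] [PolishSpace X] [LocallyCompactSpace X]
    [MeasurableSpace X] [BorelSpace X]
    (ν : Measure X) [IsFiniteMeasureOnCompacts ν]
    (T : ℝ) (hT : 0 < T)
    (A : Icc (0 : ℝ) T → StrongDual ℝ Φ → StrongDual ℝ Φ)
    (G : Icc (0 : ℝ) T → StrongDual ℝ Φ → X → StrongDual ℝ Φ)
    (hAG : MeasurableCoeff A G)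
    (p₀ : ℕ) (q : ℕ → ℕ) (K : ℕ → ℝ)
    (hcoeff : ∀ p, p₀ ≤ p → p ≤ q p ∧ CoeffCondition S ν A G p (q p) (K p))
    (p : ℕ) (hp : p₀ ≤ p)
    (hG0_meas : AEMeasurable (growthNorm S G p) (nuT T ν))
    (hG0 : ExpIntegrable ν (growthNorm S G p))
    (hG1_meas : AEMeasurable (lipNorm S G (q p)) (nuT T ν))
    (hG1 : ExpIntegrable ν (lipNorm S G (q p)))
    (X₀ : S.Neg p)
    (p₁ : ℕ) (hp₁ : p ≤ p₁) (hHS : S.InjectionHS p p₁) :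
    (∀ g : Control T ν,
      IsSkeletonSolution S ν A G p p₁ X₀ g
        (skeletonMap S ν A G p p₁ X₀ (controlMeasure T ν g)) ∧
      ∀ Y : C(Icc (0 : ℝ) T, S.Neg p₁), IsSkeletonSolution S ν A G p p₁ X₀ g Y →
        Y = skeletonMap S ν A G p p₁ X₀ (controlMeasure T ν g)) ∧
    ∀ (N : ℕ) (g : ℕ → Control T ν) (g₀ : Control T ν),
      (∀ n, g n ∈ SN T ν N) → g₀ ∈ SN T ν N → Tendsto g atTop (𝓝 g₀) →
      Tendsto (fun n => skeletonMap S ν A G p p₁ X₀ (controlMeasure T ν (g n))) atTop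
        (𝓝 (skeletonMap S ν A G p p₁ X₀ (controlMeasure T ν g₀))) := by
  have hpq := (hcoeff p hp).1
  have hc := (hcoeff p hp).2
  -- The conditions at level `p₁` are needed as well: limits of paths exist only in `Φ_{-p₁}`.
  have hc₁ := (hcoeff p₁ (hp.trans hp₁)).2
  obtain ⟨h₀, h₀tail, hgrowth⟩ := hG0.exists_expTail hG0_meas
  obtain ⟨h₁, h₁tail, hlip⟩ := hG1.exists_expTail hG1_meas
  have H : GrowthContext S ν A G p (q p) (K p) h₀ :=
    ⟨hAG, hpq, hc, hc.K_nonneg ⟨0, le_rfl, hT.le⟩, h₀tail, hgrowth⟩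
  have hex := H.exists_solution hc₁ hp₁ hHS hT.le (S.negNorm_incl_ne_top p X₀)
  have hsol : ∀ N, ∃ R, 0 ≤ R ∧ ∀ g : Control T ν, CostLE T ν N g.1 →
      IsSkeletonSolution S ν A G p p₁ X₀ g
        (skeletonMap S ν A G p p₁ X₀ (controlMeasure T ν g)) ∧
      ∀ t, S.negNorm p (S.incl p₁ (skeletonMap S ν A G p p₁ X₀ (controlMeasure T ν g) t))
        ≤ ENNReal.ofReal R := by
    intro N
    obtain ⟨R, hR, HR⟩ := hex N
    refine ⟨R, hR, fun g hg => ?_⟩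
    obtain ⟨Y, hYb, hYeq⟩ := HR g.1 hg
    have hY := H.isSkeletonSolution hR hg hYb hYeq
    refine ⟨hY.skeletonMap, ?_⟩
    -- The selected solution carries no bound by itself; uniqueness identifies it with the
    -- constructed one, whose radius depends only on `N`.
    rw [← hY.unique H h₁tail hlip hY.skeletonMap]
    exact hYb
  have hskel : ∀ g : Control T ν, IsSkeletonSolution S ν A G p p₁ X₀ g
      (skeletonMap S ν A G p p₁ X₀ (controlMeasure T ν g)) := fun g => by
    obtain ⟨N, hN⟩ := g.exists_costLE
    obtain ⟨R, -, HR⟩ := hsol N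
    exact (HR g hN).1
  refine ⟨fun g => ⟨hskel g, fun Y hY => hY.unique H h₁tail hlip (hskel g)⟩,
    fun N g g₀ hg hg₀ hlim => tendsto_of_subseq_tendsto fun ns hns => ?_⟩
  obtain ⟨R, hR, HR⟩ := hsol N
  have hgN : ∀ n, CostLE T ν N (g n).1 := fun n => ⟨(g n).2.1, hg n⟩
  have hg₀N : CostLE T ν N g₀.1 := ⟨g₀.2.1, hg₀⟩
  -- The exact solutions for the controls along a subsequence form a family of approximations with
  -- no delay and no truncation; the limit solves the equation for `g₀`, so uniqueness makes it
  -- independent of the subsequence.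
  obtain ⟨Y₀, σ, -, hYlim, hY₀b, hY₀eq⟩ := H.exists_subseq_solution hc₁ hp₁ hHS hR (S.incl p X₀)
    (Y := fun n => skeletonMap S ν A G p p₁ X₀ (controlMeasure T ν (g (ns n))))
    (τ := fun _ => id) (fun _ => measurable_id) (fun _ => tendsto_const_nhds)
    (g := fun n => (g (ns n)).1) (fun n => hgN (ns n)) hg₀N
    (Control.tendsto_integral (hlim.comp hns)) (fun n => (HR _ (hgN (ns n))).2)
    (fun n j => Or.inl fun t => (hskel (g (ns n))).apply_eq _ t)
  refine ⟨σ, ?_⟩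
  rw [← (H.isSkeletonSolution hR hg₀N hY₀b hY₀eq).unique H h₁tail hlip (hskel g₀)]
  exact hYlim
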